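/- **Setting.** Let $G$ be a complex reductive Lie group with Lie algebra $\mathfrak g$, let $B$ be a nondegenerate symmetric $\mathrm{Ad}(G)$-invariant bilinear form on $\mathfrak g$, used to identify $\mathfrak g^*\cong\mathfrak g$ (so $\mathrm{Ad}^*=\mathrm{Ad}$), and let $\Omega=\sum_i e_i\otimes e^i$ ($\{e_i\},\{e^i\}$ $B$-dual bases). Let $\mathfrak t\subset\mathfrak g$ be a Cartan subalgebra with roots $\Phi=\Phi_+\sqcup(-\Phi_+)$, root vectors $e_\alpha$ with $B(e_\alpha,e_{-\alpha})=1$, and $\mathfrak t'=\{s\in\mathfrak t:\alpha(s)\notin 2\pi i\mathbb Z\ \forall\alpha\in\Phi\}$. Let $\lambda\in\mathfrak t$, $\mathfrak h$ its centralizer, $\mathfrak g_1=[\mathfrak h,\mathfrak h]$ (so $\mathfrak h=\mathfrak g_1+\mathfrak t$), and $G_1\subset H\subset G$ the connected subgroups integrating $\mathfrak g_1\subset\mathfrak h$; $H$ acts on $G\times\mathfrak t'$ by $h\cdot(g,s)=(hg,s)$. For $\mathfrak k=\mathfrak g$ or $\mathfrak g_1$ let $\mathfrak k_{\rm nr}$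 be the set of $y\in\mathfrak k$ such that $\mathrm{ad}_y$ on $\mathfrak k$ has no eigenvalue in $2\pi i(\mathbb Z\setminus\{0\})$, let $r_{{\rm AM},\mathfrak k}(y)=(\mathrm{id}\otimes\phi(\mathrm{ad}_y))(\Omega_{\mathfrak k})$ for $y\in\mathfrak k_{\rm nr}$, $\phi(z)=-\frac1z+\frac12\coth\frac z2$, and let $r_{\mathfrak k}=\frac12\sum_\alpha(e_\alpha\otimes e_{-\alpha}-e_{-\alpha}\otimes e_\alpha)$, the sum over the $\alpha\in\Phi_+$ that are roots of $\mathfrak k$. Regard $r_{{\rm AM},\mathfrak g_1}$ as a function on $\mathfrak g$ through the $B$-orthogonal projection $\mathrm{pr}:\mathfrak g\to\mathfrak g_1$. **Bivectors.** With $B$-dual bases $\{t_j\},\{t^j\}$ of $\mathfrak t$, with $\partial/\partial t^j$ the derivative in the direction $t^j$, and $v\wedge w=v\otimes w-w\otimes v$, put on $G\times\mathfrak t'$ $$\pi(g,s)=\sum_j\frac{\partial}{\partial t^j}\wedge l_g(t_j)+l_g\big((\mathrm{id}\otimes\mathrm{ad}_s^{-1})(\Omega)\big),\qquad \pi_{\mathfrak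 k}(g,s)=\pi(g,s)+r_g\big(r_{{\rm AM},\mathfrak k}(\mathrm{Ad}_gs)\big)-r_g(r_{\mathfrak k}),$$ where $l_g,r_g$ are left and right translation and $\mathrm{ad}_s^{-1}$ is extended by $0$ to the centralizer of $s$; $\pi_{\mathfrak g}$ is defined on $G\times\mathfrak t'$, and $\pi_{\mathfrak g_1}$ where $\mathrm{pr}(\mathrm{Ad}_gs)\in(\mathfrak g_1)_{\rm nr}$. **Gauge equation.** Let $\rho$ be a holomorphic map to $G$ defined on $\mathfrak g_{\rm nr}$ (for instance the restriction of a holomorphic map $\mathfrak g^*\to G$). With $\theta=\rho^{-1}d\rho$, the relative gauge equation is $$r_{{\rm AM},\mathfrak g}-\mathrm{Ad}_{\rho^{-1}}^{\otimes2}(r_{{\rm AM},\mathfrak g_1})=(r_{\mathfrak g}-r_{\mathfrak g_1})^\rho$$ at all $x\in\mathfrak g_{\rm nr}$ with $\mathrm{pr}(x)\in(\mathfrak g_1)_{\rm nr}$, where $$r^\rho(x)=\sum_i\big(\theta_x(e^i)\otimes e_i-e_i\otimes\theta_x(e^i)\big)+\mathrm{Ad}_{\rho(x)^{-1}}^{\otimes2}r-\sum_{i,j}B(x,[e_i,e_j])\,\theta_x(e^i)\otimes\theta_x(e^j).$$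 $H$-equivariance of $\rho$ means $\rho(\mathrm{Ad}_hx)=h\rho(x)h^{-1}$ for $h\in H$, $x\in\mathfrak g_{\rm nr}$. Put $\nu_\rho(g,s)=(\rho(\mathrm{Ad}_gs)g,s)$ on $G\times\mathfrak t'$. A map $F:G\times\mathfrak t'\to G\times\mathfrak t'$ is called *locally symplectic* from $\pi_{\mathfrak g_1}$ to $\pi_{\mathfrak g}$ if it is holomorphic, $F_*\pi_{\mathfrak g_1}=\pi_{\mathfrak g}$ at every point where $\pi_{\mathfrak g_1}$ is defined, and $F$ is a local biholomorphism at every such point $p$ for which $\pi_{\mathfrak g}$ is nondegenerate at $F(p)$. **Proposition.** (a) Let $\rho$ be $H$-equivariant (for example, $H$-equivariant with $\rho=1$ on $\mathfrak g_1^*$). Then $\rho$ satisfies the relative gauge equation if and only if $\nu_\rho$ is an $H$-equivariant locally symplectic map from $(G\times\mathfrak t',\pi_{\mathfrak g_1})$ to $(G\times\mathfrak t',\pi_{\mathfrak g})$. (b) $\rho$ is $H$-equivariant, satisfies the relative gauge equation, and equals $1$ on $\mathfrak h\cap\mathfrak g_{\rm nr}$, if and only if $\nu_\rho$ is a relative Ginzburg–Weinstein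 linearization, that is, an $H$-equivariant locally symplectic map from $(G\times\mathfrak t',\pi_{\mathfrak g_1})$ to $(G\times\mathfrak t',\pi_{\mathfrak g})$ that restricts to the identity on $G_1\times\mathfrak t'$. -/

import Mathlib

open scoped Manifold ContDiff TensorProduct

namespace RelGW

noncomputable section

/-! ### The function `φ(z) = -1/z + (1/2) coth (z/2)` of an operator -/

section FunctionalCalculus

variable {A : Type*} [Ring A] [Algebra ℂ A] [TopologicalSpace A]

/-- The entire function `d(z) = (exp z - 1)/z = ∑ z^k/(k+1)!`. -/
def entireD (a : A) : A := ∑' k : ℕ, (((k + 1).factorial : ℂ)⁻¹) • a ^ k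

/-- The entire function `n(z) = (z (exp z + 1) - 2 (exp z - 1))/z^3 = ∑ (k+1)/(k+3)! z^k`. -/
def entireN (a : A) : A := ∑' k : ℕ, (((k : ℂ) + 1) / ((k + 3).factorial : ℂ)) • a ^ k

/-- `φ(a)` for `φ(z) = -1/z + (1/2) coth (z/2)`, extended by `φ(0) = 0`, written as the quotient
`z n(z) / (2 d(z))` of entire functions. It is meaningful when `d(a)` is invertible; for an
operator `a` this says that no eigenvalue of `a` is a nonzero multiple of `2 π i`. -/
def phi (a : A) : A := (1 / 2 : ℂ) • (a * entireN a * Ring.inverse (entireD a))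

end FunctionalCalculus

/-! ### Finite-dimensional Lie algebras with a bilinear form -/

section Quadratic

variable {L : Type*} [LieRing L] [LieAlgebra ℂ L] [FiniteDimensional ℂ L]

open Classical in
/-- The basis `e^i` of `L` dual to the standing basis `e_i = Module.finBasis ℂ L i` with respect to
a nondegenerate form `B` (and `0` if `B` is degenerate). -/
def dualVec (B : LinearMap.BilinForm ℂ L) (i : Fin (Module.finrank ℂ L)) : L :=
  if h : B.Nondegenerate then B.dualBasis h (Module.finBasis ℂ L) i else 0

/-- The Casimir element `Ω = ∑ e_i ⊗ e^i`. -/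
def casimir (B : LinearMap.BilinForm ℂ L) : L ⊗[ℂ] L :=
  ∑ i, Module.finBasis ℂ L i ⊗ₜ[ℂ] dualVec B i

/-- `f^∨ = (f ⊗ id)(Ω)` for `f ∈ L^*`. -/
def vee (B : LinearMap.BilinForm ℂ L) (f : Module.Dual ℂ L) : L :=
  TensorProduct.lid ℂ L (TensorProduct.map f LinearMap.id (casimir B))

/-- `y` is non-resonant: no eigenvalue of `ad y` lies in `2 π i (ℤ \ {0})`. -/
def NonResonant (y : L) : Prop :=
  ∀ n : ℤ, n ≠ 0 →
    ¬ Module.End.HasEigenvalue (LieAlgebra.ad ℂ L y) (2 * Real.pi * Complex.I * n)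

/-- The restriction of a bilinear form to a subalgebra. -/
def restrictForm (B : LinearMap.BilinForm ℂ L) (k : LieSubalgebra ℂ L) : LinearMap.BilinForm ℂ k :=
  LinearMap.compl₁₂ B (k.incl : k →ₗ[ℂ] L) (k.incl : k →ₗ[ℂ] L)

/-- The image of `x ∈ L ≅ L^*` under `L^* → k^*`, as a functional on the subalgebra `k`. -/
def restrictFunctional (B : LinearMap.BilinForm ℂ L) (k : LieSubalgebra ℂ L) (x : L) :
    Module.Dual ℂ k :=
  (B x) ∘ₗ (k.incl : k →ₗ[ℂ] L)

/-- The projection `L ≅ L^* → k^* ≅ k`, the last identification being given by `B` restricted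
to `k`; this is the `B`-orthogonal projection of `L` onto `k`. -/
def proj (B : LinearMap.BilinForm ℂ L) (k : LieSubalgebra ℂ L) (x : L) : k :=
  vee (restrictForm B k) (restrictFunctional B k x)

/-- `S` is the extension by `0` of the inverse of `ad x` on the `B`-orthogonal complement of the
centralizer of `x`. -/
structure IsAdInv (B : LinearMap.BilinForm ℂ L) (x : L) (S : L →ₗ[ℂ] L) : Prop where
  zero_of_centralizes : ∀ y, ⁅x, y⁆ = 0 → S y = 0
  mem_compl : ∀ y, (∀ z, ⁅x, z⁆ = 0 → B z y = 0) → ∀ z, ⁅x, z⁆ = 0 → B z (S y) = 0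
  right_inv : ∀ y, (∀ z, ⁅x, z⁆ = 0 → B z y = 0) → ⁅x, S y⁆ = y

open Classical in
/-- The operator `ad_x⁻¹`, extended by zero to the centralizer of `x`. -/
def adInv (B : LinearMap.BilinForm ℂ L) (x : L) : L →ₗ[ℂ] L :=
  if h : ∃ S, IsAdInv B x S then h.choose else 0

/-- The centralizer of an element. -/
def centralizer (l : L) : LieSubalgebra ℂ L where
  carrier := {x | ⁅l, x⁆ = 0}
  add_mem' := by intro a b ha hb; simp_all
  zero_mem' := by simp
  smul_mem' := by intro c x hx; simp_all
  lie_mem' := by intro a b ha hb; simp_all [leibniz_lie l a b]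

/-- The derived subalgebra `[k, k]` of a subalgebra `k`, as a subalgebra of `L`. -/
def derivedSubalgebra (k : LieSubalgebra ℂ L) : LieSubalgebra ℂ L :=
  LieSubalgebra.lieSpan ℂ L {z | ∃ x ∈ k, ∃ y ∈ k, ⁅x, y⁆ = z}

section AlekseevMeinrenken

variable [TopologicalSpace L] [IsTopologicalAddGroup L] [ContinuousSMul ℂ L] [T2Space L]

/-- The adjoint operator `ad y` as a continuous operator. -/
def adL (y : L) : L →L[ℂ] L := LinearMap.toContinuousLinearMap (LieAlgebra.ad ℂ L y)

/-- The Alekseev-Meinrenken dynamical r-matrix `f ↦ (id ⊗ φ(ad f^∨))(Ω)` on `L^*`. -/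
def rAM (B : LinearMap.BilinForm ℂ L) (f : Module.Dual ℂ L) : L ⊗[ℂ] L :=
  TensorProduct.map LinearMap.id ((phi (adL (vee B f)) : L →L[ℂ] L) : L →ₗ[ℂ] L) (casimir B)

end AlekseevMeinrenken

/-! ### Roots and the standard r-matrix -/

section Roots

variable (t : LieSubalgebra ℂ L) [t.IsCartanSubalgebra]

/-- The roots of `L` with respect to the Cartan subalgebra `t`. -/
def IsRoot (α : Module.Dual ℂ t) : Prop := α ≠ 0 ∧ LieAlgebra.rootSpace t α ≠ ⊥

/-- A system of positive roots: `Φ = Φ₊ ⊔ -Φ₊`, with `Φ₊` closed under addition inside `Φ`. -/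
structure IsPositiveSystem (P : Finset (Module.Dual ℂ t)) : Prop where
  isRoot : ∀ α ∈ P, IsRoot t α
  mem_or_neg_mem : ∀ α, IsRoot t α → α ∈ P ∨ -α ∈ P
  neg_notMem : ∀ α ∈ P, -α ∉ P
  add_mem : ∀ α ∈ P, ∀ β ∈ P, IsRoot t (α + β) → α + β ∈ P

/-- A choice of root vectors `e_α` with `B(e_α, e_{-α}) = 1`. -/
structure IsRootVectors (B : LinearMap.BilinForm ℂ L) (e : Module.Dual ℂ t → L) : Prop where
  mem_rootSpace : ∀ α, IsRoot t α → e α ∈ LieAlgebra.rootSpace t α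
  pairing : ∀ α, IsRoot t α → B (e α) (e (-α)) = 1

/-- The complement `t'` of the affine root hyperplanes. -/
def regularSet : Set t := {s | ∀ α, IsRoot t α → ∀ n : ℤ, α s ≠ 2 * Real.pi * Complex.I * n}

variable {t}

/-- The skew-symmetric part `∑_{α ∈ P} (e_α ⊗ e_{-α} - e_{-α} ⊗ e_α) / 2` of the standard
classical r-matrix attached to a set `P` of positive roots. -/
def rStd (e : Module.Dual ℂ t → L) (P : Finset (Module.Dual ℂ t)) : L ⊗[ℂ] L :=
  ∑ α ∈ P, (1 / 2 : ℂ) • (e α ⊗ₜ[ℂ] e (-α) - e (-α) ⊗ₜ[ℂ] e α)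

open Classical in
/-- The positive roots of the centralizer of `l ∈ t`. -/
def leviRoots (P : Finset (Module.Dual ℂ t)) (l : t) : Finset (Module.Dual ℂ t) :=
  P.filter fun α => α l = 0

end Roots

end Quadratic

/-! ### Complex Lie groups -/

section Group

variable (E : Type*) [NormedAddCommGroup E] [NormedSpace ℂ E]
  (G : Type*) [TopologicalSpace G] [ChartedSpace E G] [Group G]

/-- The Lie algebra `𝔤 = T_1 G` of left invariant vector fields on the complex Lie group `G`. Its
elements and its bracket are those of `GroupLieAlgebra`; the type synonym only serves to equip it
with the norm of the model space `E`, so that `𝔤` and its subspaces are complex manifolds. -/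
def LieAlg (E : Type*) [NormedAddCommGroup E] [NormedSpace ℂ E]
    (G : Type*) [TopologicalSpace G] [ChartedSpace E G] [Group G] : Type _ :=
  GroupLieAlgebra 𝓘(ℂ, E) G

instance : NormedAddCommGroup (LieAlg E G) := inferInstanceAs (NormedAddCommGroup E)

instance : NormedSpace ℂ (LieAlg E G) := inferInstanceAs (NormedSpace ℂ E)

instance [FiniteDimensional ℂ E] : FiniteDimensional ℂ (LieAlg E G) :=
  inferInstanceAs (FiniteDimensional ℂ E)

variable {E G} in
/-- The identity map from `LieAlg E G` to `GroupLieAlgebra 𝓘(ℂ, E) G`. -/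
def toGLA (x : LieAlg E G) : GroupLieAlgebra 𝓘(ℂ, E) G := x

instance [CompleteSpace E] [LieGroup 𝓘(ℂ, E) ω G] : LieRing (LieAlg E G) where
  bracket x y := (⁅toGLA x, toGLA y⁆ : GroupLieAlgebra 𝓘(ℂ, E) G)
  add_lie x y z := add_lie (toGLA x) (toGLA y) (toGLA z)
  lie_add x y z := lie_add (toGLA x) (toGLA y) (toGLA z)
  lie_self x := lie_self (toGLA x)
  leibniz_lie x y z := leibniz_lie (toGLA x) (toGLA y) (toGLA z)

instance [CompleteSpace E] [LieGroup 𝓘(ℂ, E) ω G] : LieAlgebra ℂ (LieAlg E G) where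
  lie_smul c x y := lie_smul c (toGLA x) (toGLA y)

variable {E G}

/-- The adjoint action: the differential at `1` of `x ↦ g x g⁻¹`. -/
def Ad (g : G) : LieAlg E G →L[ℂ] LieAlg E G :=
  mfderiv 𝓘(ℂ, E) 𝓘(ℂ, E) (fun x : G => g * x * g⁻¹) 1

/-- The differential `T_1 G → T_g G` of left translation by `g`. -/
def dLeft (g : G) : LieAlg E G →L[ℂ] TangentSpace 𝓘(ℂ, E) g :=
  mfderiv 𝓘(ℂ, E) 𝓘(ℂ, E) (fun x : G => g * x) 1

/-- The differential `T_1 G → T_g G` of right translation by `g`. -/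
def dRight (g : G) : LieAlg E G →L[ℂ] TangentSpace 𝓘(ℂ, E) g :=
  mfderiv 𝓘(ℂ, E) 𝓘(ℂ, E) (fun x : G => x * g) 1

/-- The left logarithmic derivative `ρ⁻¹ dρ` at `x` of a `G`-valued map on `𝔤`, that is, the
differential at `x` of `y ↦ ρ(x)⁻¹ ρ(y)`. -/
def logDeriv (ρ : LieAlg E G → G) (x : LieAlg E G) : LieAlg E G →L[ℂ] LieAlg E G :=
  mfderiv 𝓘(ℂ, LieAlg E G) 𝓘(ℂ, E) (fun y => (ρ x)⁻¹ * ρ y) x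

/-- `γ : ℝ → G` is a (real) one-parameter subgroup with initial velocity `ξ ∈ 𝔤`. -/
structure IsOneParameter (γ : ℝ → G) (ξ : LieAlg E G) : Prop where
  map_add : ∀ s s', γ (s + s') = γ s * γ s'
  hasMFDerivAt : HasMFDerivAt 𝓘(ℝ, ℝ) 𝓘(ℝ, E) γ 0 (ContinuousLinearMap.toSpanSingleton ℝ (ξ : E))

variable [FiniteDimensional ℂ E] [LieGroup 𝓘(ℂ, E) ω G]

/-- `⊗² Ad_g`. -/
def Ad₂ (g : G) : LieAlg E G ⊗[ℂ] LieAlg E G →ₗ[ℂ] LieAlg E G ⊗[ℂ] LieAlg E G :=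
  TensorProduct.map (Ad g).toLinearMap (Ad g).toLinearMap

/-- The Alekseev-Meinrenken r-matrix of a subalgebra `k` as a function on `𝔤 ≅ 𝔤^*` (through
`𝔤^* → k^*`) with values in `k ⊗ k ⊆ 𝔤 ⊗ 𝔤`. -/
def rAMsub (B : LinearMap.BilinForm ℂ (LieAlg E G)) (k : LieSubalgebra ℂ (LieAlg E G))
    (x : LieAlg E G) : LieAlg E G ⊗[ℂ] LieAlg E G :=
  TensorProduct.map (k.incl : k →ₗ[ℂ] LieAlg E G) (k.incl : k →ₗ[ℂ] LieAlg E G)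
    (rAM (restrictForm B k) (restrictFunctional B k x))

/-- The connected subgroup of `G` that integrates a subalgebra `k` of `𝔤`: the subgroup generated
by all `exp ξ`, `ξ ∈ k`. -/
def integralSubgroup (k : LieSubalgebra ℂ (LieAlg E G)) : Subgroup G :=
  Subgroup.closure {g | ∃ ξ ∈ k, ∃ γ : ℝ → G, IsOneParameter γ ξ ∧ γ 1 = g}

/-- The right-hand side `r^ρ` of the gauge equation,
`ρ₁⁻¹d₂ρ₁ - ρ₂⁻¹d₁ρ₂ + (⊗² Ad_ρ)⁻¹ r - ⟨id ⊗ id ⊗ x, [ρ₁⁻¹d₃ρ₁, ρ₂⁻¹d₃ρ₂]⟩`, where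
`ρ₁⁻¹d₂ρ₁ = ∑ ρ⁻¹∂_iρ ⊗ e_i`. Under `𝔤^* ≅ 𝔤` the coordinate direction `∂_i` on `𝔤^*` is the
direction `e^i` in `𝔤`, and the pairing with `x` is `B x`. -/
def gaugeTransform (B : LinearMap.BilinForm ℂ (LieAlg E G)) (ρ : LieAlg E G → G)
    (r : LieAlg E G ⊗[ℂ] LieAlg E G) (x : LieAlg E G) : LieAlg E G ⊗[ℂ] LieAlg E G :=
  (∑ i, logDeriv ρ x (dualVec B i) ⊗ₜ[ℂ] Module.finBasis ℂ (LieAlg E G) i)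
    - (∑ i, Module.finBasis ℂ (LieAlg E G) i ⊗ₜ[ℂ] logDeriv ρ x (dualVec B i))
    + Ad₂ (ρ x)⁻¹ r
    - ∑ i, ∑ j, B x ⁅Module.finBasis ℂ (LieAlg E G) i, Module.finBasis ℂ (LieAlg E G) j⁆ •
        (logDeriv ρ x (dualVec B i) ⊗ₜ[ℂ] logDeriv ρ x (dualVec B j))

/-! ### The bivectors on `G × t` -/

section Slice

variable (t : LieSubalgebra ℂ (LieAlg E G))

/-- The model with corners of the complex manifold `G × t`. -/
abbrev model := 𝓘(ℂ, E).prod 𝓘(ℂ, t)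

/-- The tangent space of `G × t`. -/
abbrev Tan (p : G × t) := TangentSpace (model t) p

variable {t}

/-- `l_g : 𝔤 → T_g G ⊆ T_{(g,s)}(G × t)`. -/
def leftVec (p : G × t) : LieAlg E G →ₗ[ℂ] Tan t p :=
  LinearMap.inl ℂ (TangentSpace 𝓘(ℂ, E) p.1) t ∘ₗ (dLeft p.1).toLinearMap

/-- `r_g : 𝔤 → T_g G ⊆ T_{(g,s)}(G × t)`. -/
def rightVec (p : G × t) : LieAlg E G →ₗ[ℂ] Tan t p :=
  LinearMap.inl ℂ (TangentSpace 𝓘(ℂ, E) p.1) t ∘ₗ (dRight p.1).toLinearMap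

/-- `t = T_s t ⊆ T_{(g,s)}(G × t)`. -/
def torusVec (p : G × t) : t →ₗ[ℂ] Tan t p := LinearMap.inr ℂ E t

/-- The wedge `v ∧ w = v ⊗ w - w ⊗ v`. -/
def wedge {V : Type*} [AddCommGroup V] [Module ℂ V] (v w : V) : V ⊗[ℂ] V :=
  v ⊗ₜ[ℂ] w - w ⊗ₜ[ℂ] v

/-- The bivector `π(g,s) = ∑ ∂/∂t^j ∧ l_g(t_j) + l_g((id ⊗ ad_s⁻¹)(Ω))` of the symplectic slice
`G × t'` of `T^*G`; `∂/∂t^j` is the direction of the dual basis vector `t^j` of `t`. -/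
def piSlice (B : LinearMap.BilinForm ℂ (LieAlg E G)) (p : G × t) : Tan t p ⊗[ℂ] Tan t p :=
  (∑ j, wedge (torusVec p (dualVec (restrictForm B t) j)) (leftVec p (Module.finBasis ℂ t j)))
    + TensorProduct.map (leftVec p) (leftVec p)
        (TensorProduct.map LinearMap.id (adInv B (p.2 : LieAlg E G)) (casimir B))

/-- `π + r_g(r_AM(Ad_g s)) - r_g(r)`, for the values `a = r_AM(Ad_g s)` and `r`. -/
def piModified (B : LinearMap.BilinForm ℂ (LieAlg E G)) (a : LieAlg E G → LieAlg E G ⊗[ℂ] LieAlg E G)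
    (r : LieAlg E G ⊗[ℂ] LieAlg E G) (p : G × t) : Tan t p ⊗[ℂ] Tan t p :=
  piSlice B p
    + TensorProduct.map (rightVec p) (rightVec p) (a (Ad p.1 (p.2 : LieAlg E G)))
    - TensorProduct.map (rightVec p) (rightVec p) r

/-- The bivector `π_𝔤`. -/
def piG (B : LinearMap.BilinForm ℂ (LieAlg E G)) (P : Finset (Module.Dual ℂ t))
    (e : Module.Dual ℂ t → LieAlg E G) (p : G × t) : Tan t p ⊗[ℂ] Tan t p :=
  piModified B (fun x => rAM B (B x)) (rStd e P) p

/-- The Levi subalgebra `𝔥`, the centralizer of `l ∈ t`. -/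
def levi (l : t) : LieSubalgebra ℂ (LieAlg E G) := centralizer (l : LieAlg E G)

/-- The semisimple part `𝔤₁ = [𝔥, 𝔥]` of `𝔥`. -/
def leviSS (l : t) : LieSubalgebra ℂ (LieAlg E G) := derivedSubalgebra (levi l)

/-- The bivector `π_{𝔤₁}`; it is defined where `Ad_g s` projects to a non-resonant element
of `𝔤₁`. -/
def piG1 (B : LinearMap.BilinForm ℂ (LieAlg E G)) (P : Finset (Module.Dual ℂ t))
    (e : Module.Dual ℂ t → LieAlg E G) (l : t) (p : G × t) : Tan t p ⊗[ℂ] Tan t p :=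
  piModified B (rAMsub B (leviSS l)) (rStd e (leviRoots P l)) p

/-- A bivector `P` on `V` is nondegenerate if `V^* → V`, `c ↦ (c ⊗ id)(P)`, is bijective. -/
def BivectorNondegenerate {V : Type*} [AddCommGroup V] [Module ℂ V] (P : V ⊗[ℂ] V) : Prop :=
  Function.Bijective fun c : Module.Dual ℂ V =>
    TensorProduct.lid ℂ V (TensorProduct.map c LinearMap.id P)

variable [t.IsCartanSubalgebra]

variable (t) in
/-- The open subset `G × t'` of `G × t`. -/
def slice : Set (G × t) := {p | p.2 ∈ regularSet t}

/-! ### Twists and linearizations -/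

/-- `ρ(Ad_h x) = h ρ(x) h⁻¹` for `h ∈ H` and non-resonant `x`. -/
def IsEquivariant (H : Subgroup G) (ρ : LieAlg E G → G) : Prop :=
  ∀ h ∈ H, ∀ x : LieAlg E G, NonResonant x → ρ (Ad h x) = h * ρ x * h⁻¹

/-- The relative gauge equation
`r_AM,𝔤 - (⊗² Ad_{ρ⁻¹}) r_AM,𝔤₁ = (r_𝔤 - r_𝔤₁)^ρ`, at all points where both dynamical r-matrices
are defined. -/
def GaugeEquation (B : LinearMap.BilinForm ℂ (LieAlg E G)) (P : Finset (Module.Dual ℂ t))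
    (e : Module.Dual ℂ t → LieAlg E G) (l : t) (ρ : LieAlg E G → G) : Prop :=
  ∀ x : LieAlg E G, NonResonant x → NonResonant (proj B (leviSS l) x) →
    rAM B (B x)
        - Ad₂ (ρ x)⁻¹ (rAMsub B (leviSS l) x)
      = gaugeTransform B ρ (rStd e P - rStd e (leviRoots P l)) x

/-- A relative Ginzburg-Weinstein twist: an `H`-equivariant solution of the relative gauge equation
that is trivial on `𝔥`. -/
structure IsRelativeTwist (B : LinearMap.BilinForm ℂ (LieAlg E G)) (P : Finset (Module.Dual ℂ t))
    (e : Module.Dual ℂ t → LieAlg E G) (l : t) (ρ : LieAlg E G → G) : Prop where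
  equivariant : IsEquivariant (integralSubgroup (levi l)) ρ
  gauge : GaugeEquation B P e l ρ
  eq_one : ∀ x ∈ levi l, NonResonant x → ρ x = 1

/-- The map `ν_ρ(g,s) = (ρ(Ad_g s) g, s)`. -/
def nu (ρ : LieAlg E G → G) (p : G × t) : G × t :=
  (ρ (Ad p.1 (p.2 : LieAlg E G)) * p.1, p.2)

/-- `F(h g, s) = h · F(g, s)` for `h ∈ H` on `G × t'`. -/
def IsSliceEquivariant (H : Subgroup G) (F : G × t → G × t) : Prop :=
  ∀ h ∈ H, ∀ p ∈ slice t, F (h * p.1, p.2) = (h * (F p).1, (F p).2)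

/-- `F : (G × t', π_{𝔤₁}) → (G × t', π_𝔤)` is holomorphic, maps the bivector `π_{𝔤₁}` to `π_𝔤`
wherever `π_{𝔤₁}` is defined, and is there a local biholomorphism at all points over which `π_𝔤`
is symplectic. -/
structure IsLocallySymplectic (B : LinearMap.BilinForm ℂ (LieAlg E G))
    (P : Finset (Module.Dual ℂ t)) (e : Module.Dual ℂ t → LieAlg E G) (l : t)
    (F : G × t → G × t) : Prop where
  mapsTo : Set.MapsTo F (slice t) (slice t)
  holomorphic : ContMDiffOn (model t) (model t) ω F (slice t)
  map_bivector : ∀ p ∈ slice t, NonResonant (proj B (leviSS l) (Ad p.1 (p.2 : LieAlg E G))) →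
    TensorProduct.map (mfderiv (model t) (model t) F p : Tan t p →ₗ[ℂ] Tan t (F p))
        (mfderiv (model t) (model t) F p : Tan t p →ₗ[ℂ] Tan t (F p)) (piG1 B P e l p)
      = piG B P e (F p)
  isLocalDiffeomorphAt : ∀ p ∈ slice t,
    NonResonant (proj B (leviSS l) (Ad p.1 (p.2 : LieAlg E G))) →
    BivectorNondegenerate (piG B P e (F p)) → IsLocalDiffeomorphAt (model t) (model t) ω F p

/-- A relative Ginzburg-Weinstein linearization: an `H`-equivariant locally symplectic map that
restricts to the identity on `G₁ × t'`. -/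
structure IsRelativeLinearization (B : LinearMap.BilinForm ℂ (LieAlg E G))
    (P : Finset (Module.Dual ℂ t)) (e : Module.Dual ℂ t → LieAlg E G) (l : t)
    (F : G × t → G × t) : Prop where
  equivariant : IsSliceEquivariant (integralSubgroup (levi l)) F
  symplectic : IsLocallySymplectic B P e l F
  eq_self : ∀ p ∈ slice t, p.1 ∈ integralSubgroup (leviSS l) → F p = p

end Slice

end Group

end

end RelGW

/-! Trivialize T_(g,s)(G × t) by left translation as 𝔤 × t. The moment map (g, s) ↦ Ad_g s has
differential (ξ, η) ↦ Ad_g([ξ, s] + η), so the differential of ν_ρ is (ξ, η) ↦ (ξ + θ'([ξ, s] + η),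
η), where x = Ad_g s and θ' = Ad_g⁻¹ θ_x Ad_g (`hasMFDerivAt_nu`). Pushing π forward along this
linear map adds exactly (θ' ⊗ 1)Ω - (1 ⊗ θ')Ω + (θ' ⊗ θ')(ad_s ⊗ 1)Ω
(`map_twistMap_trivialBivector`). Conjugated by Ad_g, these are the θ terms of the gauge transform
at x (`gaugeTransform_eq`).

On the remaining part of π_{𝔤₁}, the right translate of r_AM,𝔤₁ - r_𝔤₁, the differential acts
through 1 - θ_x ad_x. Differentiating H-equivariance gives θ_x[ζ, x] = Ad_ρ⁻¹ ζ - ζ for ζ ∈ 𝔥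
(`logDeriv_lie`), so on 𝔥 this operator is Ad_ρ⁻¹. Since both r-matrices of 𝔤₁ lie in 𝔥 ⊗ 𝔥, this
yields the Ad_ρ⁻¹ terms of the gauge equation. Together with the Ad-equivariance of r_AM,𝔤 this
shows, point by point, that ν_ρ maps the bivectors to each other at (g, s) if and only if the gauge
equation holds at Ad_g s (`map_piG1_eq_iff`).

One direction follows at once. The local biholomorphism property is automatic: a nondegenerate
bivector in the image of dν_ρ ⊗ dν_ρ forces dν_ρ to be onto, and the inverse function theorem
applies. For the converse, conditions on ν_ρ control ρ only on Ad_G t'. This set contains a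
neighbourhood of each s ∈ t', because (u, y) ↦ exp(ad u)(s + y) is a submersion
(`eventually_exists_Ad_eq`). The non-resonant domains are open and connected, since a complex line
through one of their points leaves them only in a countable set (`isPreconnected_gaugeDomain`), so
the identity theorem extends everything to the full domain. The same argument recovers the
equivariance of ρ and, with 𝔥 and G₁ for 𝔤 and G, the equality ρ = 1 on 𝔥. -/

namespace RelGW

/-! ### Reductive Lie algebras: elements of a Cartan subalgebra act semisimply. -/

section Reductive

open LieAlgebra Module.End

variable {L : Type*} [LieRing L] [LieAlgebra ℂ L]

/-- The quotient map by the center, as a Lie algebra homomorphism. -/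
def modCenter : L →ₗ⁅ℂ⁆ L ⧸ center ℂ L where
  toLinearMap := (LieSubmodule.Quotient.mk' (center ℂ L) : L →ₗ[ℂ] L ⧸ center ℂ L)
  map_lie' := by intro x y; rfl

theorem modCenter_surjective : Function.Surjective (modCenter (L := L)) :=
  LieSubmodule.Quotient.surjective_mk' (center ℂ L)

theorem modCenter_eq_zero_iff (x : L) : modCenter x = 0 ↔ x ∈ center ℂ L :=
  LieSubmodule.Quotient.mk_eq_zero'

theorem mem_center_iff_lie (x : L) : x ∈ center ℂ L ↔ ∀ y : L, ⁅x, y⁆ = 0 := by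
  rw [LieModule.mem_maxTrivSubmodule]
  exact forall_congr' fun y => by rw [← lie_skew, neg_eq_zero]

variable [FiniteDimensional ℂ L] [HasCentralRadical ℂ L]

/-- The preimage J of an abelian ideal has [J, J] central, so its second derived ideal vanishes.
Hence J is solvable and lies in the radical, which is the center, and the abelian ideal is zero. -/
instance hasTrivialRadical_quotient_center : HasTrivialRadical ℂ (L ⧸ center ℂ L) := by
  rw [hasTrivialRadical_iff_no_abelian_ideals]
  intro I hI
  let J : LieIdeal ℂ L := I.comap modCenter
  have hIz : ∀ x ∈ I, ∀ y ∈ I, ⁅x, y⁆ = 0 := fun x hx y hy => by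
    have := hI.trivial (⟨x, hx⟩ : I) (⟨y, hy⟩ : I)
    simpa using congrArg Subtype.val this
  have hJ1 : ⁅J, J⁆ ≤ center ℂ L := by
    rw [LieSubmodule.lieIdeal_oper_eq_span, LieSubmodule.lieSpan_le]
    rintro _ ⟨x, y, rfl⟩
    rw [SetLike.mem_coe, ← modCenter_eq_zero_iff, LieHom.map_lie]
    exact hIz _ (LieIdeal.mem_comap.1 x.2) _ (LieIdeal.mem_comap.1 y.2)
  have hsol : IsSolvable J := by
    refine IsSolvable.mk (k := 2) ((LieIdeal.derivedSeries_eq_bot_iff J 2).mpr ?_)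
    rw [derivedSeriesOfIdeal_succ, derivedSeriesOfIdeal_succ, derivedSeriesOfIdeal_zero, eq_bot_iff,
      LieSubmodule.lieIdeal_oper_eq_span, LieSubmodule.lieSpan_le]
    rintro _ ⟨x, y, rfl⟩
    have := (mem_center_iff_lie (x : L)).1 (hJ1 x.2) y
    simpa using this
  have hle : J ≤ center ℂ L := by
    rw [← HasCentralRadical.radical_eq_center (R := ℂ) (L := L)]
    exact (LieIdeal.solvable_iff_le_radical ℂ L J).1 hsol
  rw [eq_bot_iff]
  intro x hx
  obtain ⟨y, rfl⟩ := modCenter_surjective x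
  have : y ∈ J := LieIdeal.mem_comap.2 hx
  simpa using (modCenter_eq_zero_iff y).2 (hle this)

omit [FiniteDimensional ℂ L] [HasCentralRadical ℂ L] in
theorem center_le_cartan (t : LieSubalgebra ℂ L) [t.IsCartanSubalgebra] {x : L}
    (hx : x ∈ center ℂ L) : x ∈ t := by
  rw [← LieSubalgebra.IsCartanSubalgebra.self_normalizing (H := t),
    LieSubalgebra.mem_normalizer_iff]
  intro y _
  rw [(mem_center_iff_lie x).1 hx]
  exact t.zero_mem

omit [FiniteDimensional ℂ L] [HasCentralRadical ℂ L] in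
-- A Cartan subalgebra contains the center, so an element that normalizes the image modulo the
-- center already normalizes the subalgebra upstairs.
theorem isCartanSubalgebra_map_modCenter (t : LieSubalgebra ℂ L) [t.IsCartanSubalgebra] :
    (t.map modCenter).IsCartanSubalgebra where
  nilpotent := by
    let f : t →ₗ⁅ℂ⁆ t.map (modCenter (L := L)) :=
      { toFun := fun x => ⟨modCenter (x : L), x, x.2, rfl⟩
        map_add' := fun x y => by ext; simp
        map_smul' := fun c x => by ext; simp
        map_lie' := fun {x y} => by ext; simp }
    have hf : Function.Surjective f := by
      rintro ⟨_, x, hx, rfl⟩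
      exact ⟨⟨x, hx⟩, rfl⟩
    exact hf.lieAlgebra_isNilpotent
  self_normalizing := by
    refine le_antisymm ?_ (LieSubalgebra.le_normalizer _)
    intro x hx
    obtain ⟨x, rfl⟩ := modCenter_surjective x
    rw [LieSubalgebra.mem_normalizer_iff] at hx
    refine ⟨x, ?_, rfl⟩
    have : x ∈ t.normalizer := by
      rw [LieSubalgebra.mem_normalizer_iff]
      intro y hy
      obtain ⟨w, hw, hw'⟩ := hx (modCenter y) ⟨y, hy, rfl⟩
      have hwz : ⁅x, y⁆ - w ∈ center ℂ L := by
        rw [← modCenter_eq_zero_iff, map_sub, LieHom.map_lie, sub_eq_zero]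
        exact hw'.symm
      have hwt : ⁅x, y⁆ - w ∈ t := center_le_cartan t hwz
      simpa using t.add_mem hwt hw
    rwa [LieSubalgebra.IsCartanSubalgebra.self_normalizing] at this

variable (B : LinearMap.BilinForm ℂ L)

/-- A linear form that vanishes on the center and on all brackets is zero. -/
theorem eq_zero_of_center_of_lie (f : L →ₗ[ℂ] ℂ) (hz : ∀ w ∈ center ℂ L, f w = 0)
    (hb : ∀ x y : L, f ⁅x, y⁆ = 0) : f = 0 := by
  let f' : (L ⧸ center ℂ L) →ₗ[ℂ] ℂ := Submodule.liftQ (center ℂ L).toSubmodule f hz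
  have hf' : ∀ x, f' (modCenter x) = f x := fun x => rfl
  -- The induced form on the semisimple quotient is κ(u, ·). Vanishing on brackets means κ([u, x],
  -- y) = 0 for all x and y, so u is central and therefore zero.
  have hκ := IsKilling.killingForm_nondegenerate ℂ (L ⧸ center ℂ L)
  obtain ⟨u, hu⟩ := ((killingForm ℂ (L ⧸ center ℂ L)).toDual hκ).surjective f'
  have hu' : ∀ y, killingForm ℂ (L ⧸ center ℂ L) u y = f' y := fun y => by rw [← hu]; rfl
  have hu0 : u = 0 := by
    have : u ∈ center ℂ (L ⧸ center ℂ L) := by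
      rw [mem_center_iff_lie]
      intro x
      refine hκ.1 _ fun y => ?_
      rw [LieModule.traceForm_apply_lie_apply, hu']
      obtain ⟨x, rfl⟩ := modCenter_surjective x
      obtain ⟨y, rfl⟩ := modCenter_surjective y
      rw [← LieHom.map_lie, hf', hb]
    simpa using this
  ext x
  rw [← hf', ← hu', hu0]
  simp

/-- By invariance, B(u, ·) vanishes on the center because u is a combination of brackets, and on
brackets because u is central. So it vanishes identically. -/
theorem eq_zero_of_mem_center_of_mem_span_lie (hnd : B.Nondegenerate)
    (hinv : ∀ x y z, B ⁅x, y⁆ z = B x ⁅y, z⁆) {u : L} (hu : u ∈ center ℂ L)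
    (hu' : u ∈ Submodule.span ℂ {z : L | ∃ x y : L, ⁅x, y⁆ = z}) : u = 0 := by
  have hzz : ∀ w ∈ center ℂ L, B u w = 0 := by
    intro w hw
    rw [mem_center_iff_lie] at hw
    suffices h : Submodule.span ℂ {z : L | ∃ x y : L, ⁅x, y⁆ = z} ≤ LinearMap.ker (B.flip w) from
      h hu'
    rw [Submodule.span_le]
    rintro _ ⟨x, y, rfl⟩
    change B ⁅x, y⁆ w = 0
    rw [hinv, ← lie_skew, hw, neg_zero, map_zero]
  have := eq_zero_of_center_of_lie (B u) hzz fun x y => by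
    rw [← hinv, (mem_center_iff_lie u).1 hu]; simp
  exact hnd.1 _ fun y => by rw [this]; rfl

/-- In a Lie algebra with central radical, the generalized eigenspaces of `ad s` for `s` in a
Cartan subalgebra are eigenspaces. -/
theorem lie_eq_smul_of_mem_maxGenEigenspace (hnd : B.Nondegenerate)
    (hinv : ∀ x y z, B ⁅x, y⁆ z = B x ⁅y, z⁆) (t : LieSubalgebra ℂ L) [t.IsCartanSubalgebra]
    {s : L} (hs : s ∈ t) {μ : ℂ} {y : L} (hy : y ∈ (ad ℂ L s).maxGenEigenspace μ) :
    ⁅s, y⁆ = μ • y := by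
  have := isCartanSubalgebra_map_modCenter t
  have hss := IsKilling.isSemisimple_ad_of_mem_isCartanSubalgebra (K := ℂ)
    (H := t.map (modCenter (L := L))) (x := modCenter s) ⟨s, hs, rfl⟩
  have hy' : modCenter y ∈ (ad ℂ (L ⧸ center ℂ L) (modCenter s)).maxGenEigenspace μ := by
    rw [mem_maxGenEigenspace] at hy ⊢
    obtain ⟨k, hk⟩ := hy
    refine ⟨k, ?_⟩
    have : ∀ (k : ℕ) (z : L), ((ad ℂ (L ⧸ center ℂ L) (modCenter s) - μ • 1) ^ k) (modCenter z) =
        modCenter (((ad ℂ L s - μ • 1) ^ k) z) := by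
      intro k
      induction k with
      | zero => simp
      | succ k ih => intro z; rw [pow_succ, pow_succ, Module.End.mul_apply, Module.End.mul_apply, ← ih]; simp
    rw [this, hk, map_zero]
  rw [hss.isFinitelySemisimple.maxGenEigenspace_eq_eigenspace, mem_eigenspace_iff] at hy'
  -- Semisimplicity downstairs makes the defect [s, y] - μy central. For μ = 0 it is also a bracket,
  -- hence zero; for μ ≠ 0 it lies in the generalized eigenspaces for both μ and 0, which are
  -- disjoint.
  have hz : ⁅s, y⁆ - μ • y ∈ center ℂ L := by
    rw [← modCenter_eq_zero_iff, map_sub, LieHom.map_lie, map_smul, sub_eq_zero]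
    exact hy'
  rcases eq_or_ne μ 0 with rfl | hμ
  · rw [zero_smul, sub_zero] at *
    exact eq_zero_of_mem_center_of_mem_span_lie B hnd hinv hz (Submodule.subset_span ⟨s, y, rfl⟩)
  · have h1 : (ad ℂ L s) (⁅s, y⁆ - μ • y) = 0 := by
      rw [ad_apply, ← lie_skew, (mem_center_iff_lie _).1 hz, neg_zero]
    have h2 : ⁅s, y⁆ - μ • y ∈ (ad ℂ L s).maxGenEigenspace μ := by
      refine Submodule.sub_mem _ ?_ (Submodule.smul_mem _ _ hy)
      exact mapsTo_maxGenEigenspace_of_comm (Commute.refl (ad ℂ L s)) μ hy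
    have h3 : ⁅s, y⁆ - μ • y ∈ (ad ℂ L s).maxGenEigenspace 0 := by
      rw [mem_maxGenEigenspace]
      exact ⟨1, by simpa using h1⟩
    have := (disjoint_genEigenspace (ad ℂ L s) hμ ⊤ ⊤).le_bot ⟨h2, h3⟩
    exact sub_eq_zero.1 (by simpa using this)

end Reductive

end RelGW

namespace RelGW

/-! ### Root decomposition, regular elements and the operator `adInv`. -/

section Roots

open LieAlgebra Module.End

variable {L : Type*} [LieRing L] [LieAlgebra ℂ L] [FiniteDimensional ℂ L]

/-- `B` is a nondegenerate symmetric form that is invariant under the adjoint action of `L`. -/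
structure IsInvariantForm (B : LinearMap.BilinForm ℂ L) : Prop where
  nondegenerate : B.Nondegenerate
  symm : ∀ x y, B x y = B y x
  lie : ∀ x y z, B ⁅x, y⁆ z = B x ⁅y, z⁆

theorem exists_linear_of_rootSpace_ne_bot (t : LieSubalgebra ℂ L) [t.IsCartanSubalgebra]
    {α : t → ℂ} (hα : rootSpace t α ≠ ⊥) : ∃ α' : Module.Dual ℂ t, ⇑α' = α :=
  ⟨(LieModule.Weight.mk (R := ℂ) (L := t) (M := L) α hα).toLinear, rfl⟩

theorem finite_isRoot (t : LieSubalgebra ℂ L) [t.IsCartanSubalgebra] :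
    {α : Module.Dual ℂ t | IsRoot t α}.Finite := by
  have := LieModule.finite_genWeightSpace_ne_bot ℂ t L
  refine Set.Finite.of_finite_image (f := fun α => (α : t → ℂ)) (this.subset ?_) ?_
  · rintro _ ⟨α, hα, rfl⟩
    exact hα.2
  · intro α _ β _ h
    exact DFunLike.coe_injective h

/-- The weight spaces span L and the one of weight zero is t. Any other nonzero one has a linear
weight, so it belongs to a root in the sense of `IsRoot`. -/
theorem rootSpace_induction (t : LieSubalgebra ℂ L) [t.IsCartanSubalgebra] {p : L → Prop}
    (h0 : ∀ y ∈ t, p y) (hr : ∀ α : Module.Dual ℂ t, IsRoot t α → ∀ y ∈ rootSpace t α, p y)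
    (hadd : ∀ x y, p x → p y → p (x + y)) (y : L) : p y := by
  have hy : y ∈ ⨆ α : t → ℂ, rootSpace t α := by
    simp [LieModule.iSup_genWeightSpace_eq_top]
  induction hy using LieSubmodule.iSup_induction' with
  | mem α y hy =>
    rcases eq_or_ne α 0 with rfl | hα
    · refine h0 y ?_
      rw [rootSpace_zero_eq] at hy
      exact hy
    · by_cases hb : rootSpace t α = ⊥
      · rw [hb, LieSubmodule.mem_bot] at hy
        exact hy ▸ h0 0 t.zero_mem
      · obtain ⟨α', rfl⟩ := exists_linear_of_rootSpace_ne_bot t hb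
        exact hr α' ⟨fun h => hα (by rw [h]; rfl), hb⟩ y hy
  | zero => exact h0 0 t.zero_mem
  | add x y _ _ hx hy => exact hadd x y hx hy

variable [HasCentralRadical ℂ L] {B : LinearMap.BilinForm ℂ L} (hB : IsInvariantForm B)
  (t : LieSubalgebra ℂ L) [t.IsCartanSubalgebra]
include hB

theorem lie_of_mem_rootSpace {α : t → ℂ} {y : L} (hy : y ∈ rootSpace t α) (s : t) :
    ⁅(s : L), y⁆ = α s • y :=
  lie_eq_smul_of_mem_maxGenEigenspace B hB.nondegenerate hB.lie t s.2
    (LieModule.genWeightSpace_le_genWeightSpaceOf L s α hy)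

theorem lie_eq_zero_of_mem_cartan {s s' : L} (hs : s ∈ t) (hs' : s' ∈ t) : ⁅s, s'⁆ = 0 := by
  have := lie_of_mem_rootSpace hB t (α := 0) (y := s') (by rw [rootSpace_zero_eq]; exact hs') ⟨s, hs⟩
  simpa using this

/-- On the root space of α the operator ad s is multiplication by α(s) ≠ 0. The resulting
decomposition L = t + [s, L] takes the place of the root decomposition in most later arguments. -/
theorem exists_add_lie_of_regular {s : t} (hs : ∀ α, IsRoot t α → α s ≠ 0) (y : L) :
    ∃ y₀ ∈ t, ∃ z : L, y = y₀ + ⁅(s : L), z⁆ := by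
  induction y using rootSpace_induction t with
  | h0 y hy => exact ⟨y, hy, 0, by simp⟩
  | hr α hα y hy =>
    refine ⟨0, t.zero_mem, (α s)⁻¹ • y, ?_⟩
    rw [lie_smul, lie_of_mem_rootSpace hB t hy, smul_smul, inv_mul_cancel₀ (hs α hα), one_smul,
      zero_add]
  | hadd x y hx hy =>
    obtain ⟨x₀, hx₀, x₁, rfl⟩ := hx
    obtain ⟨y₀, hy₀, y₁, rfl⟩ := hy
    exact ⟨x₀ + y₀, t.add_mem hx₀ hy₀, x₁ + y₁, by rw [lie_add]; abel⟩

/-- Semisimplicity of ad s at the eigenvalue 0: the intersection of its kernel and its image is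
zero. -/
theorem lie_eq_zero_of_lie_lie_eq_zero {s z : L} (hs : s ∈ t) (h : ⁅s, ⁅s, z⁆⁆ = 0) :
    ⁅s, z⁆ = 0 := by
  have := lie_eq_smul_of_mem_maxGenEigenspace B hB.nondegenerate hB.lie t hs (μ := 0) (y := z) (by
    rw [mem_maxGenEigenspace]
    exact ⟨2, by simpa [pow_two] using h⟩)
  simpa using this

theorem mem_cartan_of_lie_eq_zero {s : t} (hs : ∀ α, IsRoot t α → α s ≠ 0) {y : L}
    (hy : ⁅(s : L), y⁆ = 0) : y ∈ t := by
  obtain ⟨y₀, hy₀, z, rfl⟩ := exists_add_lie_of_regular hB t hs y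
  rw [lie_add, lie_eq_zero_of_mem_cartan hB t s.2 hy₀, zero_add] at hy
  rw [lie_eq_zero_of_lie_lie_eq_zero hB t s.2 hy, add_zero]
  exact hy₀

theorem cartan_orthogonal_lie {s x : L} (hs : s ∈ t) (hx : x ∈ t) (z : L) :
    B x ⁅s, z⁆ = 0 := by
  rw [← hB.lie, lie_eq_zero_of_mem_cartan hB t hx hs]
  simp

theorem restrictForm_nondegenerate_of_regular {s : t} (hs : ∀ α, IsRoot t α → α s ≠ 0) :
    (restrictForm B t).Nondegenerate := by
  have hsep : ∀ x : t, (∀ y : t, B x y = 0) → x = 0 := by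
    intro x hx
    refine Subtype.ext (hB.nondegenerate.1 _ fun y => ?_)
    obtain ⟨y₀, hy₀, z, rfl⟩ := exists_add_lie_of_regular hB t hs y
    rw [map_add, cartan_orthogonal_lie hB t s.2 x.2, add_zero]
    exact hx ⟨y₀, hy₀⟩
  refine ⟨hsep, fun x hx => hsep x fun y => ?_⟩
  rw [hB.symm]
  exact hx y

theorem mem_range_lie_of_orthogonal {s : t} (hs : ∀ α, IsRoot t α → α s ≠ 0) {y : L}
    (hy : ∀ z ∈ t, B z y = 0) : ∃ z, y = ⁅(s : L), z⁆ := by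
  obtain ⟨y₀, hy₀, z, rfl⟩ := exists_add_lie_of_regular hB t hs y
  have h0 : y₀ = 0 := by
    refine hB.nondegenerate.1 _ fun w => ?_
    obtain ⟨w₀, hw₀, w₁, rfl⟩ := exists_add_lie_of_regular hB t hs w
    rw [map_add, cartan_orthogonal_lie hB t s.2 hy₀, add_zero, hB.symm]
    have := hy w₀ hw₀
    rwa [map_add, cartan_orthogonal_lie hB t s.2 hw₀, add_zero] at this
  exact ⟨z, by rw [h0, zero_add]⟩

/-- Let p be the projection onto t along [s, L]. Then ad s + p is invertible, and S = (ad s + p)⁻¹ -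
p works: it is 1 - 1 = 0 on t and inverts ad s on [s, L], which is the orthogonal complement of t.
-/
theorem exists_isAdInv {s : t} (hs : ∀ α, IsRoot t α → α s ≠ 0) :
    ∃ S, IsAdInv B (s : L) S := by
  set a : L →ₗ[ℂ] L := ad ℂ L (s : L) with ha
  have hdisj : ∀ y ∈ t, ∀ z, y = ⁅(s : L), z⁆ → y = 0 := by
    rintro _ hy z rfl
    exact lie_eq_zero_of_lie_lie_eq_zero hB t s.2 (lie_eq_zero_of_mem_cartan hB t s.2 hy)
  have hcompl : IsCompl t.toSubmodule (LinearMap.range a) := by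
    constructor
    · rw [Submodule.disjoint_def]
      rintro y hy ⟨z, rfl⟩
      exact hdisj _ hy z rfl
    · rw [codisjoint_iff, eq_top_iff]
      intro y _
      obtain ⟨y₀, hy₀, z, rfl⟩ := exists_add_lie_of_regular hB t hs y
      exact Submodule.add_mem_sup hy₀ ⟨z, rfl⟩
  let p : L →ₗ[ℂ] L := t.toSubmodule.subtype ∘ₗ Submodule.projectionOnto _ _ hcompl
  have hp1 : ∀ y ∈ t, p y = y := fun y hy =>
    congrArg Subtype.val (Submodule.projectionOnto_apply_left hcompl ⟨y, hy⟩)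
  have hp2 : ∀ z, p ⁅(s : L), z⁆ = 0 := fun z =>
    congrArg Subtype.val (Submodule.projectionOnto_apply_right hcompl ⟨a z, z, rfl⟩)
  have hinj : Function.Injective (a + p) := by
    rw [← LinearMap.ker_eq_bot, LinearMap.ker_eq_bot']
    intro x hx
    obtain ⟨y₀, hy₀, z, rfl⟩ := exists_add_lie_of_regular hB t hs x
    have hx' : ⁅(s : L), ⁅(s : L), z⁆⁆ + y₀ = 0 := by
      simpa [a, hp1 y₀ hy₀, hp2, lie_eq_zero_of_mem_cartan hB t s.2 hy₀] using hx
    have hy0 : y₀ = 0 := hdisj _ hy₀ (-⁅(s : L), z⁆) (by rw [lie_neg]; exact eq_neg_of_add_eq_zero_right hx')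
    rw [hy0, add_zero] at hx'
    rw [hy0, lie_eq_zero_of_lie_lie_eq_zero hB t s.2 hx', add_zero]
  let T : L ≃ₗ[ℂ] L := LinearEquiv.ofInjectiveEndo _ hinj
  have hT : ∀ x, T x = ⁅(s : L), x⁆ + p x := fun x => rfl
  have hS1 : ∀ y ∈ t, T.symm y = y := fun y hy => by
    rw [LinearEquiv.symm_apply_eq, hT, hp1 y hy, lie_eq_zero_of_mem_cartan hB t s.2 hy, zero_add]
  have hS2 : ∀ z, ∃ w, T.symm ⁅(s : L), z⁆ = ⁅(s : L), w⁆ ∧ ⁅(s : L), ⁅(s : L), w⁆⁆ = ⁅(s : L), z⁆ := by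
    intro z
    obtain ⟨z₀, hz₀, w, rfl⟩ := exists_add_lie_of_regular hB t hs z
    have h : ⁅(s : L), z₀ + ⁅(s : L), w⁆⁆ = ⁅(s : L), ⁅(s : L), w⁆⁆ := by
      rw [lie_add, lie_eq_zero_of_mem_cartan hB t s.2 hz₀, zero_add]
    refine ⟨w, ?_, h.symm⟩
    rw [LinearEquiv.symm_apply_eq, hT, hp2, add_zero, h]
  refine ⟨(T.symm : L →ₗ[ℂ] L) - p, ?_, ?_, ?_⟩
  · intro y hy
    have hy := mem_cartan_of_lie_eq_zero hB t hs hy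
    simp [hS1 y hy, hp1 y hy]
  · intro y hy z hz
    obtain ⟨w, rfl⟩ := mem_range_lie_of_orthogonal hB t hs fun z hz => hy z (lie_eq_zero_of_mem_cartan hB t s.2 hz)
    obtain ⟨v, hv, -⟩ := hS2 w
    simp only [LinearMap.sub_apply, LinearEquiv.coe_coe, hv, hp2, sub_zero]
    exact cartan_orthogonal_lie hB t s.2 (mem_cartan_of_lie_eq_zero hB t hs hz) v
  · intro y hy
    obtain ⟨w, rfl⟩ := mem_range_lie_of_orthogonal hB t hs fun z hz => hy z (lie_eq_zero_of_mem_cartan hB t s.2 hz)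
    obtain ⟨v, hv, hv'⟩ := hS2 w
    simp only [LinearMap.sub_apply, LinearEquiv.coe_coe, hv, hp2, sub_zero, hv']

theorem isAdInv_adInv {s : t} (hs : ∀ α, IsRoot t α → α s ≠ 0) :
    IsAdInv B (s : L) (adInv B (s : L)) := by
  have h := exists_isAdInv hB t hs
  rw [adInv, dif_pos h]
  exact h.choose_spec

theorem nonResonant_of_mem_regularSet {s : t} (hs : s ∈ regularSet t) : NonResonant (s : L) := by
  intro n hn h
  obtain ⟨y, hy⟩ := h.exists_hasEigenvector
  have hs0 : ∀ α, IsRoot t α → α s ≠ 0 := fun α hα => by simpa using hs α hα 0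
  set c : ℂ := 2 * Real.pi * Complex.I * n with hc
  have hc0 : c ≠ 0 := by
    simp [hc, hn, Real.pi_ne_zero]
  -- On t the operator ad s - c is -c, and on the root space of α it is α(s) - c. Both scalars are
  -- nonzero, so it is onto, hence injective by finite dimension.
  have hsurj : ∀ y : L, ∃ z : L, y = ⁅(s : L), z⁆ - c • z := by
    intro y
    induction y using rootSpace_induction t with
    | h0 y hy =>
      refine ⟨-c⁻¹ • y, ?_⟩
      rw [lie_smul, lie_eq_zero_of_mem_cartan hB t s.2 hy]
      simp [smul_smul, hc0]
    | hr α hα y hy =>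
      have : α s - c ≠ 0 := sub_ne_zero.2 (hs α hα n)
      refine ⟨(α s - c)⁻¹ • y, ?_⟩
      rw [lie_smul, lie_of_mem_rootSpace hB t hy, smul_smul, smul_smul, ← sub_smul, mul_comm c,
        ← mul_sub, inv_mul_cancel₀ this, one_smul]
    | hadd x y hx hy =>
      obtain ⟨x₁, rfl⟩ := hx
      obtain ⟨y₁, rfl⟩ := hy
      exact ⟨x₁ + y₁, by rw [lie_add, smul_add]; abel⟩
  have hinj : Function.Injective (ad ℂ L (s : L) - c • (1 : Module.End ℂ L)) :=
    LinearMap.injective_iff_surjective.2 fun y => by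
      obtain ⟨z, hz⟩ := hsurj y
      exact ⟨z, by simpa using hz.symm⟩
  refine hy.2 (hinj ?_)
  rw [map_zero]
  simpa [sub_eq_zero] using hy.apply_eq_smul

omit hB [HasCentralRadical ℂ L] in
theorem exists_regular : ∃ s : t, ∀ α, IsRoot t α → α s ≠ 0 := by
  have := (finite_isRoot t).to_subtype
  obtain ⟨s, hs⟩ := Module.Dual.exists_forall_ne_zero_of_forall_exists
    (fun α : {α : Module.Dual ℂ t | IsRoot t α} => (α : Module.Dual ℂ t)) fun α => by
      by_contra! h
      exact α.2.1 (LinearMap.ext h)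
  exact ⟨s, fun α hα => hs ⟨α, hα⟩⟩

omit hB [HasCentralRadical ℂ L] in
theorem isOpen_regularSet [TopologicalSpace L] [IsTopologicalAddGroup L] [ContinuousSMul ℂ L]
    [T2Space L] : IsOpen (regularSet t) := by
  have h : regularSet t = ⋂ α ∈ {α : Module.Dual ℂ t | IsRoot t α},
      {s : t | ∀ n : ℤ, α s ≠ 2 * Real.pi * Complex.I * n} := by
    ext s; simp [regularSet]
  rw [h]
  refine (finite_isRoot t).isOpen_biInter fun α _ => ?_
  have : IsTopologicalAddGroup t := inferInstanceAs (IsTopologicalAddGroup t.toSubmodule)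
  have : ContinuousSMul ℂ t := inferInstanceAs (ContinuousSMul ℂ t.toSubmodule)
  have hc : Continuous α := LinearMap.continuous_of_finiteDimensional α
  have hcl : IsClosed (Set.range fun n : ℤ => (2 * Real.pi * Complex.I * n : ℂ)) := by
    have := (Homeomorph.mulLeft₀ (2 * Real.pi * Complex.I : ℂ)
      Complex.two_pi_I_ne_zero).isClosedMap _ Complex.isClosed_range_intCast
    rwa [← Set.range_comp] at this
  convert hcl.isOpen_compl.preimage hc using 1
  ext s
  simp [eq_comm]

theorem lie_eq_zero_of_apply_eq_zero {α : Module.Dual ℂ t} {y : L} (hy : y ∈ rootSpace t α)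
    {l : t} (hl : α l = 0) : ⁅(l : L), y⁆ = 0 := by
  rw [lie_of_mem_rootSpace hB t hy, hl, zero_smul]

end Roots

end RelGW

namespace RelGW

/-! ### The Casimir element. -/

section Casimir

variable {L : Type*} [LieRing L] [LieAlgebra ℂ L] [FiniteDimensional ℂ L]
  {B : LinearMap.BilinForm ℂ L}

theorem apply_dualVec_left (h : B.Nondegenerate) (i j : Fin (Module.finrank ℂ L)) :
    B (dualVec B i) (Module.finBasis ℂ L j) = if j = i then 1 else 0 := by
  rw [dualVec, dif_pos h]
  exact B.apply_dualBasis_left h _ i j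

theorem sum_apply_basis_smul_dualVec (h : B.Nondegenerate) (x : L) :
    ∑ i, B x (Module.finBasis ℂ L i) • dualVec B i = x := by
  refine sub_eq_zero.1 (h.1 _ fun y => ?_)
  revert y
  suffices h : B (∑ i, B x (Module.finBasis ℂ L i) • dualVec B i - x) = 0 from fun y => by rw [h]; rfl
  refine (Module.finBasis ℂ L).ext fun j => ?_
  simp [apply_dualVec_left h]

theorem sum_apply_dualVec_smul_basis (h : B.Nondegenerate) (hs : ∀ x y, B x y = B y x) (x : L) :
    ∑ i, B x (dualVec B i) • Module.finBasis ℂ L i = x := by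
  refine sub_eq_zero.1 (h.1 _ fun y => ?_)
  rw [← sum_apply_basis_smul_dualVec h y]
  simp only [map_sum, map_smul, LinearMap.sub_apply, LinearMap.sum_apply, LinearMap.smul_apply, smul_eq_mul, map_sub]
  have : ∀ i, ∑ j, B x (dualVec B j) * B (Module.finBasis ℂ L j) (dualVec B i) =
      B x (dualVec B i) := fun i => by
    simp [hs _ (dualVec B i), apply_dualVec_left h]
  simp [this]

theorem vee_apply (h : B.Nondegenerate) (x : L) : vee B (B x) = x := by
  simp [vee, casimir, sum_apply_basis_smul_dualVec h]

/-- Ω is the inverse of the form B seen as a tensor, so an operator passes from one leg to the other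
as its B-adjoint. -/
theorem map_casimir_left (h : B.Nondegenerate) (hs : ∀ x y, B x y = B y x) {f g : L →ₗ[ℂ] L}
    (hfg : ∀ x y, B (f x) y = B x (g y)) :
    TensorProduct.map f LinearMap.id (casimir B) = TensorProduct.map LinearMap.id g (casimir B) := by
  have h1 : ∀ i, f (Module.finBasis ℂ L i) =
      ∑ j, B (f (Module.finBasis ℂ L i)) (dualVec B j) • Module.finBasis ℂ L j :=
    fun i => (sum_apply_dualVec_smul_basis h hs _).symm
  have h2 : ∀ j, g (dualVec B j) = ∑ i, B (g (dualVec B j)) (Module.finBasis ℂ L i) • dualVec B i :=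
    fun j => (sum_apply_basis_smul_dualVec h _).symm
  simp only [casimir, map_sum, TensorProduct.map_tmul, LinearMap.id_apply]
  calc ∑ i, f (Module.finBasis ℂ L i) ⊗ₜ[ℂ] dualVec B i
      = ∑ i, ∑ j, B (f (Module.finBasis ℂ L i)) (dualVec B j) •
          (Module.finBasis ℂ L j ⊗ₜ[ℂ] dualVec B i) := by
        refine Finset.sum_congr rfl fun i _ => ?_
        conv_lhs => rw [h1 i]
        simp [TensorProduct.sum_tmul, TensorProduct.smul_tmul']
    _ = ∑ j, Module.finBasis ℂ L j ⊗ₜ[ℂ] g (dualVec B j) := by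
        rw [Finset.sum_comm]
        refine Finset.sum_congr rfl fun j _ => ?_
        conv_rhs => rw [h2 j]
        simp [TensorProduct.tmul_sum, hfg, hs (g _)]

/-- The B-adjoint of an isometry is its inverse, so moving f from the first leg to the second
cancels the f already there. -/
theorem map_map_casimir (h : B.Nondegenerate) (hs : ∀ x y, B x y = B y x) {f : L →ₗ[ℂ] L}
    (hf : ∀ x y, B (f x) (f y) = B x y) : TensorProduct.map f f (casimir B) = casimir B := by
  have hinj : Function.Injective f := by
    rw [← LinearMap.ker_eq_bot, LinearMap.ker_eq_bot']
    intro x hx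
    exact h.1 _ fun y => by rw [← hf, hx]; simp
  let F := LinearEquiv.ofInjectiveEndo f hinj
  have hF : ∀ x, F x = f x := fun x => rfl
  have h1 := map_casimir_left h hs (f := f) (g := (F.symm : L →ₗ[ℂ] L)) fun x y => by
    rw [← hf x, LinearEquiv.coe_coe, ← hF (F.symm y), F.apply_symm_apply]
  have h2 : TensorProduct.map f f = TensorProduct.map LinearMap.id f ∘ₗ TensorProduct.map f LinearMap.id := by
    rw [← TensorProduct.map_comp]; rfl
  have h3 : f ∘ₗ (F.symm : L →ₗ[ℂ] L) = LinearMap.id := by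
    ext x; exact F.apply_symm_apply x
  rw [h2, LinearMap.comp_apply, h1, ← LinearMap.comp_apply, ← TensorProduct.map_comp, h3]
  simp

variable (hB : IsInvariantForm B)
include hB

theorem map_ad_casimir (x : L) :
    TensorProduct.map (LieAlgebra.ad ℂ L x) LinearMap.id (casimir B) =
      - TensorProduct.map LinearMap.id (LieAlgebra.ad ℂ L x) (casimir B) := by
  rw [map_casimir_left hB.nondegenerate hB.symm (g := -LieAlgebra.ad ℂ L x)]
  · rw [← LinearMap.neg_apply]
    congr 1
    refine TensorProduct.ext' fun a b => ?_
    simp only [TensorProduct.map_tmul, LinearMap.neg_apply, TensorProduct.tmul_neg]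
  · intro y z
    rw [LinearMap.neg_apply, LieAlgebra.ad_apply, LieAlgebra.ad_apply, ← lie_skew, map_neg,
      LinearMap.neg_apply, hB.lie, map_neg]

/-- The coefficients `∑ B(x, [e_i, e_j]) e^i ⊗ e^j` give the tensor `(id ⊗ ad x) Ω`. -/
theorem sum_structure_smul_tmul (x : L) (f g : L →ₗ[ℂ] L) :
    ∑ i, ∑ j, B x ⁅Module.finBasis ℂ L i, Module.finBasis ℂ L j⁆ •
        (f (dualVec B i) ⊗ₜ[ℂ] g (dualVec B j)) =
      -TensorProduct.map f g (TensorProduct.map (LieAlgebra.ad ℂ L x) LinearMap.id (casimir B)) := by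
  have key : TensorProduct.map (LieAlgebra.ad ℂ L x) LinearMap.id (casimir B) =
      -∑ i, ∑ j, B x ⁅Module.finBasis ℂ L i, Module.finBasis ℂ L j⁆ •
        (dualVec B i ⊗ₜ[ℂ] dualVec B j) := by
    have h : ∀ j, ⁅x, Module.finBasis ℂ L j⁆ =
        -∑ i, B x ⁅Module.finBasis ℂ L i, Module.finBasis ℂ L j⁆ • dualVec B i := by
      intro j
      conv_lhs => rw [← sum_apply_basis_smul_dualVec hB.nondegenerate ⁅x, _⁆]
      rw [← Finset.sum_neg_distrib]
      refine Finset.sum_congr rfl fun i _ => ?_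
      rw [hB.lie, ← lie_skew, map_neg, neg_smul]
    simp only [casimir, map_sum, TensorProduct.map_tmul, LieAlgebra.ad_apply, LinearMap.id_apply, h]
    rw [Finset.sum_comm (f := fun i j => _ • _), ← Finset.sum_neg_distrib]
    simp [TensorProduct.neg_tmul, TensorProduct.sum_tmul, TensorProduct.smul_tmul']
  rw [key]
  simp

end Casimir

/-! ### Linear algebra of the slice: push-forward of the trivialized bivector. -/

section SliceAlgebra

variable {L : Type*} [LieRing L] [LieAlgebra ℂ L] [FiniteDimensional ℂ L]
  [LieAlgebra.HasCentralRadical ℂ L]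
  {B : LinearMap.BilinForm ℂ L} (hB : IsInvariantForm B)
  (t : LieSubalgebra ℂ L) [t.IsCartanSubalgebra]

/-- The bivector `∑ ∂/∂t^j ∧ t_j + (id ⊗ ad_s⁻¹)(Ω)` on `L × t`. -/
noncomputable def trivialBivector (B : LinearMap.BilinForm ℂ L) (s : t) : (L × t) ⊗[ℂ] (L × t) :=
  (∑ j, wedge (LinearMap.inr ℂ L t (dualVec (restrictForm B t) j))
      (LinearMap.inl ℂ L t (Module.finBasis ℂ t j)))
    + TensorProduct.map (LinearMap.inl ℂ L t) (LinearMap.inl ℂ L t)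
        (TensorProduct.map LinearMap.id (adInv B (s : L)) (casimir B))

/-- The linear map `(ξ, η) ↦ (ξ + θ([ξ, s] + η), η)`. -/
def twistMap (θ : L →ₗ[ℂ] L) (s : t) : L × t →ₗ[ℂ] L × t :=
  LinearMap.prod
    (LinearMap.fst ℂ L t + θ ∘ₗ (-(LieAlgebra.ad ℂ L (s : L)) ∘ₗ LinearMap.fst ℂ L t +
      t.toSubmodule.subtype ∘ₗ LinearMap.snd ℂ L t))
    (LinearMap.snd ℂ L t)

omit [FiniteDimensional ℂ L] [LieAlgebra.HasCentralRadical ℂ L] [t.IsCartanSubalgebra] in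
theorem twistMap_apply (θ : L →ₗ[ℂ] L) (s : t) (v : L × t) :
    twistMap t θ s v = (v.1 + θ (⁅v.1, (s : L)⁆ + v.2), v.2) := by
  simp [twistMap, LinearMap.prod_apply]

include hB

theorem lie_adInv_lie {s : t} (hs : ∀ α, IsRoot t α → α s ≠ 0) (y : L) :
    ⁅(s : L), adInv B (s : L) ⁅(s : L), y⁆⁆ = ⁅(s : L), y⁆ :=
  (isAdInv_adInv hB t hs).right_inv _ fun _ hx => cartan_orthogonal_lie hB t s.2
    (mem_cartan_of_lie_eq_zero hB t hs hx) y

/-- Both sides vanish for y ∈ t. For y ∈ [s, L] both lie in [s, L] and have the same image under ad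
s, which is injective there by semisimplicity. -/
theorem adInv_lie {s : t} (hs : ∀ α, IsRoot t α → α s ≠ 0) (y : L) :
    adInv B (s : L) ⁅(s : L), y⁆ = ⁅(s : L), adInv B (s : L) y⁆ := by
  have hS := isAdInv_adInv hB t hs
  obtain ⟨y₀, hy₀, z, rfl⟩ := exists_add_lie_of_regular hB t hs y
  have h0 := lie_eq_zero_of_mem_cartan hB t s.2 hy₀
  rw [lie_add, h0, zero_add, map_add, hS.zero_of_centralizes _ h0, zero_add,
    lie_adInv_lie hB t hs]
  obtain ⟨v, hv⟩ := mem_range_lie_of_orthogonal hB t hs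
    (y := adInv B (s : L) ⁅(s : L), ⁅(s : L), z⁆⁆) fun x hx =>
      hS.mem_compl _ (fun w hw => cartan_orthogonal_lie hB t s.2
        (mem_cartan_of_lie_eq_zero hB t hs hw) _) x (lie_eq_zero_of_mem_cartan hB t s.2 hx)
  have h1 : ⁅(s : L), ⁅(s : L), v - z⁆⁆ = 0 := by
    rw [lie_sub, ← hv, lie_sub, lie_adInv_lie hB t hs, sub_self]
  have h2 := lie_eq_zero_of_lie_lie_eq_zero hB t s.2 h1
  rw [hv, ← sub_eq_zero, ← lie_sub, h2]

/-- The projection `y ↦ y - [s, ad_s⁻¹ y]` onto the Cartan subalgebra in dual bases. -/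
theorem sub_lie_adInv {s : t} (hs : ∀ α, IsRoot t α → α s ≠ 0) (y : L) :
    y - ⁅(s : L), adInv B (s : L) y⁆ =
      ∑ j, B (Module.finBasis ℂ t j : t) y • ((dualVec (restrictForm B t) j : t) : L) := by
  have hS := isAdInv_adInv hB t hs
  have hnd := restrictForm_nondegenerate_of_regular hB t hs
  obtain ⟨y₀, hy₀, z, rfl⟩ := exists_add_lie_of_regular hB t hs y
  rw [map_add, hS.zero_of_centralizes _ (lie_eq_zero_of_mem_cartan hB t s.2 hy₀), zero_add,
    lie_adInv_lie hB t hs, add_sub_cancel_right]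
  have h1 := congrArg t.toSubmodule.subtype
    (sum_apply_basis_smul_dualVec hnd (⟨y₀, hy₀⟩ : t))
  rw [map_sum] at h1
  refine h1.symm.trans (Finset.sum_congr rfl fun j _ => ?_)
  rw [map_add, cartan_orthogonal_lie hB t s.2 (Module.finBasis ℂ t j).2, add_zero, hB.symm,
    map_smul]
  rfl

/-- Since 1 - ad_s ad_s⁻¹ is the orthogonal projection onto t, applying it to one leg of Ω leaves
the Casimir element of t. In this form the ∂/∂t^j terms can be combined with the ad_s⁻¹ term. -/
theorem sum_cartan_tmul {s : t} (hs : ∀ α, IsRoot t α → α s ≠ 0) :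
    ∑ j, ((Module.finBasis ℂ t j : t) : L) ⊗ₜ[ℂ] ((dualVec (restrictForm B t) j : t) : L) =
      casimir B - TensorProduct.map LinearMap.id
        (LieAlgebra.ad ℂ L (s : L) ∘ₗ adInv B (s : L)) (casimir B) := by
  have h1 : casimir B - TensorProduct.map LinearMap.id
      (LieAlgebra.ad ℂ L (s : L) ∘ₗ adInv B (s : L)) (casimir B) =
      ∑ i, Module.finBasis ℂ L i ⊗ₜ[ℂ]
        (dualVec B i - ⁅(s : L), adInv B (s : L) (dualVec B i)⁆) := by
    simp [casimir, TensorProduct.tmul_sub]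
  rw [h1]
  simp only [sub_lie_adInv hB t hs, TensorProduct.tmul_sum]
  rw [Finset.sum_comm]
  refine Finset.sum_congr rfl fun j _ => ?_
  conv_lhs => rw [← sum_apply_dualVec_smul_basis hB.nondegenerate hB.symm (Module.finBasis ℂ t j : L)]
  simp [TensorProduct.sum_tmul, TensorProduct.smul_tmul']

theorem sum_cartan_tmul' {s : t} (hs : ∀ α, IsRoot t α → α s ≠ 0) :
    ∑ j, ((dualVec (restrictForm B t) j : t) : L) ⊗ₜ[ℂ] ((Module.finBasis ℂ t j : t) : L) =
      casimir B - TensorProduct.map LinearMap.id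
        (LieAlgebra.ad ℂ L (s : L) ∘ₗ adInv B (s : L)) (casimir B) := by
  -- The projection onto t is self-adjoint because its image t and its kernel [s, L] are orthogonal.
  -- This moves it to the other leg of Ω.
  have hself : ∀ x y, B (⁅(s : L), adInv B (s : L) x⁆) y = B x ⁅(s : L), adInv B (s : L) y⁆ := by
    intro x y
    have key : ∀ x y, B (x - ⁅(s : L), adInv B (s : L) x⁆) ⁅(s : L), adInv B (s : L) y⁆ = 0 := by
      intro x y
      rw [sub_lie_adInv hB t hs]
      simp only [map_sum, LinearMap.sum_apply, map_smul, LinearMap.smul_apply]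
      exact Finset.sum_eq_zero fun j _ => by
        rw [cartan_orthogonal_lie hB t s.2 (dualVec (restrictForm B t) j).2, smul_zero]
    have h1 := key x y
    have h2 := key y x
    rw [map_sub, LinearMap.sub_apply, sub_eq_zero] at h1 h2
    rw [h1, hB.symm, h2, hB.symm]
  rw [← map_casimir_left hB.nondegenerate hB.symm
    (f := LieAlgebra.ad ℂ L (s : L) ∘ₗ adInv B (s : L))
    (g := LieAlgebra.ad ℂ L (s : L) ∘ₗ adInv B (s : L)) hself]
  have h1 : casimir B - TensorProduct.map
      (LieAlgebra.ad ℂ L (s : L) ∘ₗ adInv B (s : L)) LinearMap.id (casimir B) =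
      ∑ i, (Module.finBasis ℂ L i - ⁅(s : L), adInv B (s : L) (Module.finBasis ℂ L i)⁆) ⊗ₜ[ℂ]
        dualVec B i := by
    simp [casimir, TensorProduct.sub_tmul]
  rw [h1]
  simp only [sub_lie_adInv hB t hs, TensorProduct.sum_tmul]
  rw [Finset.sum_comm]
  refine Finset.sum_congr rfl fun j _ => ?_
  conv_lhs => rw [← sum_apply_basis_smul_dualVec hB.nondegenerate (Module.finBasis ℂ t j : L)]
  simp [TensorProduct.tmul_sum, TensorProduct.smul_tmul']

omit [FiniteDimensional ℂ L] [LieAlgebra.HasCentralRadical ℂ L] [t.IsCartanSubalgebra] hB in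
theorem map_twistMap_inl (θ : L →ₗ[ℂ] L) (s : t) (a : L ⊗[ℂ] L) :
    TensorProduct.map (twistMap t θ s) (twistMap t θ s)
        (TensorProduct.map (LinearMap.inl ℂ L t) (LinearMap.inl ℂ L t) a) =
      TensorProduct.map (LinearMap.inl ℂ L t) (LinearMap.inl ℂ L t)
        (TensorProduct.map (LinearMap.id - θ ∘ₗ LieAlgebra.ad ℂ L (s : L))
          (LinearMap.id - θ ∘ₗ LieAlgebra.ad ℂ L (s : L)) a) := by
  have hTi : twistMap t θ s ∘ₗ LinearMap.inl ℂ L t =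
      LinearMap.inl ℂ L t ∘ₗ (LinearMap.id - θ ∘ₗ LieAlgebra.ad ℂ L (s : L)) := by
    refine LinearMap.ext fun x => ?_
    have : twistMap t θ s (LinearMap.inl ℂ L t x) = (x + θ (⁅x, (s : L)⁆ + ((0 : t) : L)), 0) :=
      twistMap_apply t θ s _
    rw [LinearMap.comp_apply, this, ZeroMemClass.coe_zero, add_zero, ← lie_skew, map_neg,
      ← sub_eq_add_neg]
    rfl
  rw [← LinearMap.comp_apply, ← LinearMap.comp_apply, ← TensorProduct.map_comp,
    ← TensorProduct.map_comp, hTi]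

/-- The ∂/∂t^j terms contribute θ applied to the t-part of Ω, and the ad_s⁻¹ term contributes θ
applied to the complementary part (1 ⊗ ad_s ad_s⁻¹)Ω, so the two add up to θ applied to all of Ω.
What remains is quadratic in θ. -/
theorem map_twistMap_trivialBivector {s : t} (hs : ∀ α, IsRoot t α → α s ≠ 0)
    (θ : L →ₗ[ℂ] L) :
    TensorProduct.map (twistMap t θ s) (twistMap t θ s) (trivialBivector t B s) =
      trivialBivector t B s +
        TensorProduct.map (LinearMap.inl ℂ L t) (LinearMap.inl ℂ L t)
          (TensorProduct.map θ LinearMap.id (casimir B) - TensorProduct.map LinearMap.id θ (casimir B)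
            + TensorProduct.map θ θ
                (TensorProduct.map (LieAlgebra.ad ℂ L (s : L)) LinearMap.id (casimir B))) := by
  set a := LieAlgebra.ad ℂ L (s : L) with ha
  set S := adInv B (s : L) with hS
  set i := LinearMap.inl ℂ L t with hi
  have hcomm : S ∘ₗ a = a ∘ₗ S := LinearMap.ext fun y => adInv_lie hB t hs y
  have haSa : a ∘ₗ S ∘ₗ a = a := LinearMap.ext fun y => lie_adInv_lie hB t hs y
  have hTr : ∀ η : t, twistMap t θ s (LinearMap.inr ℂ L t η) =
      i (θ η) + LinearMap.inr ℂ L t η := by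
    intro η
    simp [twistMap_apply, hi]
  have hTt : ∀ η : t, twistMap t θ s (i (η : L)) = i η := by
    intro η
    simp [twistMap_apply, hi, lie_eq_zero_of_mem_cartan hB t η.2 s.2]
  have hmm : ∀ (f g f' g' : L →ₗ[ℂ] L) (x : L ⊗[ℂ] L), TensorProduct.map f g
      (TensorProduct.map f' g' x) = TensorProduct.map (f ∘ₗ f') (g ∘ₗ g') x := by
    intro f g f' g' x
    rw [TensorProduct.map_comp]; rfl
  -- the `ad_s⁻¹` part
  have h1 : TensorProduct.map (twistMap t θ s) (twistMap t θ s) (TensorProduct.map i i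
      (TensorProduct.map LinearMap.id S (casimir B))) = TensorProduct.map i i
      (TensorProduct.map LinearMap.id S (casimir B)
        + TensorProduct.map θ LinearMap.id (TensorProduct.map LinearMap.id (a ∘ₗ S) (casimir B))
        - TensorProduct.map LinearMap.id θ (TensorProduct.map LinearMap.id (a ∘ₗ S) (casimir B))
        + TensorProduct.map θ θ (TensorProduct.map a LinearMap.id (casimir B))) := by
    rw [hi, map_twistMap_inl]
    congr 1
    have e2 : TensorProduct.map (θ ∘ₗ a) S (casimir B) =
        -TensorProduct.map θ (a ∘ₗ S) (casimir B) := by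
      have := congrArg (TensorProduct.map θ S) (map_ad_casimir hB (s : L))
      rwa [map_neg, hmm, hmm, LinearMap.comp_id, LinearMap.comp_id, hcomm] at this
    -- In the quadratic term, moving one ad_s across Ω places it next to ad_s ad_s⁻¹. The identity
    -- ad_s ad_s⁻¹ ad_s = ad_s then removes ad_s⁻¹, and moving ad_s back restores the sign.
    have e3 : TensorProduct.map (θ ∘ₗ a) (θ ∘ₗ a ∘ₗ S) (casimir B) =
        TensorProduct.map (θ ∘ₗ a) θ (casimir B) := by
      have := congrArg (TensorProduct.map θ (θ ∘ₗ a ∘ₗ S)) (map_ad_casimir hB (s : L))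
      have h' := congrArg (TensorProduct.map θ θ) (map_ad_casimir hB (s : L))
      rw [map_neg, hmm, hmm, LinearMap.comp_id, LinearMap.comp_id, ← ha, LinearMap.comp_assoc,
        LinearMap.comp_assoc, haSa] at this
      rw [map_neg, hmm, hmm, LinearMap.comp_id, ← ha] at h'
      rw [this, h']
    have e4 : TensorProduct.map (LinearMap.id - θ ∘ₗ a) (LinearMap.id - θ ∘ₗ a)
        (TensorProduct.map LinearMap.id S (casimir B)) =
        TensorProduct.map LinearMap.id S (casimir B)
        - TensorProduct.map (θ ∘ₗ a) S (casimir B)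
        - TensorProduct.map LinearMap.id (θ ∘ₗ a ∘ₗ S) (casimir B)
        + TensorProduct.map (θ ∘ₗ a) (θ ∘ₗ a ∘ₗ S) (casimir B) := by
      simp only [← LinearMap.sub_apply, ← LinearMap.add_apply, ← LinearMap.comp_apply]
      congr 1
      refine TensorProduct.ext' fun x y => ?_
      simp only [LinearMap.comp_apply, TensorProduct.map_tmul, LinearMap.sub_apply,
        LinearMap.add_apply, LinearMap.id_apply, TensorProduct.sub_tmul, TensorProduct.tmul_sub]
      abel
    rw [e4, e2, e3, hmm, hmm, hmm]
    simp only [LinearMap.comp_id, LinearMap.id_comp]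
    abel
  -- The ∂/∂t^j part: the twist adds θ(η) to a vector η of the t-factor, and fixes t inside L
  -- because t is abelian.
  have h2 : TensorProduct.map (twistMap t θ s) (twistMap t θ s)
      (∑ j, wedge (LinearMap.inr ℂ L t (dualVec (restrictForm B t) j))
        (i (Module.finBasis ℂ t j : t))) =
      (∑ j, wedge (LinearMap.inr ℂ L t (dualVec (restrictForm B t) j))
        (i (Module.finBasis ℂ t j : t))) + TensorProduct.map i i
        (TensorProduct.map θ LinearMap.id (casimir B - TensorProduct.map LinearMap.id (a ∘ₗ S) (casimir B))
        - TensorProduct.map LinearMap.id θ (casimir B - TensorProduct.map LinearMap.id (a ∘ₗ S) (casimir B))) := by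
    have e1 : ∀ j, TensorProduct.map (twistMap t θ s) (twistMap t θ s)
        (wedge (LinearMap.inr ℂ L t (dualVec (restrictForm B t) j)) (i (Module.finBasis ℂ t j : t))) =
        wedge (LinearMap.inr ℂ L t (dualVec (restrictForm B t) j)) (i (Module.finBasis ℂ t j : t)) +
          TensorProduct.map i i (TensorProduct.map θ LinearMap.id
            (((dualVec (restrictForm B t) j : t) : L) ⊗ₜ[ℂ] ((Module.finBasis ℂ t j : t) : L)) -
          TensorProduct.map LinearMap.id θ
            (((Module.finBasis ℂ t j : t) : L) ⊗ₜ[ℂ] ((dualVec (restrictForm B t) j : t) : L))) := by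
      intro j
      simp only [wedge, map_sub, TensorProduct.map_tmul, hTr, hTt, LinearMap.id_apply,
        TensorProduct.add_tmul, TensorProduct.tmul_add]
      abel
    rw [map_sum, Finset.sum_congr rfl fun j _ => e1 j, Finset.sum_add_distrib, ← map_sum,
      Finset.sum_sub_distrib, ← map_sum, ← map_sum, sum_cartan_tmul hB t hs,
      sum_cartan_tmul' hB t hs]
  rw [trivialBivector, map_add, h1, h2]
  simp only [map_add, map_sub]
  abel

omit [FiniteDimensional ℂ L] [LieAlgebra.HasCentralRadical ℂ L] [t.IsCartanSubalgebra] hB in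
theorem map_inl_injective : Function.Injective
    (TensorProduct.map (LinearMap.inl ℂ L t) (LinearMap.inl ℂ L t)) := by
  refine Function.LeftInverse.injective
    (g := TensorProduct.map (LinearMap.fst ℂ L t) (LinearMap.fst ℂ L t)) fun x => ?_
  rw [← LinearMap.comp_apply, ← TensorProduct.map_comp, LinearMap.fst_comp_inl]
  simp

/-- The trivialized bivector cancels on both sides and L ⊗ L embeds injectively, so the identity of
bivectors on L × t becomes an equation in L ⊗ L, already close to the gauge equation. -/
theorem map_twistMap_eq_iff {s : t} (hs : ∀ α, IsRoot t α → α s ≠ 0) (θ : L →ₗ[ℂ] L)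
    (a₁ a₂ : L ⊗[ℂ] L) :
    TensorProduct.map (twistMap t θ s) (twistMap t θ s) (trivialBivector t B s +
        TensorProduct.map (LinearMap.inl ℂ L t) (LinearMap.inl ℂ L t) a₁) =
      trivialBivector t B s + TensorProduct.map (LinearMap.inl ℂ L t) (LinearMap.inl ℂ L t) a₂ ↔
    TensorProduct.map θ LinearMap.id (casimir B) - TensorProduct.map LinearMap.id θ (casimir B)
      + TensorProduct.map θ θ
          (TensorProduct.map (LieAlgebra.ad ℂ L (s : L)) LinearMap.id (casimir B))
      + TensorProduct.map (LinearMap.id - θ ∘ₗ LieAlgebra.ad ℂ L (s : L))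
          (LinearMap.id - θ ∘ₗ LieAlgebra.ad ℂ L (s : L)) a₁ = a₂ := by
  rw [map_add, map_twistMap_trivialBivector hB t hs, map_twistMap_inl, add_assoc, ← map_add,
    add_right_inj]
  exact (map_inl_injective t).eq_iff

end SliceAlgebra

end RelGW

namespace RelGW

open Filter Topology

/-! ### The operator functions d, n and φ: analyticity and conjugation. -/

section EntireFunctions

variable {A : Type*} [NormedRing A] [NormedAlgebra ℂ A]

theorem radius_entireD : (FormalMultilinearSeries.ofScalars A
    fun k : ℕ => (((k + 1).factorial : ℂ)⁻¹)).radius = ⊤ := by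
  refine FormalMultilinearSeries.ofScalars_radius_eq_top_of_tendsto _ _
    (Eventually.of_forall fun k => inv_ne_zero (Nat.cast_ne_zero.2 (Nat.factorial_ne_zero _))) ?_
  have : (fun n : ℕ => ‖(((n.succ + 1).factorial : ℂ)⁻¹)‖ / ‖(((n + 1).factorial : ℂ)⁻¹)‖) =
      fun n : ℕ => 1 / (((n + 1 : ℕ) : ℝ) + 1) := by
    funext n
    have h : ((n + 1).factorial : ℝ) ≠ 0 := Nat.cast_ne_zero.2 (Nat.factorial_ne_zero _)
    rw [norm_inv, norm_inv, Complex.norm_natCast, Complex.norm_natCast, Nat.succ_eq_add_one,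
      Nat.factorial_succ (n + 1), Nat.cast_mul]
    field_simp
    push_cast
    ring
  rw [this]
  exact (tendsto_add_atTop_iff_nat 1).2 tendsto_one_div_add_atTop_nhds_zero_nat

theorem radius_entireN : (FormalMultilinearSeries.ofScalars A
    fun k : ℕ => (((k : ℂ) + 1) / ((k + 3).factorial : ℂ))).radius = ⊤ := by
  have hk : ∀ k : ℕ, (k : ℂ) + 1 ≠ 0 := fun k => Nat.cast_add_one_ne_zero k
  refine FormalMultilinearSeries.ofScalars_radius_eq_top_of_tendsto _ _
    (Eventually.of_forall fun k => div_ne_zero (hk k)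
      (Nat.cast_ne_zero.2 (Nat.factorial_ne_zero _))) ?_
  have h1 : ∀ n : ℕ, ‖(((n.succ : ℕ) : ℂ) + 1) / ((n.succ + 3).factorial : ℂ)‖ /
      ‖((n : ℂ) + 1) / ((n + 3).factorial : ℂ)‖ =
      ((n : ℝ) + 2) / (((n : ℝ) + 1) * ((n : ℝ) + 4)) := by
    intro n
    have h : ((n + 3).factorial : ℝ) ≠ 0 := Nat.cast_ne_zero.2 (Nat.factorial_ne_zero _)
    have e1 : ‖(((n.succ : ℕ) : ℂ) + 1)‖ = (n : ℝ) + 2 := by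
      rw [← Nat.cast_add_one, Complex.norm_natCast]; push_cast; ring
    have e2 : ‖((n : ℂ) + 1)‖ = (n : ℝ) + 1 := by
      rw [← Nat.cast_add_one, Complex.norm_natCast]; push_cast; ring
    have e3 : ((n.succ + 3).factorial : ℝ) = ((n : ℝ) + 4) * ((n + 3).factorial : ℝ) := by
      rw [Nat.succ_eq_add_one, show n + 1 + 3 = (n + 3) + 1 by ring, Nat.factorial_succ]
      push_cast; ring
    have hn : (n : ℝ) + 1 ≠ 0 := by positivity
    have hn4 : (n : ℝ) + 4 ≠ 0 := by positivity
    rw [norm_div, norm_div, Complex.norm_natCast, Complex.norm_natCast, e1, e2, e3]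
    field_simp
  refine squeeze_zero (fun n => by positivity) (g := fun n : ℕ => 2 * (1 / ((n : ℝ) + 1))) ?_ ?_
  · intro n
    rw [h1]
    rw [div_le_iff₀ (by positivity)]
    field_simp
    nlinarith [(Nat.cast_nonneg n : (0 : ℝ) ≤ n)]
  · simpa using tendsto_one_div_add_atTop_nhds_zero_nat.const_mul (2 : ℝ)

variable [CompleteSpace A]

theorem summable_entireD (a : A) : Summable fun k : ℕ => (((k + 1).factorial : ℂ)⁻¹) • a ^ k := by
  have := FormalMultilinearSeries.summable _ (x := a)
    (show a ∈ Metric.eball (0 : A) (FormalMultilinearSeries.ofScalars A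
      fun k : ℕ => (((k + 1).factorial : ℂ)⁻¹)).radius by rw [radius_entireD]; exact Metric.mem_eball.2 (edist_lt_top _ _))
  simpa [FormalMultilinearSeries.ofScalars_apply_eq] using this

theorem summable_entireN (a : A) :
    Summable fun k : ℕ => (((k : ℂ) + 1) / ((k + 3).factorial : ℂ)) • a ^ k := by
  have := FormalMultilinearSeries.summable _ (x := a)
    (show a ∈ Metric.eball (0 : A) (FormalMultilinearSeries.ofScalars A
      fun k : ℕ => (((k : ℂ) + 1) / ((k + 3).factorial : ℂ))).radius by rw [radius_entireN]; exact Metric.mem_eball.2 (edist_lt_top _ _))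
  simpa [FormalMultilinearSeries.ofScalars_apply_eq] using this

theorem analyticAt_entireD (a : A) : AnalyticAt ℂ (entireD : A → A) a := by
  have h := (FormalMultilinearSeries.ofScalars A
    fun k : ℕ => (((k + 1).factorial : ℂ)⁻¹)).hasFPowerSeriesOnBall (by rw [radius_entireD]; simp)
  have := h.analyticAt_of_mem (y := a) (by rw [radius_entireD]; simp)
  convert this using 1
  funext b
  exact (FormalMultilinearSeries.ofScalars_sum_eq _ b).symm

theorem analyticAt_entireN (a : A) : AnalyticAt ℂ (entireN : A → A) a := by
  have h := (FormalMultilinearSeries.ofScalars A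
    fun k : ℕ => (((k : ℂ) + 1) / ((k + 3).factorial : ℂ))).hasFPowerSeriesOnBall
      (by rw [radius_entireN]; simp)
  have := h.analyticAt_of_mem (y := a) (by rw [radius_entireN]; simp)
  convert this using 1
  funext b
  exact (FormalMultilinearSeries.ofScalars_sum_eq _ b).symm

theorem analyticAt_phi {a : A} (ha : IsUnit (entireD a)) : AnalyticAt ℂ (phi : A → A) a := by
  have h1 : AnalyticAt ℂ (fun b : A => Ring.inverse (entireD b)) a := by
    obtain ⟨u, hu⟩ := ha
    refine AnalyticAt.fun_comp ?_ (analyticAt_entireD a)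
    rw [← hu]
    exact analyticAt_inverse u
  exact (((analyticAt_id.mul (analyticAt_entireN a)).mul h1).const_smul (c := (1 / 2 : ℂ)))

theorem entireD_conj (u : Aˣ) (a : A) : entireD (u * a * ↑u⁻¹) = u * entireD a * ↑u⁻¹ := by
  rw [entireD, entireD, ← (summable_entireD a).tsum_mul_left,
    ← ((summable_entireD a).mul_left _).tsum_mul_right]
  refine tsum_congr fun k => ?_
  rw [Units.conj_pow]
  simp

theorem entireN_conj (u : Aˣ) (a : A) : entireN (u * a * ↑u⁻¹) = u * entireN a * ↑u⁻¹ := by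
  rw [entireN, entireN, ← (summable_entireN a).tsum_mul_left,
    ← ((summable_entireN a).mul_left _).tsum_mul_right]
  refine tsum_congr fun k => ?_
  rw [Units.conj_pow]
  simp

theorem phi_conj (u : Aˣ) (a : A) : phi (u * a * ↑u⁻¹) = u * phi a * ↑u⁻¹ := by
  -- `Ring.inverse` is compatible with conjugation even at non-units, where it is 0. So no
  -- non-resonance is needed here, nor for the Ad-equivariance of r_AM.
  have h : Ring.inverse (u * entireD a * ↑u⁻¹ : A) = u * Ring.inverse (entireD a) * ↑u⁻¹ := by
    rw [Ring.inverse_mul (Or.inr u⁻¹.isUnit), Ring.inverse_mul (Or.inl u.isUnit),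
      Ring.inverse_unit, Ring.inverse_unit, inv_inv, mul_assoc]
  rw [phi, phi, entireD_conj, entireN_conj, h]
  simp [mul_assoc]

end EntireFunctions

/-! ### Non-resonance: openness and connectedness. -/

section Spectrum

theorem mul_entireD (μ : ℂ) : μ * entireD μ = Complex.exp μ - 1 := by
  rw [Complex.exp_eq_exp_ℂ, NormedSpace.exp_eq_tsum (𝕂 := ℂ)]
  have hs : Summable fun n : ℕ => ((n.factorial : ℂ)⁻¹) • μ ^ n := NormedSpace.expSeries_summable' μ
  beta_reduce
  rw [hs.tsum_eq_zero_add, entireD, ← (summable_entireD μ).tsum_mul_left]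
  simp only [Nat.factorial_zero, Nat.cast_one, inv_one, pow_zero, smul_eq_mul, mul_one,
    add_sub_cancel_left]
  refine tsum_congr fun k => ?_
  ring

/-- For μ ≠ 0 the equation μ d(μ) = exp μ - 1 gives the zeros of exp μ - 1. At μ = 0 the value is 1,
which excludes n = 0. -/
theorem entireD_eq_zero_iff (μ : ℂ) :
    entireD μ = 0 ↔ ∃ n : ℤ, n ≠ 0 ∧ μ = 2 * Real.pi * Complex.I * n := by
  rcases eq_or_ne μ 0 with rfl | hμ
  · have h0 : entireD (0 : ℂ) = 1 := by
      rw [entireD, tsum_eq_single 0 (fun k hk => by simp [hk])]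
      simp
    simp only [h0, one_ne_zero, false_iff, not_exists, not_and]
    intro n hn h
    simp [hn, Real.pi_ne_zero] at h
  · have h1 : entireD μ = 0 ↔ Complex.exp μ = 1 := by
      rw [← sub_eq_zero (a := Complex.exp μ), ← mul_entireD, mul_eq_zero]
      simp [hμ]
    rw [h1, Complex.exp_eq_one_iff]
    constructor
    · rintro ⟨n, rfl⟩
      refine ⟨n, ?_, by ring⟩
      rintro rfl
      simp at hμ
    · rintro ⟨n, -, rfl⟩
      exact ⟨n, by ring⟩

variable {V : Type*} [NormedAddCommGroup V] [NormedSpace ℂ V] [FiniteDimensional ℂ V]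

/-- The operator `a` has no eigenvalue in `2 π i (ℤ \ {0})`. -/
def NonResonantOp (a : V →ₗ[ℂ] V) : Prop :=
  ∀ n : ℤ, n ≠ 0 → ¬ Module.End.HasEigenvalue a (2 * Real.pi * Complex.I * n)

theorem entireD_apply_eigenvector (a : V →L[ℂ] V) {μ : ℂ} {v : V} (h : a v = μ • v) :
    entireD a v = entireD μ • v := by
  have hp : ∀ k : ℕ, (a ^ k) v = μ ^ k • v := by
    intro k
    induction k with
    | zero => simp
    | succ k ih =>
      rw [pow_succ', pow_succ', mul_apply_eq_comp, ih, map_smul, h, smul_smul, mul_comm]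
  have h1 := (ContinuousLinearMap.apply ℂ V v).map_tsum (summable_entireD a)
  have h2 := (ContinuousLinearMap.toSpanSingleton ℂ v).map_tsum (summable_entireD μ)
  refine h1.trans (Eq.trans (tsum_congr fun k => ?_) h2.symm)
  simp [hp, smul_smul]

/-- The kernel of d(a) is a-invariant, so if it is nonzero it contains an eigenvector of a, whose
eigenvalue is a zero of d. This identifies non-resonance with the domain on which φ is analytic. -/
theorem isUnit_entireD_iff (a : V →L[ℂ] V) :
    IsUnit (entireD a) ↔ NonResonantOp (a : V →ₗ[ℂ] V) := by
  constructor
  · rintro ⟨u, hu⟩ n hn h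
    obtain ⟨v, hv⟩ := h.exists_hasEigenvector
    have h1 : entireD a v = 0 := by
      rw [entireD_apply_eigenvector a hv.apply_eq_smul, (entireD_eq_zero_iff _).2 ⟨n, hn, rfl⟩,
        zero_smul]
    apply hv.2
    have : (↑u⁻¹ * ↑u : V →L[ℂ] V) v = 0 := by
      rw [mul_apply_eq_comp, hu, h1, map_zero]
    simpa using this
  · intro h
    have hinj : Function.Injective ((entireD a : V →L[ℂ] V) : V →ₗ[ℂ] V) := by
      rw [← LinearMap.ker_eq_bot]
      by_contra hne
      have hcomm : entireD a * a = a * entireD a := by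
        rw [entireD, ← (summable_entireD a).tsum_mul_left, ← (summable_entireD a).tsum_mul_right]
        refine tsum_congr fun k => ?_
        rw [smul_mul_assoc, mul_smul_comm, pow_mul_comm']
      have hinv : ∀ v ∈ LinearMap.ker ((entireD a : V →L[ℂ] V) : V →ₗ[ℂ] V), (a : V →ₗ[ℂ] V) v ∈ LinearMap.ker ((entireD a : V →L[ℂ] V) : V →ₗ[ℂ] V) := by
        intro v hv
        have := congrArg (fun f : V →L[ℂ] V => f v) hcomm
        rw [LinearMap.mem_ker] at hv ⊢
        refine this.trans ?_
        change a (entireD a v) = 0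
        rw [show entireD a v = 0 from hv, map_zero]
      have : Nontrivial (LinearMap.ker ((entireD a : V →L[ℂ] V) : V →ₗ[ℂ] V)) :=
        Submodule.nontrivial_iff_ne_bot.2 hne
      obtain ⟨μ, hμ⟩ := Module.End.exists_eigenvalue ((a : V →ₗ[ℂ] V).restrict hinv)
      obtain ⟨⟨v, hv⟩, hvμ⟩ := hμ.exists_hasEigenvector
      have hv0 : v ≠ 0 := fun h0 => hvμ.2 (Subtype.ext h0)
      have hav : a v = μ • v := congrArg Subtype.val hvμ.apply_eq_smul
      have h0 : entireD μ • v = 0 := by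
        rw [← entireD_apply_eigenvector a hav]; exact hv
      obtain ⟨n, hn, rfl⟩ := (entireD_eq_zero_iff μ).1 ((smul_eq_zero.1 h0).resolve_right hv0)
      exact h n hn (Module.End.hasEigenvalue_of_hasEigenvector
        ⟨Module.End.mem_eigenspace_iff.2 hav, hv0⟩)
    let e : V ≃L[ℂ] V := (LinearEquiv.ofInjectiveEndo _ hinj).toContinuousLinearEquiv
    refine ⟨ContinuousLinearEquiv.toUnit e, ?_⟩
    ext v
    rfl

theorem isOpen_nonResonantOp : IsOpen {a : V →L[ℂ] V | NonResonantOp (a : V →ₗ[ℂ] V)} := by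
  have : {a : V →L[ℂ] V | NonResonantOp (a : V →ₗ[ℂ] V)} = entireD ⁻¹' {u | IsUnit u} := by
    ext a
    exact (isUnit_entireD_iff a).symm
  rw [this]
  exact Units.isOpen.preimage
    (continuous_iff_continuousAt.2 fun a => (analyticAt_entireD a).continuousAt)

/-- On a complex line through a nonresonant operator, the resonant operators form a countable
set. -/
theorem countable_resonant_line {a b : V →ₗ[ℂ] V} (ha : NonResonantOp a) :
    {z : ℂ | ¬ NonResonantOp (a + z • b)}.Countable := by
  have hsub : {z : ℂ | ¬ NonResonantOp (a + z • b)} ⊆ ⋃ n ∈ {n : ℤ | n ≠ 0},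
      {z : ℂ | Module.End.HasEigenvalue (a + z • b) (2 * Real.pi * Complex.I * n)} := by
    intro z hz
    simp only [NonResonantOp, Set.mem_ofPred_eq, not_forall, not_not] at hz
    obtain ⟨n, hn, h⟩ := hz
    exact Set.mem_biUnion hn h
  refine (Set.Countable.biUnion (Set.to_countable _) fun n hn => Set.Finite.countable ?_).mono hsub
  set c : ℂ := 2 * Real.pi * Complex.I * n with hc
  have hinj : Function.Injective (a - c • (LinearMap.id : V →ₗ[ℂ] V)) := by
    rw [← LinearMap.ker_eq_bot, LinearMap.ker_eq_bot']
    intro v hv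
    by_contra hv0
    exact ha n hn (Module.End.hasEigenvalue_of_hasEigenvector
      ⟨Module.End.mem_eigenspace_iff.2 (sub_eq_zero.1 hv), hv0⟩)
  let T := LinearEquiv.ofInjectiveEndo _ hinj
  have hT : ∀ v, T v = a v - c • v := fun v => rfl
  -- If (a + zb)v = cv then (a - c)v = -z bv, so -z⁻¹ is an eigenvalue of (a - c)⁻¹b. There are
  -- finitely many of these for each c, and countably many c.
  have hfin : {μ : ℂ | Module.End.HasEigenvalue ((T.symm : V →ₗ[ℂ] V) ∘ₗ b) μ}.Finite :=
    Module.End.finite_hasEigenvalue _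
  refine (hfin.preimage (f := fun z : ℂ => -z⁻¹) fun x _ y _ h => by simpa using h).subset ?_
  intro z hz
  obtain ⟨v, hv⟩ := hz.exists_hasEigenvector
  have h1 : T v = -(z • b v) := by
    have := hv.apply_eq_smul
    rw [hT, sub_eq_iff_eq_add, ← this]
    simp
  have hz0 : z ≠ 0 := by
    rintro rfl
    rw [zero_smul, neg_zero] at h1
    exact hv.2 (T.map_eq_zero_iff.1 h1)
  refine Module.End.hasEigenvalue_of_hasEigenvector (x := v)
    ⟨Module.End.mem_eigenspace_iff.2 ?_, hv.2⟩
  have h2 : b v = T (-z⁻¹ • v) := by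
    rw [map_smul, h1]; simp [smul_smul, hz0]
  rw [LinearMap.comp_apply, h2, LinearEquiv.coe_coe, T.symm_apply_apply]

omit [FiniteDimensional ℂ V] in
-- Two points of U lie on a complex line, a real plane, that meets the complement of U in a
-- countable set. A plane minus a countable set is connected.
theorem isPreconnected_of_countable_line {U : Set V}
    (h : ∀ x ∈ U, ∀ y : V, {z : ℂ | x + z • y ∉ U}.Countable) : IsPreconnected U := by
  refine isPreconnected_of_forall_pair fun x hx y hy => ?_
  have hc := h x hx (y - x)
  refine ⟨(fun z : ℂ => x + z • (y - x)) '' {z : ℂ | x + z • (y - x) ∉ U}ᶜ, ?_, ?_, ?_, ?_⟩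
  · rintro _ ⟨z, hz, rfl⟩
    simpa using hz
  · exact ⟨0, by simpa using hx, by simp⟩
  · exact ⟨1, by simpa using hy, by simp⟩
  · refine (hc.isConnected_compl_of_one_lt_rank ?_).isPreconnected.image _ (by fun_prop)
    rw [Complex.rank_real_complex]; norm_num

end Spectrum

end RelGW

namespace RelGW

open Filter Topology

/-! ### Derivatives of products and inverses at the identity of a Lie group. -/

section GroupDerivatives

variable {𝕜 : Type*} [NontriviallyNormedField 𝕜]
  {E : Type*} [NormedAddCommGroup E] [NormedSpace 𝕜 E]
  {G : Type*} [TopologicalSpace G] [ChartedSpace E G] [Group G] [LieGroup 𝓘(𝕜, E) ω G]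
  {E' : Type*} [NormedAddCommGroup E'] [NormedSpace 𝕜 E'] {H' : Type*} [TopologicalSpace H']
  {I' : ModelWithCorners 𝕜 E' H'} {M : Type*} [TopologicalSpace M] [ChartedSpace H' M]

theorem mdifferentiableAt_mul_left' (g h : G) :
    MDifferentiableAt 𝓘(𝕜, E) 𝓘(𝕜, E) (fun x : G => g * x) h :=
  (contMDiff_mul_left (I := 𝓘(𝕜, E)) (n := ω)).contMDiffAt.mdifferentiableAt (by simp)

theorem mdifferentiableAt_mul_right' (g h : G) :
    MDifferentiableAt 𝓘(𝕜, E) 𝓘(𝕜, E) (fun x : G => x * g) h :=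
  (contMDiff_mul_right (I := 𝓘(𝕜, E)) (n := ω)).contMDiffAt.mdifferentiableAt (by simp)

theorem hasMFDerivAt_mul_one :
    HasMFDerivAt (𝓘(𝕜, E).prod 𝓘(𝕜, E)) 𝓘(𝕜, E) (fun p : G × G => p.1 * p.2) (1, 1)
      (ContinuousLinearMap.fst 𝕜 E E + ContinuousLinearMap.snd 𝕜 E E : E × E →L[𝕜] E) := by
  have hd : MDifferentiableAt (𝓘(𝕜, E).prod 𝓘(𝕜, E)) 𝓘(𝕜, E) (fun p : G × G => p.1 * p.2) (1, 1) :=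
    (contMDiff_mul 𝓘(𝕜, E) ω).contMDiffAt.mdifferentiableAt (by simp)
  have h1 := hd.hasMFDerivAt
  rw [mfderiv_prod_eq_add hd] at h1
  have e1 : (fun z : G × G => z.1 * ((1 : G), (1 : G)).2) = Prod.fst := by funext z; simp
  have e2 : (fun z : G × G => ((1 : G), (1 : G)).1 * z.2) = Prod.snd := by funext z; simp
  have f1 := hasMFDerivAt_fst (I := 𝓘(𝕜, E)) (I' := 𝓘(𝕜, E)) ((1 : G), (1 : G))
  have f2 := hasMFDerivAt_snd (I := 𝓘(𝕜, E)) (I' := 𝓘(𝕜, E)) ((1 : G), (1 : G))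
  rw [← e1] at f1
  rw [← e2] at f2
  rw [f1.mfderiv, f2.mfderiv] at h1
  exact h1

/-- Requiring both factors to take the value 1 makes the product rule a plain sum in T_1 G. Other
products are first translated to the identity. -/
theorem hasMFDerivAt_mul_of_eq_one {f h : M → G} {p : M} {f' h' : E' →L[𝕜] E}
    (hf : HasMFDerivAt I' 𝓘(𝕜, E) f p f') (hh : HasMFDerivAt I' 𝓘(𝕜, E) h p h')
    (hf1 : f p = 1) (hh1 : h p = 1) :
    HasMFDerivAt I' 𝓘(𝕜, E) (fun q => f q * h q) p (f' + h' : E' →L[𝕜] E) := by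
  have h1 : HasMFDerivAt I' (𝓘(𝕜, E).prod 𝓘(𝕜, E)) (fun q => (f q, h q)) p (f'.prod h') :=
    hf.prodMk hh
  have h2 := hasMFDerivAt_mul_one (𝕜 := 𝕜) (E := E) (G := G)
  have h3 : ((1 : G), (1 : G)) = (f p, h p) := by rw [hf1, hh1]
  rw [h3] at h2
  have := HasMFDerivAt.comp p h2 h1
  exact this

theorem hasMFDerivAt_inv_one :
    HasMFDerivAt 𝓘(𝕜, E) 𝓘(𝕜, E) (fun x : G => x⁻¹) 1
      (-ContinuousLinearMap.id 𝕜 E : E →L[𝕜] E) := by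
  have hd : MDifferentiableAt 𝓘(𝕜, E) 𝓘(𝕜, E) (fun x : G => x⁻¹) 1 :=
    (contMDiff_inv 𝓘(𝕜, E) ω).contMDiffAt.mdifferentiableAt (by simp)
  have h1 := hd.hasMFDerivAt
  have h2 := hasMFDerivAt_mul_of_eq_one (hasMFDerivAt_id (I := 𝓘(𝕜, E)) (1 : G)) h1 rfl inv_one
  have h3 : (fun q : G => id q * q⁻¹) = fun _ => 1 := by funext q; simp
  rw [h3] at h2
  have h4 := hasMFDerivAt_unique h2 (hasMFDerivAt_const (I := 𝓘(𝕜, E)) (I' := 𝓘(𝕜, E)) (1 : G) (1 : G))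
  have h5 : (mfderiv 𝓘(𝕜, E) 𝓘(𝕜, E) (fun x : G => x⁻¹) 1 : E →L[𝕜] E) =
    -ContinuousLinearMap.id 𝕜 E := eq_neg_of_add_eq_zero_right h4
  rw [h5] at h1
  exact h1

theorem hasMFDerivAt_inv_of_eq_one {f : M → G} {p : M} {f' : E' →L[𝕜] E}
    (hf : HasMFDerivAt I' 𝓘(𝕜, E) f p f') (hf1 : f p = 1) :
    HasMFDerivAt I' 𝓘(𝕜, E) (fun q => (f q)⁻¹) p (-f' : E' →L[𝕜] E) := by
  have h2 := hasMFDerivAt_inv_one (𝕜 := 𝕜) (E := E) (G := G)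
  rw [← hf1] at h2
  have e : (-f' : E' →L[𝕜] E) = (-ContinuousLinearMap.id 𝕜 E).comp f' := by ext v; rfl
  rw [e]
  exact HasMFDerivAt.comp p h2 hf

end GroupDerivatives

/-! ### The adjoint representation and translations. -/

section Adjoint

variable {E : Type*} [NormedAddCommGroup E] [NormedSpace ℂ E]
  {G : Type*} [TopologicalSpace G] [ChartedSpace E G] [Group G] [LieGroup 𝓘(ℂ, E) ω G]
  {E' : Type*} [NormedAddCommGroup E'] [NormedSpace ℂ E'] {H' : Type*} [TopologicalSpace H']
  {I' : ModelWithCorners ℂ E' H'} {M : Type*} [TopologicalSpace M] [ChartedSpace H' M]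

theorem mdifferentiableAt_conj (g h : G) :
    MDifferentiableAt 𝓘(ℂ, E) 𝓘(ℂ, E) (fun x : G => g * x * g⁻¹) h :=
  (mdifferentiableAt_mul_right' (𝕜 := ℂ) g⁻¹ (g * h)).comp h (mdifferentiableAt_mul_left' g h)

theorem hasMFDerivAt_conj (g : G) :
    HasMFDerivAt 𝓘(ℂ, E) 𝓘(ℂ, E) (fun x : G => g * x * g⁻¹) 1 (Ad g : E →L[ℂ] E) :=
  (mdifferentiableAt_conj g 1).hasMFDerivAt

theorem hasMFDerivAt_conj_of_eq_one {f : M → G} {p : M} {f' : E' →L[ℂ] E}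
    (hf : HasMFDerivAt I' 𝓘(ℂ, E) f p f') (hf1 : f p = 1) (g : G) :
    HasMFDerivAt I' 𝓘(ℂ, E) (fun q => g * f q * g⁻¹) p ((Ad g : E →L[ℂ] E).comp f') := by
  have h2 := hasMFDerivAt_conj (E := E) g
  rw [← hf1] at h2
  exact HasMFDerivAt.comp p h2 hf

theorem Ad_mul (g h : G) : (Ad (g * h) : LieAlg E G →L[ℂ] LieAlg E G) = (Ad g).comp (Ad h) := by
  have h1 := hasMFDerivAt_conj_of_eq_one (hasMFDerivAt_conj (E := E) h) (by simp) g
  have e : (fun q : G => g * (h * q * h⁻¹) * g⁻¹) = fun q => (g * h) * q * (g * h)⁻¹ := by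
    funext q; group
  rw [e] at h1
  have h0 := hasMFDerivAt_conj (E := E) (g * h)
  exact hasMFDerivAt_unique (E := E) (E' := E) h0 h1

theorem Ad_one : (Ad (1 : G) : LieAlg E G →L[ℂ] LieAlg E G) = ContinuousLinearMap.id ℂ _ := by
  have h1 := hasMFDerivAt_conj (E := E) (1 : G)
  have e : (fun q : G => 1 * q * 1⁻¹) = id := by funext q; simp
  rw [e] at h1
  have h2 := hasMFDerivAt_id (I := 𝓘(ℂ, E)) (1 : G)
  exact hasMFDerivAt_unique (E := E) (E' := E) h1 h2

theorem Ad_mul_apply (g h : G) (x : LieAlg E G) : Ad (g * h) x = Ad g (Ad h x) := by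
  rw [Ad_mul]; rfl

theorem Ad_inv_apply_Ad (g : G) (x : LieAlg E G) : Ad g⁻¹ (Ad g x) = x := by
  rw [← Ad_mul_apply, inv_mul_cancel, Ad_one]; rfl

theorem Ad_apply_Ad_inv (g : G) (x : LieAlg E G) : Ad g (Ad g⁻¹ x) = x := by
  rw [← Ad_mul_apply, mul_inv_cancel, Ad_one]; rfl

theorem hasMFDerivAt_mul_left (g : G) :
    HasMFDerivAt 𝓘(ℂ, E) 𝓘(ℂ, E) (fun x : G => g * x) 1 (dLeft g : E →L[ℂ] E) :=
  (mdifferentiableAt_mul_left' g 1).hasMFDerivAt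

/-- Differentiate x g = g (g⁻¹ x g) at x = 1. -/
theorem dRight_eq (g : G) (x : LieAlg E G) : (dRight g x : E) = dLeft g (Ad g⁻¹ x) := by
  have h1 := hasMFDerivAt_conj (E := E) g⁻¹
  have h2 := hasMFDerivAt_mul_left (E := E) g
  rw [show (1 : G) = g⁻¹ * 1 * g⁻¹⁻¹ by simp] at h2
  have h3 := HasMFDerivAt.comp 1 h2 h1
  have e : (fun x : G => g * x) ∘ (fun x : G => g⁻¹ * x * g⁻¹⁻¹) = fun x => x * g := by
    funext q; simp [mul_assoc]
  rw [e] at h3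
  have h4 : HasMFDerivAt 𝓘(ℂ, E) 𝓘(ℂ, E) (fun x : G => x * g) 1 (dRight g : E →L[ℂ] E) :=
    (mdifferentiableAt_mul_right' g 1).hasMFDerivAt
  exact congrArg (fun F : E →L[ℂ] E => F x) (hasMFDerivAt_unique h4 h3)

/-- A map is differentiable if its left translate to the identity is. -/
theorem hasMFDerivAt_of_translate {f : M → G} {p : M} {f' : E' →L[ℂ] E} (a : G) (ha : f p = a)
    (hf : HasMFDerivAt I' 𝓘(ℂ, E) (fun q => a⁻¹ * f q) p f') :
    HasMFDerivAt I' 𝓘(ℂ, E) f p ((dLeft a : E →L[ℂ] E).comp f') := by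
  have h2 := hasMFDerivAt_mul_left (E := E) a
  rw [show (1 : G) = a⁻¹ * f p by simp [ha]] at h2
  have h3 := HasMFDerivAt.comp p h2 hf
  have e : (fun x : G => a * x) ∘ (fun q => a⁻¹ * f q) = f := by funext q; simp
  rwa [e] at h3

theorem dLeft_bijective (g : G) : Function.Bijective (dLeft g : E →L[ℂ] E) := by
  have h1 := hasMFDerivAt_mul_left (E := E) g
  have h2 : HasMFDerivAt 𝓘(ℂ, E) 𝓘(ℂ, E) (fun x : G => g⁻¹ * x) (g * 1)
      (mfderiv 𝓘(ℂ, E) 𝓘(ℂ, E) (fun x : G => g⁻¹ * x) (g * 1)) :=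
    (mdifferentiableAt_mul_left' g⁻¹ (g * 1)).hasMFDerivAt
  have h3 := HasMFDerivAt.comp 1 h2 h1
  have e : (fun x : G => g⁻¹ * x) ∘ (fun x : G => g * x) = id := by funext q; simp
  rw [e] at h3
  have h4 := hasMFDerivAt_unique h3 (hasMFDerivAt_id (I := 𝓘(ℂ, E)) (1 : G))
  have h5 : HasMFDerivAt 𝓘(ℂ, E) 𝓘(ℂ, E) (fun x : G => g * x) (g⁻¹ * (g * 1)) (dLeft g : E →L[ℂ] E) := by
    rw [inv_mul_cancel_left]; exact h1
  have h6 := HasMFDerivAt.comp (g * 1) h5 h2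
  have e' : (fun x : G => g * x) ∘ (fun x : G => g⁻¹ * x) = id := by funext q; simp
  rw [e'] at h6
  have h7 := hasMFDerivAt_unique h6 (hasMFDerivAt_id (I := 𝓘(ℂ, E)) (g * 1))
  refine Function.bijective_iff_has_inverse.2
    ⟨(mfderiv 𝓘(ℂ, E) 𝓘(ℂ, E) (fun x : G => g⁻¹ * x) (g * 1) : E →L[ℂ] E), fun x => ?_, fun x => ?_⟩
  · exact congrArg (fun F : E →L[ℂ] E => F x) h4
  · exact congrArg (fun F : E →L[ℂ] E => F x) h7

end Adjoint

end RelGW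

namespace RelGW

open Filter Topology

/-! ### The differential of `Ad` is `ad`. -/

section AdjointDerivative

variable {E : Type*} [NormedAddCommGroup E] [NormedSpace ℂ E]
  {G : Type*} [TopologicalSpace G] [ChartedSpace E G] [Group G] [LieGroup 𝓘(ℂ, E) ω G]
  {E' : Type*} [NormedAddCommGroup E'] [NormedSpace ℂ E'] {H' : Type*} [TopologicalSpace H']
  {I' : ModelWithCorners ℂ E' H'} {M : Type*} [TopologicalSpace M] [ChartedSpace H' M]

/-- With constant base points the coordinate changes of the tangent bundles are identities. This
turns smoothness of a family of differentials into smoothness of an operator-valued function. -/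
theorem inTangentCoordinates_of_const {N : Type*} {E₁ : Type*} [NormedAddCommGroup E₁]
    [NormedSpace ℂ E₁] {E₂ : Type*} [NormedAddCommGroup E₂] [NormedSpace ℂ E₂]
    {M₁ M₂ : Type*} [TopologicalSpace M₁] [ChartedSpace E₁ M₁] [IsManifold 𝓘(ℂ, E₁) 1 M₁]
    [TopologicalSpace M₂] [ChartedSpace E₂ M₂] [IsManifold 𝓘(ℂ, E₂) 1 M₂]
    (a : M₁) (b : M₂) (ϕ : N → E₁ →L[ℂ] E₂) (x₀ x : N) :
    inTangentCoordinates 𝓘(ℂ, E₁) 𝓘(ℂ, E₂) (fun _ => a) (fun _ => b) ϕ x₀ x = ϕ x := by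
  rw [inTangentCoordinates_eq (x₀ := x₀) (x := x) _ _ _ (mem_chart_source _ _) (mem_chart_source _ _)]
  ext v
  simp only [ContinuousLinearMap.comp_apply]
  rw [(tangentBundleCore 𝓘(ℂ, E₁) M₁).coordChange_self _ _ (mem_achart_source E₁ a),
    (tangentBundleCore 𝓘(ℂ, E₂) M₂).coordChange_self _ _ (mem_achart_source E₂ b)]

theorem inTangentCoordinates_of_vectorSpace {E₁ : Type*} [NormedAddCommGroup E₁]
    [NormedSpace ℂ E₁] {E₂ : Type*} [NormedAddCommGroup E₂] [NormedSpace ℂ E₂]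
    {M₂ : Type*} [TopologicalSpace M₂] [ChartedSpace E₂ M₂] [IsManifold 𝓘(ℂ, E₂) 1 M₂]
    {N : Type*} (u : N → E₁)
    (b : M₂) (ϕ : N → E₁ →L[ℂ] E₂) (x₀ x : N) :
    inTangentCoordinates 𝓘(ℂ, E₁) 𝓘(ℂ, E₂) u (fun _ => b) ϕ x₀ x = ϕ x := by
  rw [inTangentCoordinates_eq (x₀ := x₀) (x := x) _ _ _
    (by rw [chartAt_self_eq]; trivial) (mem_chart_source _ _)]
  ext v
  simp only [ContinuousLinearMap.comp_apply]
  rw [(tangentBundleCore 𝓘(ℂ, E₂) M₂).coordChange_self _ _ (mem_achart_source E₂ b)]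
  simp

variable (E G) in
theorem contMDiff_Ad :
    ContMDiff 𝓘(ℂ, E) 𝓘(ℂ, LieAlg E G →L[ℂ] LieAlg E G) ω
      (fun g : G => (Ad g : LieAlg E G →L[ℂ] LieAlg E G)) := by
  intro g₀
  have h1 : ContMDiffAt (𝓘(ℂ, E).prod 𝓘(ℂ, E)) 𝓘(ℂ, E) ω
      (Function.uncurry fun g x : G => g * x * g⁻¹) (g₀, 1) :=
    ((contMDiff_fst.mul contMDiff_snd).mul contMDiff_fst.inv).contMDiffAt
  have h2 := ContMDiffAt.mfderiv (m := ω) (fun g x : G => g * x * g⁻¹) (fun _ => 1) h1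
    contMDiffAt_const (by simp)
  have e : (fun x : G => x * 1 * x⁻¹) = fun _ => 1 := by funext x; simp
  rw [e] at h2
  have e2 : inTangentCoordinates 𝓘(ℂ, E) 𝓘(ℂ, E) (fun _ : G => (1 : G)) (fun _ => (1 : G))
      (fun x : G => mfderiv 𝓘(ℂ, E) 𝓘(ℂ, E) (fun y : G => x * y * x⁻¹) 1) g₀ =
      fun g : G => (Ad g : E →L[ℂ] E) := by
    funext g
    exact inTangentCoordinates_of_const (E₁ := E) (E₂ := E) (1 : G) (1 : G)
      (fun x => (Ad x : E →L[ℂ] E)) g₀ g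
  rw [e2] at h2
  exact h2

variable (E G) in
/-- The multiplication of `G` in the preferred chart at `1`. -/
noncomputable def chartMul (p : E × E) : E :=
  extChartAt 𝓘(ℂ, E) (1 : G)
    ((extChartAt 𝓘(ℂ, E) (1 : G)).symm p.1 * (extChartAt 𝓘(ℂ, E) (1 : G)).symm p.2)

variable (E G) in
/-- The coordinates of `1`. -/
noncomputable def chartOne : E := extChartAt 𝓘(ℂ, E) (1 : G) 1

omit [LieGroup 𝓘(ℂ, E) ω G] in
theorem symm_chartOne : (extChartAt 𝓘(ℂ, E) (1 : G)).symm (chartOne E G) = 1 :=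
  extChartAt_to_inv 1

omit [LieGroup 𝓘(ℂ, E) ω G] in
theorem eventually_mem_target : ∀ᶠ u in 𝓝 (chartOne E G), u ∈ (extChartAt 𝓘(ℂ, E) (1 : G)).target :=
  extChartAt_target_mem_nhds 1

theorem contMDiffAt_chart_symm {u : E} (hu : u ∈ (extChartAt 𝓘(ℂ, E) (1 : G)).target) :
    ContMDiffAt 𝓘(ℂ, E) 𝓘(ℂ, E) ω (extChartAt 𝓘(ℂ, E) (1 : G)).symm u :=
  (contMDiffOn_extChartAt_symm (1 : G)).contMDiffAt ((isOpen_extChartAt_target 1).mem_nhds hu)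

theorem contDiffAt_chartMul : ContDiffAt ℂ ω (chartMul E G) (chartOne E G, chartOne E G) := by
  rw [← contMDiffAt_iff_contDiffAt]
  have h0 := contMDiffAt_chart_symm (E := E) (G := G) (u := chartOne E G)
    (mem_extChartAt_target 1)
  have h1 : ContMDiffAt 𝓘(ℂ, E × E) 𝓘(ℂ, E) ω
      (fun p : E × E => (extChartAt 𝓘(ℂ, E) (1 : G)).symm p.1) (chartOne E G, chartOne E G) :=
    ContMDiffAt.comp _ h0 contDiff_fst.contMDiff.contMDiffAt
  have h2 : ContMDiffAt 𝓘(ℂ, E × E) 𝓘(ℂ, E) ω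
      (fun p : E × E => (extChartAt 𝓘(ℂ, E) (1 : G)).symm p.2) (chartOne E G, chartOne E G) :=
    ContMDiffAt.comp _ h0 contDiff_snd.contMDiff.contMDiffAt
  refine ContMDiffAt.comp _ (contMDiffAt_extChartAt' ?_) (h1.mul h2)
  rw [symm_chartOne, mul_one]
  exact mem_chart_source E 1

theorem fderiv_chartMul_eventually :
    ∀ᶠ u in 𝓝 (chartOne E G), DifferentiableAt ℂ (chartMul E G) (u, chartOne E G) ∧
      DifferentiableAt ℂ (chartMul E G) (chartOne E G, u) := by
  have h : ∀ᶠ p in 𝓝 (chartOne E G, chartOne E G), DifferentiableAt ℂ (chartMul E G) p :=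
    (contDiffAt_chartMul.eventually (by simp)).mono fun p hp => hp.differentiableAt (by simp)
  have c1 : ContinuousAt (fun u => (u, chartOne E G)) (chartOne E G) := by fun_prop
  have c2 : ContinuousAt (fun u => (chartOne E G, u)) (chartOne E G) := by fun_prop
  exact (c1.eventually h).and (c2.eventually h)

variable (E G) in
/-- The differential at `φ⁻¹ u` of the preferred chart `φ` at `1`. -/
noncomputable def chartDeriv (u : E) : E →L[ℂ] E :=
  mfderiv 𝓘(ℂ, E) 𝓘(ℂ, E) (extChartAt 𝓘(ℂ, E) (1 : G)) ((extChartAt 𝓘(ℂ, E) (1 : G)).symm u)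

theorem hasMFDerivAt_chart {u : E} (hu : u ∈ (extChartAt 𝓘(ℂ, E) (1 : G)).target) :
    HasMFDerivAt 𝓘(ℂ, E) 𝓘(ℂ, E) (extChartAt 𝓘(ℂ, E) (1 : G))
      ((extChartAt 𝓘(ℂ, E) (1 : G)).symm u) (chartDeriv E G u) := by
  have hs : (extChartAt 𝓘(ℂ, E) (1 : G)).symm u ∈ (chartAt E (1 : G)).source := by
    simpa using (extChartAt 𝓘(ℂ, E) (1 : G)).map_target hu
  exact (mdifferentiableAt_extChartAt hs).hasMFDerivAt

/-- In the chart, the partial derivative of the multiplication in its second argument at (u, 1) is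
the differential of a left translation. So left invariant vector fields are partial derivatives of
one analytic map. -/
theorem fderiv_chartMul_right :
    ∀ᶠ u in 𝓝 (chartOne E G), ∀ v : E, fderiv ℂ (chartMul E G) (u, chartOne E G) (0, v) =
      chartDeriv E G u (dLeft ((extChartAt 𝓘(ℂ, E) (1 : G)).symm u) v) := by
  filter_upwards [eventually_mem_target (E := E) (G := G),
    fderiv_chartMul_eventually (E := E) (G := G)] with u hu hd
  have h3 := hasMFDerivAt_chart hu
  set φ := extChartAt 𝓘(ℂ, E) (1 : G) with hφ
  rw [show φ.symm u = φ.symm u * 1 by rw [mul_one]] at h3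
  have h4 := HasMFDerivAt.comp (1 : G) h3 (hasMFDerivAt_mul_left (E := E) (φ.symm u))
  have h5 : HasFDerivAt (fun w => chartMul E G (u, w))
      ((chartDeriv E G u).comp (dLeft (φ.symm u) : E →L[ℂ] E)) (chartOne E G) := by
    have := h4.2
    rw [ModelWithCorners.range_eq_univ] at this
    exact hasFDerivWithinAt_univ.1 this
  have h6 : HasFDerivAt (fun w => chartMul E G (u, w))
      ((fderiv ℂ (chartMul E G) (u, chartOne E G)).comp (ContinuousLinearMap.inr ℂ E E))
      (chartOne E G) :=
    hd.1.hasFDerivAt.comp (chartOne E G) (hasFDerivAt_prodMk_right u (chartOne E G))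
  intro v
  exact (DFunLike.congr_fun (F := E →L[ℂ] E) (HasFDerivAt.unique (E := E) (F := E) h5 h6) v).symm

theorem fderiv_chartMul_left :
    ∀ᶠ u in 𝓝 (chartOne E G), ∀ v : E, fderiv ℂ (chartMul E G) (chartOne E G, u) (v, 0) =
      chartDeriv E G u (dRight ((extChartAt 𝓘(ℂ, E) (1 : G)).symm u) v) := by
  filter_upwards [eventually_mem_target (E := E) (G := G),
    fderiv_chartMul_eventually (E := E) (G := G)] with u hu hd
  have h3 := hasMFDerivAt_chart hu
  set φ := extChartAt 𝓘(ℂ, E) (1 : G) with hφ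
  rw [show φ.symm u = 1 * φ.symm u by rw [one_mul]] at h3
  have h4' : HasMFDerivAt 𝓘(ℂ, E) 𝓘(ℂ, E) (fun x : G => x * φ.symm u) 1
      (dRight (φ.symm u) : E →L[ℂ] E) := (mdifferentiableAt_mul_right' _ _).hasMFDerivAt
  have h4 := HasMFDerivAt.comp (1 : G) h3 h4'
  have h5 : HasFDerivAt (fun w => chartMul E G (w, u))
      ((chartDeriv E G u).comp (dRight (φ.symm u) : E →L[ℂ] E)) (chartOne E G) := by
    have := h4.2
    rw [ModelWithCorners.range_eq_univ] at this
    exact hasFDerivWithinAt_univ.1 this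
  have h6 : HasFDerivAt (fun w => chartMul E G (w, u))
      ((fderiv ℂ (chartMul E G) (chartOne E G, u)).comp (ContinuousLinearMap.inl ℂ E E))
      (chartOne E G) :=
    hd.2.hasFDerivAt.comp (f := fun w => (w, u)) (chartOne E G)
      (hasFDerivAt_prodMk_left (chartOne E G) u)
  intro v
  exact (DFunLike.congr_fun (F := E →L[ℂ] E) (HasFDerivAt.unique (E := E) (F := E) h5 h6) v).symm

/-- The left invariant vector field in the chart at `1`. -/
theorem mpullback_mulInvariantVectorField_chart (v : GroupLieAlgebra 𝓘(ℂ, E) G) :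
    ∀ᶠ u in 𝓝 (chartOne E G), VectorField.mpullbackWithin 𝓘(ℂ, E) 𝓘(ℂ, E)
      (extChartAt 𝓘(ℂ, E) (1 : G)).symm (mulInvariantVectorField v) (Set.range 𝓘(ℂ, E)) u =
      fderiv ℂ (chartMul E G) (u, chartOne E G) (0, v) := by
  filter_upwards [eventually_mem_target (E := E) (G := G),
    fderiv_chartMul_right (E := E) (G := G)] with u hu hd
  have h1 := mfderiv_extChartAt_comp_mfderivWithin_extChartAt_symm (I := 𝓘(ℂ, E)) (x := (1 : G)) hu
  have h2 := mfderivWithin_extChartAt_symm_comp_mfderiv_extChartAt (I := 𝓘(ℂ, E)) (x := (1 : G)) hu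
  rw [VectorField.mpullbackWithin_apply, ContinuousLinearMap.inverse_eq h2 h1]
  exact (hd v).symm

theorem fderiv_chartMul_one_right (v : E) :
    fderiv ℂ (chartMul E G) (chartOne E G, chartOne E G) (0, v) = v := by
  have hd := (fderiv_chartMul_eventually (E := E) (G := G)).self_of_nhds.1
  have h1 := hd.hasFDerivAt.comp (chartOne E G) (hasFDerivAt_prodMk_right (chartOne E G) (chartOne E G))
  have h2 : (chartMul E G ∘ fun w => (chartOne E G, w)) =ᶠ[𝓝 (chartOne E G)] id := by
    filter_upwards [eventually_mem_target (E := E) (G := G)] with w hw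
    simp only [Function.comp, chartMul, symm_chartOne, one_mul, id]
    exact (extChartAt 𝓘(ℂ, E) (1 : G)).right_inv hw
  exact DFunLike.congr_fun (h1.unique ((hasFDerivAt_id _).congr_of_eventuallyEq h2)) v

theorem fderiv_chartMul_one_left (v : E) :
    fderiv ℂ (chartMul E G) (chartOne E G, chartOne E G) (v, 0) = v := by
  have hd := (fderiv_chartMul_eventually (E := E) (G := G)).self_of_nhds.1
  have h1 := hd.hasFDerivAt.comp (f := fun w => (w, chartOne E G)) (chartOne E G)
    (hasFDerivAt_prodMk_left (chartOne E G) (chartOne E G))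
  have h2 : (chartMul E G ∘ fun w => (w, chartOne E G)) =ᶠ[𝓝 (chartOne E G)] id := by
    filter_upwards [eventually_mem_target (E := E) (G := G)] with w hw
    simp only [Function.comp, chartMul, symm_chartOne, mul_one, id]
    exact (extChartAt 𝓘(ℂ, E) (1 : G)).right_inv hw
  exact DFunLike.congr_fun (h1.unique ((hasFDerivAt_id _).congr_of_eventuallyEq h2)) v

theorem lie_eq_chart [CompleteSpace E] (x y : LieAlg E G) :
    (⁅x, y⁆ : LieAlg E G) =
      (fderiv ℂ (fun u => fderiv ℂ (chartMul E G) (u, chartOne E G) ((0 : E), (y : E))) (chartOne E G) x -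
       fderiv ℂ (fun u => fderiv ℂ (chartMul E G) (u, chartOne E G) ((0 : E), (x : E))) (chartOne E G) y : E) := by
  have h0 : (⁅x, y⁆ : LieAlg E G) = VectorField.mlieBracketWithin 𝓘(ℂ, E)
    (mulInvariantVectorField (toGLA x)) (mulInvariantVectorField (toGLA y)) Set.univ (1 : G) := rfl
  have e1 : ((extChartAt 𝓘(ℂ, E) (1 : G)).symm ⁻¹' Set.univ ∩ Set.range 𝓘(ℂ, E)) = Set.univ := by
    simp
  rw [h0, VectorField.mlieBracketWithin_apply, mfderiv_extChartAt_self, e1]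
  have hx := mpullback_mulInvariantVectorField_chart (toGLA x)
  have hy := mpullback_mulInvariantVectorField_chart (toGLA y)
  have hi : ∀ w : E, (ContinuousLinearMap.id ℂ E).inverse w = w := by
    intro w; rw [ContinuousLinearMap.inverse_id]; rfl
  refine (hi _).trans ?_
  have key : ∀ V W V' W' : E → E, V =ᶠ[𝓝 (chartOne E G)] V' → W =ᶠ[𝓝 (chartOne E G)] W' →
      VectorField.lieBracketWithin ℂ V W Set.univ (chartOne E G) =
        fderiv ℂ W' (chartOne E G) (V' (chartOne E G)) -
          fderiv ℂ V' (chartOne E G) (W' (chartOne E G)) := by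
    intro V W V' W' h1 h2
    rw [VectorField.lieBracketWithin_univ, h1.lieBracket_vectorField_eq h2, VectorField.lieBracket]
  refine (key _ _ _ _ hx hy).trans ?_
  exact congrArg₂ (· - ·) (congrArg _ (fderiv_chartMul_one_right _))
    (congrArg _ (fderiv_chartMul_one_right _))

variable (E G) in
/-- The coordinate expression of `Ad`. -/
noncomputable def chartAd (u : E) : E →L[ℂ] E := Ad ((extChartAt 𝓘(ℂ, E) (1 : G)).symm u)

theorem differentiableAt_chartAd : DifferentiableAt ℂ (chartAd E G) (chartOne E G) := by
  have h := (contMDiff_Ad E G).contMDiffAt.comp (chartOne E G)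
    (contMDiffAt_chart_symm (E := E) (G := G) (mem_extChartAt_target 1))
  exact (contMDiffAt_iff_contDiffAt.1 h).differentiableAt (by simp)

theorem chartAd_chartOne : chartAd E G (chartOne E G) = ContinuousLinearMap.id ℂ E := by
  unfold chartAd
  rw [symm_chartOne]
  exact Ad_one

/-- The chart version of r_g(Ad_g v) = l_g(v). It determines `Ad` by the two partial derivatives of
the multiplication. -/
theorem eventually_chartAd (v : E) : ∀ᶠ u in 𝓝 (chartOne E G),
    fderiv ℂ (chartMul E G) (chartOne E G, u) (chartAd E G u v, 0) =
      fderiv ℂ (chartMul E G) (u, chartOne E G) (0, v) := by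
  filter_upwards [fderiv_chartMul_left (E := E) (G := G),
    fderiv_chartMul_right (E := E) (G := G)] with u h1 h2
  rw [h1, h2]
  refine congrArg _ ?_
  refine (dRight_eq _ _).trans ?_
  exact congrArg _ (Ad_inv_apply_Ad _ _)

/-- Differentiate `eventually_chartAd` at the identity in the direction x. The second derivative of
the multiplication in (0, x), (y, 0) appears, and its symmetry turns it into the derivative of the
left invariant field of x in the direction y. -/
theorem fderiv_chartAd_eq_sub (x y : E) :
    fderiv ℂ (chartAd E G) (chartOne E G) x y =
      fderiv ℂ (fun u => fderiv ℂ (chartMul E G) (u, chartOne E G) ((0 : E), y)) (chartOne E G) x -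
      fderiv ℂ (fun u => fderiv ℂ (chartMul E G) (u, chartOne E G) ((0 : E), x)) (chartOne E G) y := by
  set e := chartOne E G with he
  have hm : DifferentiableAt ℂ (fderiv ℂ (chartMul E G)) (e, e) :=
    (contDiffAt_chartMul.fderiv_right (m := ω) (by simp)).differentiableAt (by simp)
  have hsym : IsSymmSndFDerivAt ℂ (chartMul E G) (e, e) :=
    contDiffAt_chartMul.isSymmSndFDerivAt (by simp)
  set D := fderiv ℂ (fderiv ℂ (chartMul E G)) (e, e) with hD
  have hl : HasFDerivAt (fun u => fderiv ℂ (chartMul E G) (e, u))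
      (D.comp (ContinuousLinearMap.inr ℂ E E)) e :=
    hm.hasFDerivAt.comp e (hasFDerivAt_prodMk_right e e)
  have hr : HasFDerivAt (fun u => fderiv ℂ (chartMul E G) (u, e))
      (D.comp (ContinuousLinearMap.inl ℂ E E)) e :=
    hm.hasFDerivAt.comp (f := fun w => (w, e)) e (hasFDerivAt_prodMk_left e e)
  have hr' : ∀ v w : E, fderiv ℂ (fun u => fderiv ℂ (chartMul E G) (u, e) ((0 : E), v)) e w =
      D (w, 0) (0, v) := by
    intro v w
    rw [(hr.clm_apply (hasFDerivAt_const _ _)).fderiv]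
    simp
  have ha := (differentiableAt_chartAd (E := E) (G := G)).hasFDerivAt
  have ha' := (ContinuousLinearMap.inl ℂ E E).hasFDerivAt.comp e
    (ha.clm_apply (hasFDerivAt_const (y : E) e))
  have hc := (hl.clm_apply ha').congr_of_eventuallyEq (f₁ := fun u =>
    fderiv ℂ (chartMul E G) (u, e) ((0 : E), (y : E)))
    ((eventually_chartAd (y : E)).mono fun u hu => hu.symm)
  have hc' := DFunLike.congr_fun (hc.unique (hr.clm_apply (hasFDerivAt_const ((0 : E), (y : E)) e))) x
  rw [hr', hr', show D (y, 0) (0, x) = D (0, x) (y, 0) from hsym _ _]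
  simp only [_root_.add_apply, ContinuousLinearMap.comp_apply,
    ContinuousLinearMap.flip_apply, _root_.zero_apply, map_zero, zero_add,
    Function.comp_apply, ContinuousLinearMap.inl_apply, ContinuousLinearMap.inr_apply] at hc'
  rw [show chartAd E G e y = y by rw [he, chartAd_chartOne]; rfl] at hc'
  rw [← hc', ← he]
  simp [he, fderiv_chartMul_one_left]

theorem fderiv_chartAd [CompleteSpace E] (x y : LieAlg E G) :
    (fderiv ℂ (chartAd E G) (chartOne E G) (x : E) (y : E) : E) = (⁅x, y⁆ : LieAlg E G) :=
  (fderiv_chartAd_eq_sub (E := E) (G := G) x y).trans (lie_eq_chart x y).symm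

variable [FiniteDimensional ℂ E]

variable (E G) in
/-- The adjoint representation of `𝔤` as a continuous linear map. -/
noncomputable def adCLM : LieAlg E G →L[ℂ] LieAlg E G →L[ℂ] LieAlg E G :=
  (LieModule.toEnd ℂ (LieAlg E G) (LieAlg E G) :
    LieAlg E G →ₗ[ℂ] LieAlg E G →ₗ[ℂ] LieAlg E G).toContinuousBilinearMap

end AdjointDerivative

section

variable {E : Type*} [NormedAddCommGroup E] [NormedSpace ℂ E] [FiniteDimensional ℂ E]
  {G : Type*} [TopologicalSpace G] [ChartedSpace E G] [Group G] [LieGroup 𝓘(ℂ, E) ω G]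

theorem hasMFDerivAt_Ad_one :
    HasMFDerivAt 𝓘(ℂ, E) 𝓘(ℂ, LieAlg E G →L[ℂ] LieAlg E G)
      (fun g : G => (Ad g : LieAlg E G →L[ℂ] LieAlg E G)) 1
      (adCLM E G : E →L[ℂ] (LieAlg E G →L[ℂ] LieAlg E G)) := by
  refine ⟨(contMDiff_Ad E G).continuous.continuousAt, ?_⟩
  have h := (differentiableAt_chartAd (E := E) (G := G)).hasFDerivAt
  have h2 : fderiv ℂ (chartAd E G) (chartOne E G) = (adCLM E G : E →L[ℂ] (E →L[ℂ] E)) := by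
    ext x y
    exact fderiv_chartAd (E := E) (G := G) x y
  rw [h2] at h
  rw [ModelWithCorners.range_eq_univ]
  exact hasFDerivWithinAt_univ.2 h

/-- Differentiate Ad_(g h g⁻¹) = Ad_g Ad_h Ad_g⁻¹ at h = 1. -/
theorem Ad_lie (g : G) (x y : LieAlg E G) : Ad g ⁅x, y⁆ = ⁅Ad g x, Ad g y⁆ := by
  have h1 : HasMFDerivAt 𝓘(ℂ, E) 𝓘(ℂ, LieAlg E G →L[ℂ] LieAlg E G)
      (fun h : G => (Ad (g * h * g⁻¹) : LieAlg E G →L[ℂ] LieAlg E G)) 1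
      ((adCLM E G).comp (Ad g) : E →L[ℂ] (LieAlg E G →L[ℂ] LieAlg E G)) := by
    have h0 := hasMFDerivAt_Ad_one (E := E) (G := G)
    rw [show (1 : G) = g * 1 * g⁻¹ by simp] at h0
    exact HasMFDerivAt.comp (1 : G) h0 (hasMFDerivAt_conj g)
  have h2 : HasMFDerivAt 𝓘(ℂ, E) 𝓘(ℂ, LieAlg E G →L[ℂ] LieAlg E G)
      (fun h : G => (Ad (g * h * g⁻¹) : LieAlg E G →L[ℂ] LieAlg E G)) 1
      ((((ContinuousLinearMap.compL ℂ (LieAlg E G) (LieAlg E G) (LieAlg E G)) (Ad g)).comp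
        (((ContinuousLinearMap.compL ℂ (LieAlg E G) (LieAlg E G) (LieAlg E G)).flip (Ad g⁻¹)).comp
          (adCLM E G))) : E →L[ℂ] (LieAlg E G →L[ℂ] LieAlg E G)) := by
    have h0 := (((ContinuousLinearMap.compL ℂ (LieAlg E G) (LieAlg E G) (LieAlg E G)) (Ad g)).comp
        ((ContinuousLinearMap.compL ℂ (LieAlg E G) (LieAlg E G) (LieAlg E G)).flip
          (Ad g⁻¹))).hasMFDerivAt (x := Ad (1 : G))
    have h3 := HasMFDerivAt.comp (1 : G) h0 (hasMFDerivAt_Ad_one (E := E) (G := G))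
    refine h3.congr_of_eventuallyEq (Filter.Eventually.of_forall fun h => ?_)
    ext v
    simp [Ad_mul_apply]
  have h4 := DFunLike.congr_fun (DFunLike.congr_fun
    (F := E →L[ℂ] (LieAlg E G →L[ℂ] LieAlg E G)) (hasMFDerivAt_unique h1 h2) x) (Ad g y)
  have h5 : ⁅Ad g x, Ad g y⁆ = Ad g ⁅x, Ad g⁻¹ (Ad g y)⁆ := h4
  rw [h5, Ad_inv_apply_Ad]

/-- Differentiating B(Ad_g x, Ad_g z) = B(x, z) at g = 1 in the direction y gives B([y, x], z) +
B(x, [y, z]) = 0. -/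
theorem isInvariantForm_of_Ad (B : LinearMap.BilinForm ℂ (LieAlg E G)) (hBsymm : B.IsSymm)
    (hBnd : B.Nondegenerate)
    (hBinv : ∀ (g : G) (x y : LieAlg E G), B (Ad g x) (Ad g y) = B x y) : IsInvariantForm B := by
  refine ⟨hBnd, fun x y => hBsymm.eq x y, fun x y z => ?_⟩
  have h1 := (differentiableAt_chartAd (E := E) (G := G)).hasFDerivAt
  set A := fderiv ℂ (chartAd E G) (chartOne E G) with hA
  have h2 : ∀ v : E, HasFDerivAt (fun u => (chartAd E G u v : E)) (A.flip v) (chartOne E G) :=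
    fun v => by
      have := h1.clm_apply (hasFDerivAt_const v _)
      simpa using this
  let b : E →L[ℂ] E →L[ℂ] ℂ := LinearMap.toContinuousBilinearMap B
  have h3 := ((b.hasFDerivAt.comp _ (h2 (x : E))).clm_apply (h2 (z : E)))
  have h4 : HasFDerivAt (fun u => b (chartAd E G u x) (chartAd E G u z)) (0 : E →L[ℂ] ℂ)
      (chartOne E G) := by
    refine (hasFDerivAt_const (b x z) _).congr_of_eventuallyEq (Eventually.of_forall fun u => ?_)
    exact hBinv _ x z
  have h5 := DFunLike.congr_fun (h3.unique h4) (y : E)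
  have h6 : ∀ v : E, chartAd E G (chartOne E G) v = v := fun v => by
    rw [chartAd_chartOne]; rfl
  have h7 : B x ⁅y, z⁆ + B ⁅y, x⁆ z = 0 :=
    (congrArg₂ (· + ·) (congrArg₂ (fun p q : E => b p q) (h6 x) (fderiv_chartAd y z))
      (congrArg₂ (fun p q : E => b p q) (fderiv_chartAd y x) (h6 z))).symm.trans h5
  rw [← lie_skew, map_neg, LinearMap.neg_apply]
  linear_combination -h7

end

end RelGW

namespace RelGW

open Filter Topology

/-! ### One-parameter subgroups of real and complex Lie groups. -/

section RealOneParameter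

variable {E : Type*} [NormedAddCommGroup E] [NormedSpace ℝ E]
  {G : Type*} [TopologicalSpace G] [ChartedSpace E G] [Group G] [LieGroup 𝓘(ℝ, E) ω G]

theorem isMIntegralCurveOn_mul_left (v : GroupLieAlgebra 𝓘(ℝ, E) G) {γ : ℝ → G} {s : Set ℝ}
    (h : IsMIntegralCurveOn (I := 𝓘(ℝ, E)) γ (mulInvariantVectorField v) s) (g : G) :
    IsMIntegralCurveOn (I := 𝓘(ℝ, E)) (fun t => g * γ t) (mulInvariantVectorField v) s := by
  intro t ht
  have h1 := (h t ht)
  have h2 : HasMFDerivAt 𝓘(ℝ, E) 𝓘(ℝ, E) (fun x : G => g * x) (γ t) _ :=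
    (mdifferentiableAt_mul_left' (𝕜 := ℝ) g (γ t)).hasMFDerivAt
  have h3 := HasMFDerivAt.comp_hasMFDerivWithinAt t h2 h1
  refine h3.congr_mfderiv ?_
  have h4 : HasMFDerivAt 𝓘(ℝ, E) 𝓘(ℝ, E) (fun x : G => γ t * x) 1 _ :=
    (mdifferentiableAt_mul_left' (𝕜 := ℝ) (γ t) 1).hasMFDerivAt
  have h5 : HasMFDerivAt 𝓘(ℝ, E) 𝓘(ℝ, E) (fun x : G => g * x) (γ t * 1) _ :=
    (mdifferentiableAt_mul_left' (𝕜 := ℝ) g (γ t * 1)).hasMFDerivAt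
  have h6 := (HasMFDerivAt.comp (1 : G) h5 h4).mfderiv
  have h7 : ((fun x : G => g * x) ∘ fun x => γ t * x) = fun x => g * γ t * x := by
    funext x; simp [mul_assoc]
  rw [h7] at h6
  have h8 : mulInvariantVectorField v (g * γ t) =
      mfderiv 𝓘(ℝ, E) 𝓘(ℝ, E) (fun x : G => g * x) (γ t) (mulInvariantVectorField v (γ t)) := by
    simp only [mulInvariantVectorField]
    have h9 := DFunLike.congr_fun (F := E →L[ℝ] E) h6 v
    refine h9.trans ?_
    rw [mul_one]
    rfl
  let A : E →L[ℝ] E := mfderiv 𝓘(ℝ, E) 𝓘(ℝ, E) (fun x : G => g * x) (γ t)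
  let w : E := mulInvariantVectorField v (γ t)
  have h10 : A.comp ((1 : ℝ →L[ℝ] ℝ).smulRight w) = (1 : ℝ →L[ℝ] ℝ).smulRight (A w) := by
    ext; simp
  exact h10.trans (congrArg (fun w : E => (1 : ℝ →L[ℝ] ℝ).smulRight w) h8.symm)

omit [LieGroup 𝓘(ℝ, E) ω G] in
theorem mulInvariantVectorField_one (v : GroupLieAlgebra 𝓘(ℝ, E) G) :
    mulInvariantVectorField v 1 = v := by
  simp only [mulInvariantVectorField]
  rw [show (fun x : G => 1 * x) = id by funext x; simp, mfderiv_id]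
  rfl

theorem contMDiff_mulInvariantVectorField_one [CompleteSpace E] (v : GroupLieAlgebra 𝓘(ℝ, E) G) :
    have : IsManifold 𝓘(ℝ, E) 1 G := IsManifold.of_le (n := ω) (by simp)
    ContMDiff 𝓘(ℝ, E) 𝓘(ℝ, E).tangent 1
      (fun g : G => (⟨g, mulInvariantVectorField v g⟩ : TangentBundle 𝓘(ℝ, E) G)) := by
  have : LieGroup 𝓘(ℝ, E) (minSmoothness ℝ 3) G := LieGroup.of_le (n := ω) (by simp)
  exact (contMDiff_mulInvariantVectorField v).of_le (by simp)

/-- Left translates of a single local integral curve give the same existence time at every point, so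
the integral curve through 1 exists for all time. Uniqueness of integral curves makes it a
homomorphism. -/
theorem exists_hom_hasMFDerivAt [CompleteSpace E] [T2Space G] (v : GroupLieAlgebra 𝓘(ℝ, E) G) :
    ∃ γ : ℝ → G, (∀ s s', γ (s + s') = γ s * γ s') ∧
      HasMFDerivAt 𝓘(ℝ, ℝ) 𝓘(ℝ, E) γ 0 (ContinuousLinearMap.toSpanSingleton ℝ (v : E)) := by
  have : IsManifold 𝓘(ℝ, E) 1 G := IsManifold.of_le (n := ω) (by simp)
  have hv := contMDiff_mulInvariantVectorField_one v
  obtain ⟨γ₀, h0, h1⟩ := exists_isMIntegralCurveAt_of_contMDiffAt_boundaryless 0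
    (hv.contMDiffAt (x := 1))
  obtain ⟨ε, hε, h2⟩ := isMIntegralCurveAt_iff'.1 h1
  rw [Real.ball_eq_Ioo, zero_sub, zero_add] at h2
  obtain ⟨γ, hγ0, hγ⟩ := exists_isMIntegralCurve_of_isMIntegralCurveOn hv hε
    (fun g => ⟨fun t => g * γ₀ t, by simp [h0], isMIntegralCurveOn_mul_left v h2 g⟩) 1
  refine ⟨γ, fun s s' => ?_, ?_⟩
  · have h3 : IsMIntegralCurve (γ ∘ (· + s)) (mulInvariantVectorField v) := hγ.comp_add s
    have h4 : IsMIntegralCurve (fun t => γ s * γ t) (mulInvariantVectorField v) :=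
      isMIntegralCurve_iff_isMIntegralCurveOn.2
        (isMIntegralCurveOn_mul_left v (hγ.isMIntegralCurveOn _) (γ s))
    have h5 := isMIntegralCurve_Ioo_eq_of_contMDiff_boundaryless (t₀ := 0) hv h3 h4 (by simp [hγ0])
    have := congrFun h5 s'
    simpa [add_comm] using this
  · refine (hγ 0).congr_mfderiv ?_
    rw [hγ0]
    have h6 : (1 : ℝ →L[ℝ] ℝ).smulRight (v : E) = ContinuousLinearMap.toSpanSingleton ℝ (v : E) := by
      ext; simp
    exact (congrArg (fun w : E => (1 : ℝ →L[ℝ] ℝ).smulRight w)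
      (mulInvariantVectorField_one v)).trans h6

end RealOneParameter

section RestrictScalars

variable {E : Type*} [NormedAddCommGroup E] [NormedSpace ℂ E]
  {G : Type*} [TopologicalSpace G] [ChartedSpace E G]
  {E' : Type*} [NormedAddCommGroup E'] [NormedSpace ℂ E'] {M : Type*} [TopologicalSpace M]
  [ChartedSpace E' M]

theorem hasMFDerivAt_restrictScalars {f : G → M} {x : G} {f' : E →L[ℂ] E'}
    (h : HasMFDerivAt 𝓘(ℂ, E) 𝓘(ℂ, E') f x f') :
    HasMFDerivAt 𝓘(ℝ, E) 𝓘(ℝ, E') f x (f'.restrictScalars ℝ) :=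
  ⟨h.1, HasFDerivWithinAt.restrictScalars ℝ h.2⟩

theorem lieGroup_real [Group G] [LieGroup 𝓘(ℂ, E) ω G] : LieGroup 𝓘(ℝ, E) ω G where
  __ := isManifold_of_contDiffOn 𝓘(ℝ, E) ω G fun e e' he he' =>
    ((StructureGroupoid.compatible (contDiffGroupoid ω 𝓘(ℂ, E)) he he').1).restrict_scalars ℝ
  contMDiff_mul := fun p => by
    have h := (contMDiff_mul 𝓘(ℂ, E) ω (G := G)) p
    exact ⟨h.1, ContDiffWithinAt.restrict_scalars ℝ h.2⟩
  contMDiff_inv := fun p => by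
    have h := (contMDiff_inv 𝓘(ℂ, E) ω (G := G)) p
    exact ⟨h.1, ContDiffWithinAt.restrict_scalars ℝ h.2⟩

end RestrictScalars

section OneParameter

variable {E : Type*} [NormedAddCommGroup E] [NormedSpace ℂ E]
  {G : Type*} [TopologicalSpace G] [ChartedSpace E G] [Group G]
  {V : Type*} [NormedAddCommGroup V] [NormedSpace ℂ V]
  {γ : ℝ → G} {ξ : LieAlg E G}

theorem IsOneParameter.map_zero (h : IsOneParameter γ ξ) : γ 0 = 1 := by
  have := h.map_add 0 0
  simpa using this

theorem IsOneParameter.hasMFDerivAt_of_eq (h : IsOneParameter γ ξ) {r : ℝ} (hr : r = 0) :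
    HasMFDerivAt 𝓘(ℝ, ℝ) 𝓘(ℝ, E) γ r (ContinuousLinearMap.toSpanSingleton ℝ (ξ : E)) := by
  subst hr; exact h.hasMFDerivAt

theorem IsOneParameter.hasDerivAt_comp (h : IsOneParameter γ ξ) {F : G → V} {F' : E →L[ℂ] V}
    (hF : HasMFDerivAt 𝓘(ℂ, E) 𝓘(ℂ, V) F 1 F') : HasDerivAt (fun r => F (γ r)) (F' (ξ : E)) 0 := by
  have h1 := hasMFDerivAt_restrictScalars hF
  rw [← h.map_zero] at h1
  have h2 := HasMFDerivAt.comp (0 : ℝ) h1 h.hasMFDerivAt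
  have h3 : HasFDerivAt (fun r => F (γ r)) ((F'.restrictScalars ℝ).comp
    (ContinuousLinearMap.toSpanSingleton ℝ (ξ : E))) (0 : ℝ) := h2.hasFDerivAt
  exact h3.hasDerivAt.congr_deriv (congrArg F' (one_smul ℝ (ξ : E)))

theorem IsOneParameter.comp_mul (h : IsOneParameter γ ξ) (a : ℝ) :
    IsOneParameter (fun r => γ (a * r)) ((a : ℂ) • ξ) := by
  refine ⟨fun s s' => by rw [mul_add, h.map_add], ?_⟩
  have h1 : HasMFDerivAt 𝓘(ℝ, ℝ) 𝓘(ℝ, ℝ) (fun r : ℝ => a * r) 0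
      (ContinuousLinearMap.toSpanSingleton ℝ a) := by
    have h0 : HasDerivAt (fun r : ℝ => a * r) a 0 := by
      simpa using (hasDerivAt_id (0 : ℝ)).const_mul a
    exact h0.hasFDerivAt.hasMFDerivAt
  have h2 := HasMFDerivAt.comp (0 : ℝ) (h.hasMFDerivAt_of_eq (mul_zero a)) h1
  refine h2.congr_mfderiv ?_
  have h3 : (ContinuousLinearMap.toSpanSingleton ℝ (ξ : E)).comp
      (ContinuousLinearMap.toSpanSingleton ℝ a) =
      ContinuousLinearMap.toSpanSingleton ℝ ((a : ℂ) • (ξ : E)) := by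
    ext; simp
  exact h3

end OneParameter

section

variable {E : Type*} [NormedAddCommGroup E] [NormedSpace ℂ E] [FiniteDimensional ℂ E]
  {G : Type*} [TopologicalSpace G] [ChartedSpace E G] [Group G] [LieGroup 𝓘(ℂ, E) ω G]
  {γ : ℝ → G} {ξ : LieAlg E G}

theorem exists_isOneParameter [T2Space G] (ξ : LieAlg E G) : ∃ γ : ℝ → G, IsOneParameter γ ξ := by
  have : LieGroup 𝓘(ℝ, E) ω G := lieGroup_real
  have : CompleteSpace E := FiniteDimensional.complete ℂ E
  obtain ⟨γ, h1, h2⟩ := exists_hom_hasMFDerivAt (E := E) (G := G) ξ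
  exact ⟨γ, h1, h2⟩

theorem integralSubgroup_mono {k k' : LieSubalgebra ℂ (LieAlg E G)} (h : k ≤ k') :
    (integralSubgroup k : Subgroup G) ≤ integralSubgroup k' :=
  Subgroup.closure_mono fun _ ⟨ξ, hξ, γ, hγ, h1⟩ => ⟨ξ, h hξ, γ, hγ, h1⟩

theorem IsOneParameter.mem_integralSubgroup (h : IsOneParameter γ ξ)
    {k : LieSubalgebra ℂ (LieAlg E G)} (hξ : ξ ∈ k) (a : ℝ) : γ a ∈ integralSubgroup k :=
  Subgroup.subset_closure ⟨(a : ℂ) • ξ, k.smul_mem _ hξ, _, h.comp_mul a, by simp⟩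

theorem IsOneParameter.hasDerivAt_Ad (h : IsOneParameter γ ξ) (a : ℝ) :
    HasDerivAt (fun r => (Ad (γ r) : LieAlg E G →L[ℂ] LieAlg E G)) ((Ad (γ a)).comp (adL ξ)) a := by
  have h1 : HasDerivAt (fun r => (Ad (γ r) : LieAlg E G →L[ℂ] LieAlg E G)) (adL ξ) 0 :=
    h.hasDerivAt_comp hasMFDerivAt_Ad_one
  have h2 : HasDerivAt (fun r => (Ad (γ (r - a)) : LieAlg E G →L[ℂ] LieAlg E G)) (adL ξ) a := by
    have := HasDerivAt.comp_sub_const (f := fun r => (Ad (γ r) : LieAlg E G →L[ℂ] LieAlg E G))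
      a a (by simpa using h1)
    exact this
  have h3 := ((ContinuousLinearMap.compL ℂ (LieAlg E G) (LieAlg E G) (LieAlg E G)
    (Ad (γ a))).restrictScalars ℝ).hasFDerivAt.comp_hasDerivAt a h2
  refine h3.congr_of_eventuallyEq (Eventually.of_forall fun r => ?_)
  have h4 : γ r = γ a * γ (r - a) := by rw [← h.map_add]; congr 1; ring
  ext v
  simp only [h4, Ad_mul_apply]
  rfl

theorem IsOneParameter.Ad_apply_eq (h : IsOneParameter γ ξ) {x : LieAlg E G} (hx : ⁅ξ, x⁆ = 0)
    (a : ℝ) : Ad (γ a) x = x := by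
  have h1 : ∀ r, HasDerivAt (fun r => Ad (γ r) x) 0 r := fun r => by
    have h3 := ((ContinuousLinearMap.apply ℂ (LieAlg E G) x).restrictScalars
      ℝ).hasFDerivAt.comp_hasDerivAt r (h.hasDerivAt_Ad r)
    refine h3.congr_deriv ?_
    change Ad (γ r) ⁅ξ, x⁆ = 0
    rw [hx, _root_.map_zero]
  have h2 : Ad (γ a) x = Ad (γ 0) x :=
    is_const_of_deriv_eq_zero (fun r => (h1 r).differentiableAt) (fun r => (h1 r).deriv) a 0
  have h5 : γ 0 = 1 := h.map_zero
  rw [h2, h5, Ad_one]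
  rfl

/-- The derivative of Ad_γ(r) exp(-r ad ξ) in r vanishes. -/
theorem IsOneParameter.Ad_eq_exp (h : IsOneParameter γ ξ) :
    (Ad (γ 1) : LieAlg E G →L[ℂ] LieAlg E G) = NormedSpace.exp (adL ξ) := by
  have h1 : ∀ r : ℝ, HasDerivAt (fun r : ℝ => (Ad (γ r) : LieAlg E G →L[ℂ] LieAlg E G) *
      NormedSpace.exp (r • (-adL ξ))) 0 r := fun r => by
    have h2 := (h.hasDerivAt_Ad r)
    have h3 := hasDerivAt_exp_smul_const' (𝕂 := ℝ) (-adL ξ) r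
    have := HasDerivAt.mul (𝕜 := ℝ) (𝔸 := LieAlg E G →L[ℂ] LieAlg E G) h2 h3
    refine this.congr_deriv ?_
    change (Ad (γ r) * adL ξ) * _ + Ad (γ r) * (-adL ξ * _) = (0 : LieAlg E G →L[ℂ] LieAlg E G)
    noncomm_ring
  have h2 := is_const_of_deriv_eq_zero (fun r => (h1 r).differentiableAt) (fun r => (h1 r).deriv) 1 0
  simp only [one_smul, zero_smul, NormedSpace.exp_zero, mul_one, h.map_zero, Ad_one] at h2
  have h3 : NormedSpace.exp (-adL ξ) * NormedSpace.exp (adL ξ) = 1 := by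
    let : NormedAlgebra ℚ (LieAlg E G →L[ℂ] LieAlg E G) := NormedAlgebra.restrictScalars ℚ ℂ _
    have h4 := NormedSpace.exp_add_of_commute (Commute.neg_left (Commute.refl (adL ξ)))
    rw [← h4, neg_add_cancel, NormedSpace.exp_zero]
  calc (Ad (γ 1) : LieAlg E G →L[ℂ] LieAlg E G)
      = Ad (γ 1) * (NormedSpace.exp (-adL ξ) * NormedSpace.exp (adL ξ)) := by rw [h3, mul_one]
    _ = NormedSpace.exp (adL ξ) := by
      rw [← mul_assoc, h2]
      exact one_mul _

theorem Ad_apply_eq_of_mem_integralSubgroup {k : LieSubalgebra ℂ (LieAlg E G)} {x : LieAlg E G}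
    (hx : ∀ ξ ∈ k, ⁅ξ, x⁆ = 0) {h : G} (hh : h ∈ integralSubgroup k) : Ad h x = x := by
  induction hh using Subgroup.closure_induction with
  | mem g hg =>
    obtain ⟨ξ, hξ, γ, hγ, rfl⟩ := hg
    exact hγ.Ad_apply_eq (hx ξ hξ) 1
  | one => rw [Ad_one]; rfl
  | mul a b _ _ ha hb => rw [Ad_mul_apply, hb, ha]
  | inv a _ ha => rw [← ha, Ad_inv_apply_Ad, ha]

/-- Later arguments need the exponential only through its action on 𝔤, so it suffices to realize
exp(ad ξ) by some element of the integral subgroup. -/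
theorem exists_Ad_eq_exp [T2Space G] {k : LieSubalgebra ℂ (LieAlg E G)} (hξ : ξ ∈ k) :
    ∃ g ∈ (integralSubgroup k : Subgroup G),
      (Ad g : LieAlg E G →L[ℂ] LieAlg E G) = NormedSpace.exp (adL ξ) := by
  obtain ⟨γ, hγ⟩ := exists_isOneParameter ξ
  exact ⟨γ 1, hγ.mem_integralSubgroup hξ 1, hγ.Ad_eq_exp⟩

end

end RelGW

namespace RelGW

open Filter Topology

/-! ### Identity theorem and inverse function theorem for complex manifolds. -/

section IdentityTheorem

variable {V : Type*} [NormedAddCommGroup V] [NormedSpace ℂ V]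
  {E : Type*} [NormedAddCommGroup E] [NormedSpace ℂ E] [CompleteSpace E]
  {M : Type*} [TopologicalSpace M] [ChartedSpace E M]

omit [CompleteSpace E] in
theorem analyticAt_extChartAt_comp {f : V → M} {x : V} (hf : ContMDiffAt 𝓘(ℂ, V) 𝓘(ℂ, E) ω f x) :
    AnalyticAt ℂ (extChartAt 𝓘(ℂ, E) (f x) ∘ f) x := by
  have h := (contMDiffAt_iff.1 hf).2
  simp only [mfld_simps, contDiffWithinAt_univ] at h
  have h2 : ContDiffAt ℂ ω (extChartAt 𝓘(ℂ, E) (f x) ∘ f) x := by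
    simpa only [chartAt_self_eq, OpenPartialHomeomorph.refl_symm, OpenPartialHomeomorph.refl_apply,
      Function.comp_def, extChartAt_coe, modelWithCornersSelf_coe, id] using h
  exact h2.analyticAt

/-- The identity theorem for holomorphic maps into a complex manifold. -/
theorem eqOn_of_preconnected_of_eventuallyEq [T2Space M] {U : Set V} (hU : IsOpen U)
    (hc : IsPreconnected U) {f g : V → M} (hf : ContMDiffOn 𝓘(ℂ, V) 𝓘(ℂ, E) ω f U)
    (hg : ContMDiffOn 𝓘(ℂ, V) 𝓘(ℂ, E) ω g U) {x₀ : V} (hx₀ : x₀ ∈ U) (hfg : f =ᶠ[𝓝 x₀] g) :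
    Set.EqOn f g U := by
  have hf' : ∀ x ∈ U, ContMDiffAt 𝓘(ℂ, V) 𝓘(ℂ, E) ω f x := fun x hx =>
    hf.contMDiffAt (hU.mem_nhds hx)
  have hg' : ∀ x ∈ U, ContMDiffAt 𝓘(ℂ, V) 𝓘(ℂ, E) ω g x := fun x hx =>
    hg.contMDiffAt (hU.mem_nhds hx)
  -- S is open, so it remains to see that it is closed in U. At a limit point of S the values agree
  -- because M is Hausdorff, and in a chart around the common value the identity theorem on a ball
  -- that meets S gives equality near the point.
  let S : Set V := {x | f =ᶠ[𝓝 x] g}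
  have hS : IsOpen S := isOpen_iff_mem_nhds.2 fun x hx => eventually_eventually_nhds.2 hx
  have hsub : U ⊆ S := by
    refine hc.subset_of_closure_inter_subset hS ⟨x₀, hx₀, hfg⟩ ?_
    rintro x ⟨hxS, hxU⟩
    have heq : f x = g x := by
      by_contra hne
      obtain ⟨a, b, ha, hb, hfa, hgb, hab⟩ := t2_separation hne
      have h1 := (hf' x hxU).continuousAt.preimage_mem_nhds (ha.mem_nhds hfa)
      have h2 := (hg' x hxU).continuousAt.preimage_mem_nhds (hb.mem_nhds hgb)
      obtain ⟨y, hy, hyS⟩ := mem_closure_iff_nhds.1 hxS _ (inter_mem h1 h2)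
      have h3 : f y = g y := hyS.self_of_nhds
      exact Set.disjoint_left.1 hab hy.1 (h3 ▸ hy.2)
    have af := analyticAt_extChartAt_comp (hf' x hxU)
    have ag := analyticAt_extChartAt_comp (hg' x hxU)
    rw [← heq] at ag
    set φ := extChartAt 𝓘(ℂ, E) (f x) with hφ
    have sf : ∀ᶠ y in 𝓝 x, f y ∈ φ.source :=
      (hf' x hxU).continuousAt.preimage_mem_nhds (extChartAt_source_mem_nhds (f x))
    have sg : ∀ᶠ y in 𝓝 x, g y ∈ φ.source :=
      (hg' x hxU).continuousAt.preimage_mem_nhds (heq ▸ extChartAt_source_mem_nhds (f x))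
    obtain ⟨ε, hε, hb⟩ := Metric.eventually_nhds_iff_ball.1
      ((af.eventually_analyticAt.and ag.eventually_analyticAt).and (sf.and sg))
    obtain ⟨y, hy, hyS⟩ := mem_closure_iff_nhds.1 hxS _ (Metric.ball_mem_nhds x hε)
    have key := AnalyticOnNhd.eqOn_of_preconnected_of_eventuallyEq
      (f := φ ∘ f) (g := φ ∘ g) (U := Metric.ball x ε)
      (fun z hz => (hb z hz).1.1) (fun z hz => (hb z hz).1.2)
      (convex_ball x ε).isPreconnected hy (hyS.mono fun z hz => congrArg φ hz)
    filter_upwards [Metric.ball_mem_nhds x hε] with z hz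
    exact φ.injOn (hb z hz).2.1 (hb z hz).2.2 (key hz)
  exact fun x hx => (hsub hx).self_of_nhds

end IdentityTheorem

section InverseFunction

variable {E : Type*} [NormedAddCommGroup E] [NormedSpace ℂ E] [CompleteSpace E]
  {H : Type*} [TopologicalSpace H] {I : ModelWithCorners ℂ E H} [I.Boundaryless]
  {M : Type*} [TopologicalSpace M] [ChartedSpace H M] [IsManifold I ω M]
  {N : Type*} [TopologicalSpace N] [ChartedSpace H N] [IsManifold I ω N]

variable (I) in
/-- A chart as a partial diffeomorphism onto an open subset of the model space. -/
noncomputable def chartPartialDiffeomorph (p : M) : PartialDiffeomorph I 𝓘(ℂ, E) M E ω where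
  toPartialEquiv := extChartAt I p
  open_source := isOpen_extChartAt_source p
  open_target := isOpen_extChartAt_target p
  contMDiffOn_toFun := by
    rw [extChartAt_source]; exact contMDiffOn_extChartAt
  contMDiffOn_invFun := contMDiffOn_extChartAt_symm p

/-- The inverse function theorem for holomorphic maps. -/
theorem isLocalDiffeomorphAt_of_bijective {f : M → N} {p : M} (hf : ContMDiffAt I I ω f p)
    {f' : E →L[ℂ] E} (hf' : HasMFDerivAt I I f p f') (hbij : Function.Bijective f') :
    IsLocalDiffeomorphAt I I ω f p := by
  let e' : E ≃L[ℂ] E := ContinuousLinearEquiv.ofBijective f'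
    (LinearMap.ker_eq_bot.2 hbij.1) (LinearMap.range_eq_top.2 hbij.2)
  set F : E → E := writtenInExtChartAt I I p f with hF
  set a : E := extChartAt I p p with ha
  have h1 : HasFDerivAt F (e' : E →L[ℂ] E) a := by
    have := hf'.2
    rw [ModelWithCorners.range_eq_univ] at this
    exact hasFDerivWithinAt_univ.1 this
  have h2 : ContDiffAt ℂ ω F a := by
    have := (contMDiffAt_iff.1 hf).2
    rw [ModelWithCorners.range_eq_univ, contDiffWithinAt_univ] at this
    exact this
  let h : OpenPartialHomeomorph E E := h2.toOpenPartialHomeomorph F h1 (by simp)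
  have hh : ∀ w, h w = F w := fun w => rfl
  have has : a ∈ h.source := h2.mem_toOpenPartialHomeomorph_source h1 (by simp)
  have h3 : ContDiffAt ℂ ω h.symm (h a) :=
    h.contDiffAt_symm (h.map_source has) (by rw [h.left_inv has]; exact h1)
      (by rw [h.left_inv has]; exact h2)
  have e1 : ∀ᶠ w in 𝓝 a, ContDiffAt ℂ ω F w := h2.eventually (by simp)
  have e2 : ∀ᶠ w in 𝓝 a, ContDiffAt ℂ ω h.symm (h w) :=
    (h.continuousAt has).eventually (h3.eventually (by simp))
  have e3 : ∀ᶠ w in 𝓝 a, f ((extChartAt I p).symm w) ∈ (extChartAt I (f p)).source := by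
    have c1 : ContinuousAt (fun w => f ((extChartAt I p).symm w)) a := by
      refine ContinuousAt.comp ?_ (continuousAt_extChartAt_symm p)
      rw [ha, extChartAt_to_inv]
      exact hf.continuousAt
    refine c1.preimage_mem_nhds ?_
    rw [ha, extChartAt_to_inv]
    exact extChartAt_source_mem_nhds (f p)
  -- Shrink the domain so that the map and its local inverse are analytic at every point, and so
  -- that f stays inside the chart at f p, where it is recovered from its coordinate expression.
  obtain ⟨W, hW, hWo, haW⟩ := eventually_nhds_iff.1 (e1.and (e2.and e3))
  let hr := h.restrOpen W hWo
  let Φ : PartialDiffeomorph 𝓘(ℂ, E) 𝓘(ℂ, E) E E ω :=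
    { toPartialEquiv := hr.toPartialEquiv
      open_source := hr.open_source
      open_target := hr.open_target
      contMDiffOn_toFun := by
        rw [contMDiffOn_iff_contDiffOn]
        intro w hw
        exact (hW w hw.2).1.contDiffWithinAt
      contMDiffOn_invFun := by
        rw [contMDiffOn_iff_contDiffOn]
        intro w hw
        have h5 := hr.map_target hw
        have h6 := (hW _ h5.2).2.1
        have h7 : h (hr.symm w) = w := hr.right_inv hw
        rw [h7] at h6
        exact h6.contDiffWithinAt }
  refine ⟨((chartPartialDiffeomorph I p).trans Φ).trans (chartPartialDiffeomorph I (f p)).symm,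
    ⟨⟨mem_extChartAt_source p, has, haW⟩, ?_⟩, ?_⟩
  · change F a ∈ (extChartAt I (f p)).target
    simp only [hF, ha, writtenInExtChartAt, Function.comp, extChartAt_to_inv]
    exact mem_extChartAt_target (f p)
  · rintro x ⟨⟨hx1, hx2⟩, -⟩
    change f x = (extChartAt I (f p)).symm (F (extChartAt I p x))
    have h8 := (hW _ hx2.2).2.2
    have h9 : (extChartAt I p).symm (extChartAt I p x) = x := (extChartAt I p).left_inv hx1
    change f ((extChartAt I p).symm (extChartAt I p x)) ∈ _ at h8
    rw [h9] at h8
    simp only [hF, writtenInExtChartAt, Function.comp, h9]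
    exact ((extChartAt I (f p)).left_inv h8).symm

end InverseFunction

end RelGW

namespace RelGW

open Filter Topology

/-! ### Equivariance of the r-matrices and the basis-free gauge transform. -/

section AdInvariance

variable {E : Type*} [NormedAddCommGroup E] [NormedSpace ℂ E] [FiniteDimensional ℂ E]
  {G : Type*} [TopologicalSpace G] [ChartedSpace E G] [Group G] [LieGroup 𝓘(ℂ, E) ω G]
  {B : LinearMap.BilinForm ℂ (LieAlg E G)}

theorem nonResonant_Ad {x : LieAlg E G} (hx : NonResonant x) (g : G) : NonResonant (Ad g x) := by
  intro n hn h
  obtain ⟨v, hv⟩ := h.exists_hasEigenvector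
  refine hx n hn (Module.End.hasEigenvalue_of_hasEigenvector (x := Ad g⁻¹ v)
    (Module.End.hasEigenvector_iff.2 ⟨Module.End.mem_eigenspace_iff.2 ?_, fun h0 => hv.2 ?_⟩))
  · have h1 : ⁅Ad g x, v⁆ = (2 * Real.pi * Complex.I * n : ℂ) • v := hv.apply_eq_smul
    have h2 := congrArg (Ad g⁻¹) h1
    rw [Ad_lie, Ad_inv_apply_Ad, map_smul] at h2
    exact h2
  · rw [← Ad_apply_Ad_inv g v, h0, map_zero]

theorem Ad₂_Ad₂ (g h : G) (a : LieAlg E G ⊗[ℂ] LieAlg E G) :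
    Ad₂ g (Ad₂ h a) = Ad₂ (g * h) a := by
  rw [Ad₂, Ad₂, Ad₂, Ad_mul, ← LinearMap.comp_apply, ← TensorProduct.map_comp]
  rfl

theorem Ad₂_one (a : LieAlg E G ⊗[ℂ] LieAlg E G) : Ad₂ (1 : G) a = a := by
  rw [Ad₂, Ad_one]
  change TensorProduct.map LinearMap.id LinearMap.id a = a
  simp

theorem Ad₂_inv_Ad₂ (g : G) (a : LieAlg E G ⊗[ℂ] LieAlg E G) : Ad₂ g⁻¹ (Ad₂ g a) = a := by
  rw [Ad₂_Ad₂, inv_mul_cancel, Ad₂_one]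

theorem Ad₂_casimir (hB : IsInvariantForm B)
    (hBinv : ∀ (g : G) (x y : LieAlg E G), B (Ad g x) (Ad g y) = B x y) (g : G) :
    Ad₂ g (casimir B) = casimir B :=
  map_map_casimir hB.nondegenerate hB.symm fun x y => hBinv g x y

theorem adL_Ad (g : G) (x : LieAlg E G) :
    (adL (Ad g x) : LieAlg E G →L[ℂ] LieAlg E G) = (Ad g).comp ((adL x).comp (Ad g⁻¹)) := by
  ext y
  change ⁅Ad g x, y⁆ = Ad g ⁅x, Ad g⁻¹ y⁆
  rw [Ad_lie, Ad_apply_Ad_inv]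

theorem phi_adL_Ad (g : G) (x : LieAlg E G) :
    (phi (adL (Ad g x)) : LieAlg E G →L[ℂ] LieAlg E G) =
      (Ad g).comp ((phi (adL x)).comp (Ad g⁻¹)) := by
  let u : (LieAlg E G →L[ℂ] LieAlg E G)ˣ :=
    ⟨Ad g, Ad g⁻¹, ContinuousLinearMap.ext fun v => Ad_apply_Ad_inv g v,
      ContinuousLinearMap.ext fun v => Ad_inv_apply_Ad g v⟩
  rw [adL_Ad]
  exact phi_conj u (adL x)

theorem rAM_apply (hB : IsInvariantForm B) (x : LieAlg E G) : rAM B (B x) =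
    TensorProduct.map LinearMap.id ((phi (adL x) : LieAlg E G →L[ℂ] LieAlg E G) :
      LieAlg E G →ₗ[ℂ] LieAlg E G) (casimir B) := by
  rw [rAM, vee_apply hB.nondegenerate]

/-- Conjugation by Ad_g carries φ(ad x) to φ(ad Ad_g x), and Ω is Ad-invariant. -/
theorem rAM_Ad (hB : IsInvariantForm B)
    (hBinv : ∀ (g : G) (x y : LieAlg E G), B (Ad g x) (Ad g y) = B x y) (g : G) (x : LieAlg E G) :
    rAM B (B (Ad g x)) = Ad₂ g (rAM B (B x)) := by
  rw [rAM_apply hB, rAM_apply hB, phi_adL_Ad]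
  nth_rewrite 1 [← Ad₂_casimir hB hBinv g]
  rw [Ad₂, ← LinearMap.comp_apply, ← LinearMap.comp_apply, ← TensorProduct.map_comp,
    ← TensorProduct.map_comp]
  congr 2
  ext y
  change Ad g (phi (adL x) (Ad g⁻¹ (Ad g y))) = _
  rw [Ad_inv_apply_Ad]
  rfl

end AdInvariance

theorem sum_dualVec_tmul_basis {L : Type*} [LieRing L] [LieAlgebra ℂ L] [FiniteDimensional ℂ L]
    {B : LinearMap.BilinForm ℂ L} (h : B.Nondegenerate) (hs : ∀ x y, B x y = B y x) :
    ∑ i, dualVec B i ⊗ₜ[ℂ] Module.finBasis ℂ L i = casimir B := by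
  have h1 : ∀ i, Module.finBasis ℂ L i =
      ∑ j, B (Module.finBasis ℂ L i) (Module.finBasis ℂ L j) • dualVec B j :=
    fun i => (sum_apply_basis_smul_dualVec h _).symm
  rw [casimir]
  calc ∑ i, dualVec B i ⊗ₜ[ℂ] Module.finBasis ℂ L i
      = ∑ i, ∑ j, B (Module.finBasis ℂ L i) (Module.finBasis ℂ L j) •
          (dualVec B i ⊗ₜ[ℂ] dualVec B j) := by
        refine Finset.sum_congr rfl fun i _ => ?_
        conv_lhs => rw [h1 i]
        simp [TensorProduct.tmul_sum]
    _ = ∑ j, Module.finBasis ℂ L j ⊗ₜ[ℂ] dualVec B j := by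
        rw [Finset.sum_comm]
        refine Finset.sum_congr rfl fun j _ => ?_
        conv_rhs => rw [h1 j]
        simp [TensorProduct.sum_tmul, TensorProduct.smul_tmul', hs (Module.finBasis ℂ L j)]

section GaugeTransform

variable {E : Type*} [NormedAddCommGroup E] [NormedSpace ℂ E] [FiniteDimensional ℂ E]
  {G : Type*} [TopologicalSpace G] [ChartedSpace E G] [Group G] [LieGroup 𝓘(ℂ, E) ω G]
  {B : LinearMap.BilinForm ℂ (LieAlg E G)}

/-- The structure constant sum equals -(θ ⊗ θ)(ad x ⊗ 1)Ω, and the other two sums are θ applied to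
one leg of Ω. This is the shape produced by `map_twistMap_eq_iff`. -/
theorem gaugeTransform_eq (hB : IsInvariantForm B) (ρ : LieAlg E G → G)
    (r : LieAlg E G ⊗[ℂ] LieAlg E G) (x : LieAlg E G) :
    gaugeTransform B ρ r x =
      TensorProduct.map (logDeriv ρ x : LieAlg E G →ₗ[ℂ] LieAlg E G) LinearMap.id (casimir B)
        - TensorProduct.map LinearMap.id (logDeriv ρ x : LieAlg E G →ₗ[ℂ] LieAlg E G) (casimir B)
        + TensorProduct.map (logDeriv ρ x : LieAlg E G →ₗ[ℂ] LieAlg E G)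
            (logDeriv ρ x : LieAlg E G →ₗ[ℂ] LieAlg E G)
            (TensorProduct.map (LieAlgebra.ad ℂ (LieAlg E G) x) LinearMap.id (casimir B))
        + Ad₂ (ρ x)⁻¹ r := by
  set θ : LieAlg E G →ₗ[ℂ] LieAlg E G := (logDeriv ρ x : LieAlg E G →ₗ[ℂ] LieAlg E G) with hθ
  have h1 := sum_structure_smul_tmul hB x θ θ
  have h2 := congrArg (TensorProduct.map θ LinearMap.id)
    (sum_dualVec_tmul_basis hB.nondegenerate hB.symm)
  have h3 := congrArg (TensorProduct.map LinearMap.id θ) (casimir.eq_def B)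
  simp only [map_sum, TensorProduct.map_tmul, LinearMap.id_apply] at h2 h3
  have h4 : gaugeTransform B ρ r x = (∑ i, θ (dualVec B i) ⊗ₜ[ℂ] Module.finBasis ℂ (LieAlg E G) i)
    - (∑ i, Module.finBasis ℂ (LieAlg E G) i ⊗ₜ[ℂ] θ (dualVec B i)) + Ad₂ (ρ x)⁻¹ r
    - ∑ i, ∑ j, B x ⁅Module.finBasis ℂ (LieAlg E G) i, Module.finBasis ℂ (LieAlg E G) j⁆ •
        (θ (dualVec B i) ⊗ₜ[ℂ] θ (dualVec B j)) := rfl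
  rw [h4, h1, h2, h3]
  abel

end GaugeTransform

/-! ### The bivectors in the left trivialization. -/

section Trivialization

variable {E : Type*} [NormedAddCommGroup E] [NormedSpace ℂ E] [FiniteDimensional ℂ E]
  {G : Type*} [TopologicalSpace G] [ChartedSpace E G] [Group G] [LieGroup 𝓘(ℂ, E) ω G]
  {B : LinearMap.BilinForm ℂ (LieAlg E G)} {t : LieSubalgebra ℂ (LieAlg E G)}

/-- The left trivialization `𝔤 × t → T_p(G × t)`. -/
noncomputable def trivTan (p : G × t) : LieAlg E G × t →ₗ[ℂ] Tan t p :=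
  LinearMap.prodMap (dLeft p.1).toLinearMap LinearMap.id

theorem trivTan_bijective (p : G × t) : Function.Bijective (trivTan p) :=
  Function.Bijective.prodMap (dLeft_bijective p.1) Function.bijective_id

theorem leftVec_eq (p : G × t) : leftVec p = trivTan p ∘ₗ LinearMap.inl ℂ (LieAlg E G) t := by
  refine LinearMap.ext fun x => ?_
  rfl

theorem torusVec_eq (p : G × t) : torusVec p = trivTan p ∘ₗ LinearMap.inr ℂ (LieAlg E G) t := by
  refine LinearMap.ext fun x => ?_
  change ((0 : E), x) = ((dLeft p.1 0 : E), x)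
  rw [map_zero]
  rfl

theorem rightVec_eq (p : G × t) : rightVec p =
    trivTan p ∘ₗ LinearMap.inl ℂ (LieAlg E G) t ∘ₗ (Ad p.1⁻¹).toLinearMap := by
  refine LinearMap.ext fun x => ?_
  change ((dRight p.1 x : E), (0 : t)) = ((dLeft p.1 (Ad p.1⁻¹ x) : E), (0 : t))
  rw [dRight_eq]

theorem piSlice_eq (p : G × t) : piSlice B p =
    TensorProduct.map (trivTan p) (trivTan p) (trivialBivector t B p.2) := by
  rw [piSlice, trivialBivector, map_add, leftVec_eq, torusVec_eq, map_sum, TensorProduct.map_comp]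
  congr 1
  refine Finset.sum_congr rfl fun j _ => ?_
  rw [wedge, wedge, map_sub]
  rfl

/-- Right translation by g is left translation after Ad_g⁻¹, which is why the r-matrix terms carry
`Ad₂ p.1⁻¹`. -/
theorem piModified_eq (a : LieAlg E G → LieAlg E G ⊗[ℂ] LieAlg E G)
    (r : LieAlg E G ⊗[ℂ] LieAlg E G) (p : G × t) : piModified B a r p =
    TensorProduct.map (trivTan p) (trivTan p) (trivialBivector t B p.2 +
      TensorProduct.map (LinearMap.inl ℂ (LieAlg E G) t) (LinearMap.inl ℂ (LieAlg E G) t)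
        (Ad₂ p.1⁻¹ (a (Ad p.1 (p.2 : LieAlg E G)) - r))) := by
  rw [piModified, piSlice_eq, rightVec_eq, map_add, map_sub, map_sub, map_sub, add_sub_assoc,
    TensorProduct.map_comp, TensorProduct.map_comp]
  rfl

end Trivialization

end RelGW

namespace RelGW

open Filter Topology

/-! ### The differentials of the moment map and of ν_ρ. -/

section TwistDerivative

variable {E : Type*} [NormedAddCommGroup E] [NormedSpace ℂ E] [FiniteDimensional ℂ E]
  {G : Type*} [TopologicalSpace G] [ChartedSpace E G] [Group G] [LieGroup 𝓘(ℂ, E) ω G]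
  {B : LinearMap.BilinForm ℂ (LieAlg E G)} {t : LieSubalgebra ℂ (LieAlg E G)}

variable (E) in
/-- The inverse of the left translation `T_1 G → T_g G`. -/
noncomputable def dLeftInv (g : G) : E →L[ℂ] E :=
  mfderiv 𝓘(ℂ, E) 𝓘(ℂ, E) (fun x : G => g⁻¹ * x) g

omit [FiniteDimensional ℂ E] in
theorem hasMFDerivAt_dLeftInv (g : G) :
    HasMFDerivAt 𝓘(ℂ, E) 𝓘(ℂ, E) (fun x : G => g⁻¹ * x) g (dLeftInv E g) :=
  (mdifferentiableAt_mul_left' g⁻¹ g).hasMFDerivAt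

theorem dLeftInv_dLeft (g : G) (ξ : LieAlg E G) : dLeftInv E g (dLeft g ξ) = (ξ : E) := by
  have h1 := hasMFDerivAt_mul_left (E := E) g
  have h2 := hasMFDerivAt_dLeftInv (E := E) g
  rw [show g = g * 1 by simp] at h2
  have h3 := HasMFDerivAt.comp 1 h2 (by simpa using h1)
  have e : (fun x : G => (g * 1)⁻¹ * x) ∘ (fun x : G => g * x) = id := by funext q; simp
  rw [e] at h3
  have h4 := hasMFDerivAt_unique (E := E) (E' := E) h3 (hasMFDerivAt_id (I := 𝓘(ℂ, E)) (1 : G))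
  rw [mul_one] at h4
  exact DFunLike.congr_fun (F := E →L[ℂ] E) h4 ξ

/-- The differential of `(g, s) ↦ g₀⁻¹ g` at `(g₀, s₀)`. -/
theorem hasMFDerivAt_fst_translate (p : G × t) :
    HasMFDerivAt (model t) 𝓘(ℂ, E) (fun q : G × t => p.1⁻¹ * q.1) p
      ((dLeftInv E p.1).comp (ContinuousLinearMap.fst ℂ E t)) :=
  HasMFDerivAt.comp p (hasMFDerivAt_dLeftInv (E := E) p.1) (hasMFDerivAt_fst (I := 𝓘(ℂ, E)) (I' := 𝓘(ℂ, t)) p)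

/-- The moment map `(g, s) ↦ Ad_g s`. -/
noncomputable def momentMap (q : G × t) : LieAlg E G := Ad q.1 (q.2 : LieAlg E G)

/-- Writing Ad_g s = Ad_g₀ (Ad_(g₀⁻¹g) s) reduces the computation to the derivative of `Ad` at 1 and
the product rule. -/
theorem hasMFDerivAt_momentMap (p : G × t) : ∃ D : E × t →L[ℂ] LieAlg E G,
    HasMFDerivAt (model t) 𝓘(ℂ, LieAlg E G) momentMap p D ∧
      ∀ v : LieAlg E G × t, D (trivTan p v) = Ad p.1 (⁅v.1, (p.2 : LieAlg E G)⁆ + (v.2 : LieAlg E G)) := by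
  have h1 : HasMFDerivAt (model t) 𝓘(ℂ, LieAlg E G →L[ℂ] LieAlg E G)
      (fun q : G × t => (Ad (p.1⁻¹ * q.1) : LieAlg E G →L[ℂ] LieAlg E G)) p
      (((adCLM E G : E →L[ℂ] (LieAlg E G →L[ℂ] LieAlg E G))).comp
        ((dLeftInv E p.1).comp (ContinuousLinearMap.fst ℂ E t))) := by
    have h0 := hasMFDerivAt_Ad_one (E := E) (G := G)
    rw [show (1 : G) = p.1⁻¹ * p.1 by simp] at h0
    exact HasMFDerivAt.comp p h0 (hasMFDerivAt_fst_translate p)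
  have h2 : HasMFDerivAt (model t) 𝓘(ℂ, LieAlg E G)
      (fun q : G × t => (q.2 : LieAlg E G)) p
      (t.toSubmodule.subtypeL.comp (ContinuousLinearMap.snd ℂ E t)) :=
    HasMFDerivAt.comp p (t.toSubmodule.subtypeL.hasMFDerivAt)
      (hasMFDerivAt_snd (I := 𝓘(ℂ, E)) (I' := 𝓘(ℂ, t)) p)
  have h3 := HasFDerivWithinAt.clm_apply h1.2 h2.2
  have w1 : writtenInExtChartAt (model t) 𝓘(ℂ, LieAlg E G →L[ℂ] LieAlg E G) p
      (fun q : G × t => (Ad (p.1⁻¹ * q.1) : LieAlg E G →L[ℂ] LieAlg E G))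
      (extChartAt (model t) p p) = ContinuousLinearMap.id ℂ _ := by
    simp only [writtenInExtChartAt, Function.comp, extChartAt_to_inv, inv_mul_cancel, Ad_one]
    rfl
  have w2 : writtenInExtChartAt (model t) 𝓘(ℂ, LieAlg E G) p
      (fun q : G × t => (q.2 : LieAlg E G)) (extChartAt (model t) p p) = p.2 := by
    simp only [writtenInExtChartAt, Function.comp, extChartAt_to_inv]
    rfl
  rw [w1, w2] at h3
  have h4 : HasMFDerivAt (model t) 𝓘(ℂ, LieAlg E G)
      (fun q : G × t => Ad (p.1⁻¹ * q.1) (q.2 : LieAlg E G)) p _ :=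
    ⟨h1.1.clm_apply h2.1, h3⟩
  have h5 := HasMFDerivAt.comp p ((Ad p.1 : LieAlg E G →L[ℂ] LieAlg E G).hasMFDerivAt) h4
  have e : (⇑(Ad p.1 : LieAlg E G →L[ℂ] LieAlg E G) ∘
      fun q : G × t => Ad (p.1⁻¹ * q.1) (q.2 : LieAlg E G)) = momentMap := by
    funext q
    simp only [Function.comp, momentMap, ← Ad_mul_apply, mul_inv_cancel_left]
  rw [e] at h5
  refine ⟨_, h5, fun v => ?_⟩
  have h6 : adCLM E G (dLeftInv E p.1 (dLeft p.1 v.1)) (p.2 : LieAlg E G) =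
      ⁅v.1, (p.2 : LieAlg E G)⁆ :=
    congrArg (fun w : LieAlg E G => adCLM E G w (p.2 : LieAlg E G)) (dLeftInv_dLeft p.1 v.1)
  change Ad p.1 ((v.2 : LieAlg E G) +
    adCLM E G (dLeftInv E p.1 (dLeft p.1 v.1)) (p.2 : LieAlg E G)) = _
  rw [h6, add_comm]

/-- The differential of `ν_ρ` in the left trivialization. -/
theorem hasMFDerivAt_nu {ρ : LieAlg E G → G} {p : G × t}
    (hρ : MDifferentiableAt 𝓘(ℂ, LieAlg E G) 𝓘(ℂ, E) ρ (momentMap p)) :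
    ∃ D : E × t →L[ℂ] E × t,
      HasMFDerivAt (model t) (model t) (nu ρ) p D ∧
      (D : E × t →ₗ[ℂ] E × t) ∘ₗ trivTan p = trivTan (nu ρ p) ∘ₗ
        twistMap t ((Ad p.1⁻¹).toLinearMap ∘ₗ (logDeriv ρ (momentMap p)).toLinearMap ∘ₗ
          (Ad p.1).toLinearMap) p.2 := by
  obtain ⟨D₀, hD₀, hD₀'⟩ := hasMFDerivAt_momentMap p
  set x := momentMap p with hx
  have h1 : HasMFDerivAt 𝓘(ℂ, LieAlg E G) 𝓘(ℂ, E) (fun y => (ρ x)⁻¹ * ρ y) x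
      (logDeriv ρ x : LieAlg E G →L[ℂ] E) :=
    (MDifferentiableAt.comp x (mdifferentiableAt_mul_left' (𝕜 := ℂ) (ρ x)⁻¹ (ρ x)) hρ).hasMFDerivAt
  have h2 : HasMFDerivAt (model t) 𝓘(ℂ, E) (fun q : G × t => (ρ x)⁻¹ * ρ (momentMap q)) p
      ((logDeriv ρ x : LieAlg E G →L[ℂ] E).comp D₀) :=
    HasMFDerivAt.comp (E := E × t) (E' := LieAlg E G) (E'' := E)
      (g := fun y => (ρ x)⁻¹ * ρ y) (f := momentMap) p h1 hD₀
  have h3 := hasMFDerivAt_conj_of_eq_one h2 (by simp [← hx]) p.1⁻¹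
  have h4 := hasMFDerivAt_mul_of_eq_one h3 (hasMFDerivAt_fst_translate p) (by simp [← hx]) (by simp)
  -- The first component of ν_ρ, translated to the identity, splits into a conjugate of ρ(x)⁻¹ρ(Ad_g
  -- s) and the factor g₀⁻¹g. Both equal 1 at p, so their derivatives add.
  have e : (fun q : G × t => p.1⁻¹ * ((ρ x)⁻¹ * ρ (momentMap q)) * p.1⁻¹⁻¹ * (p.1⁻¹ * q.1)) =
      fun q => (ρ x * p.1)⁻¹ * (ρ (momentMap q) * q.1) := by
    funext q; group
  rw [e] at h4
  have h5 := hasMFDerivAt_of_translate (f := fun q : G × t => ρ (momentMap q) * q.1)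
    (ρ x * p.1) rfl h4
  have h6 := h5.prodMk (hasMFDerivAt_snd (I := 𝓘(ℂ, E)) (I' := 𝓘(ℂ, t)) p)
  refine ⟨_, h6, LinearMap.ext fun v => ?_⟩
  let w : LieAlg E G := dLeftInv E p.1 (dLeft p.1 v.1)
  have hw : w = v.1 := dLeftInv_dLeft p.1 v.1
  have h7 : Ad p.1⁻¹ (logDeriv ρ x (D₀ (trivTan p v))) + w =
      v.1 + Ad p.1⁻¹ (logDeriv ρ x (Ad p.1 (⁅v.1, (p.2 : LieAlg E G)⁆ + (v.2 : LieAlg E G)))) := by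
    rw [hD₀', hw, add_comm]
  refine Eq.trans ?_ (congrArg (trivTan (nu ρ p)) (twistMap_apply t _ p.2 v).symm)
  exact congrArg (fun w : LieAlg E G => ((dLeft (ρ x * p.1) w : E), v.2)) h7

end TwistDerivative

end RelGW

namespace RelGW

open Filter Topology

/-! ### Negative roots, and tensors supported on the Levi subalgebra. -/

section NegRoot

variable {L : Type*} [LieRing L] [LieAlgebra ℂ L] [FiniteDimensional ℂ L]
  [LieAlgebra.HasCentralRadical ℂ L] {B : LinearMap.BilinForm ℂ L} (hB : IsInvariantForm B)
  (t : LieSubalgebra ℂ L) [t.IsCartanSubalgebra]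
include hB

/-- By invariance, B pairs the root space of α nontrivially only with that of -α. If -α were not a
root, the root space of α would lie in the radical of B. -/
theorem isRoot_neg {α : Module.Dual ℂ t} (hα : IsRoot t α) : IsRoot t (-α) := by
  refine ⟨neg_ne_zero.2 hα.1, fun hbot => hα.2 ?_⟩
  rw [eq_bot_iff]
  intro y hy
  refine hB.nondegenerate.1 y fun z => ?_
  induction z using rootSpace_induction t with
  | h0 z hz =>
    obtain ⟨s, hs⟩ : ∃ s, α s ≠ 0 := by
      by_contra! h
      exact hα.1 (LinearMap.ext h)
    have h1 : B ⁅(s : L), y⁆ z = 0 := by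
      rw [← lie_skew, map_neg, LinearMap.neg_apply, hB.lie,
        lie_eq_zero_of_mem_cartan hB t s.2 hz, map_zero, neg_zero]
    rw [lie_of_mem_rootSpace hB t hy, map_smul, LinearMap.smul_apply, smul_eq_mul] at h1
    exact (mul_eq_zero.1 h1).resolve_left hs
  | hr β hβ z hz =>
    have hne : α + β ≠ 0 := fun h => hβ.2 (by rw [eq_neg_of_add_eq_zero_right h]; exact hbot)
    obtain ⟨s, hs⟩ : ∃ s, (α + β) s ≠ 0 := by
      by_contra! h
      exact hne (LinearMap.ext h)
    have h1 : B ⁅(s : L), y⁆ z = -B y ⁅(s : L), z⁆ := by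
      rw [← lie_skew, map_neg, LinearMap.neg_apply, hB.lie]
    rw [lie_of_mem_rootSpace hB t hy, lie_of_mem_rootSpace hB t hz, map_smul, map_smul,
      LinearMap.smul_apply, smul_eq_mul, smul_eq_mul] at h1
    have h2 : (α + β) s * B y z = 0 := by
      rw [LinearMap.add_apply]; linear_combination h1
    exact (mul_eq_zero.1 h2).resolve_left hs
  | hadd x y hx hy => rw [map_add, hx, hy, add_zero]

end NegRoot

section Levi

variable {E : Type*} [NormedAddCommGroup E] [NormedSpace ℂ E] [FiniteDimensional ℂ E]
  {G : Type*} [TopologicalSpace G] [ChartedSpace E G] [Group G] [LieGroup 𝓘(ℂ, E) ω G]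
  {B : LinearMap.BilinForm ℂ (LieAlg E G)}
  {t : LieSubalgebra ℂ (LieAlg E G)} {l : t}

theorem mem_levi {x : LieAlg E G} : x ∈ levi l ↔ ⁅(l : LieAlg E G), x⁆ = 0 := Iff.rfl

theorem leviSS_le_levi : leviSS l ≤ levi l := by
  refine LieSubalgebra.lieSpan_le.2 ?_
  rintro _ ⟨x, hx, y, hy, rfl⟩
  exact (levi l).lie_mem hx hy

theorem cartan_le_levi [t.IsCartanSubalgebra] [LieAlgebra.HasCentralRadical ℂ (LieAlg E G)]
    (hB : IsInvariantForm B) : t ≤ levi l :=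
  fun _ hx => lie_eq_zero_of_mem_cartan hB t l.2 hx

/-- Tensors in `𝔥 ⊗ 𝔥 ⊆ 𝔤 ⊗ 𝔤`. -/
noncomputable def tensorSquare (k : LieSubalgebra ℂ (LieAlg E G)) : Submodule ℂ (LieAlg E G ⊗[ℂ] LieAlg E G) :=
  LinearMap.range (TensorProduct.map (k.incl : k →ₗ[ℂ] LieAlg E G) (k.incl : k →ₗ[ℂ] LieAlg E G))

theorem tmul_mem_tensorSquare {k : LieSubalgebra ℂ (LieAlg E G)} {x y : LieAlg E G}
    (hx : x ∈ k) (hy : y ∈ k) : x ⊗ₜ[ℂ] y ∈ tensorSquare k :=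
  ⟨(⟨x, hx⟩ : k) ⊗ₜ (⟨y, hy⟩ : k), rfl⟩

theorem tensorSquare_mono {k k' : LieSubalgebra ℂ (LieAlg E G)} (h : k ≤ k') :
    tensorSquare k ≤ tensorSquare k' := by
  rintro _ ⟨c, rfl⟩
  induction c using TensorProduct.induction_on with
  | zero => simp
  | tmul x y => exact tmul_mem_tensorSquare (h x.2) (h y.2)
  | add a b ha hb => rw [map_add]; exact add_mem ha hb

theorem map_eq_of_mem_tensorSquare {k : LieSubalgebra ℂ (LieAlg E G)}
    {f f' : LieAlg E G →ₗ[ℂ] LieAlg E G} (h : ∀ x ∈ k, f x = f' x)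
    {c : LieAlg E G ⊗[ℂ] LieAlg E G} (hc : c ∈ tensorSquare k) :
    TensorProduct.map f f c = TensorProduct.map f' f' c := by
  obtain ⟨c, rfl⟩ := hc
  rw [← LinearMap.comp_apply, ← LinearMap.comp_apply, ← TensorProduct.map_comp,
    ← TensorProduct.map_comp]
  have : f ∘ₗ (k.incl : k →ₗ[ℂ] LieAlg E G) = f' ∘ₗ (k.incl : k →ₗ[ℂ] LieAlg E G) :=
    LinearMap.ext fun x => h x x.2
  rw [this]

theorem rAMsub_mem_tensorSquare (x : LieAlg E G) : rAMsub B (leviSS l) x ∈ tensorSquare (levi l) :=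
  tensorSquare_mono leviSS_le_levi ⟨_, rfl⟩

theorem rStd_leviRoots_mem_tensorSquare [t.IsCartanSubalgebra]
    [LieAlgebra.HasCentralRadical ℂ (LieAlg E G)] (hB : IsInvariantForm B)
    {P : Finset (Module.Dual ℂ t)} (hP : IsPositiveSystem t P) {e : Module.Dual ℂ t → LieAlg E G}
    (he : IsRootVectors t B e) : rStd e (leviRoots P l) ∈ tensorSquare (levi l) := by
  refine Submodule.sum_mem _ fun α hα => ?_
  rw [leviRoots, Finset.mem_filter] at hα
  have hr := hP.isRoot α hα.1
  have h1 : e α ∈ levi l :=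
    lie_eq_zero_of_apply_eq_zero hB t (he.mem_rootSpace α hr) hα.2
  have h2 : e (-α) ∈ levi l :=
    lie_eq_zero_of_apply_eq_zero hB t (he.mem_rootSpace _ (isRoot_neg hB t hr)) (by simp [hα.2])
  exact Submodule.smul_mem _ _
    (sub_mem (tmul_mem_tensorSquare h1 h2) (tmul_mem_tensorSquare h2 h1))

end Levi

/-! ### Infinitesimal equivariance and the pointwise equivalence. -/

section Equivariance

variable {E : Type*} [NormedAddCommGroup E] [NormedSpace ℂ E] [FiniteDimensional ℂ E]
  {G : Type*} [TopologicalSpace G] [ChartedSpace E G] [Group G] [LieGroup 𝓘(ℂ, E) ω G]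
  {B : LinearMap.BilinForm ℂ (LieAlg E G)}
  {t : LieSubalgebra ℂ (LieAlg E G)} [t.IsCartanSubalgebra] {l : t} {ρ : LieAlg E G → G}

/-- The infinitesimal form of equivariance. -/
theorem logDeriv_lie [T2Space G] (k : LieSubalgebra ℂ (LieAlg E G))
    (hρ : IsEquivariant (integralSubgroup k) ρ) {x : LieAlg E G} (hx : NonResonant x)
    (hd : MDifferentiableAt 𝓘(ℂ, LieAlg E G) 𝓘(ℂ, E) ρ x) {ζ : LieAlg E G} (hζ : ζ ∈ k) :
    logDeriv ρ x ⁅ζ, x⁆ = Ad (ρ x)⁻¹ ζ - ζ := by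
  have : LieGroup 𝓘(ℝ, E) ω G := lieGroup_real
  obtain ⟨γ, hγ⟩ := exists_isOneParameter (E := E) (G := G) ζ
  have hγ0 : γ 0 = 1 := hγ.map_zero
  have h1 : HasMFDerivAt 𝓘(ℂ, LieAlg E G) 𝓘(ℂ, E) (fun y => (ρ x)⁻¹ * ρ y) x
      (logDeriv ρ x : LieAlg E G →L[ℂ] E) :=
    (MDifferentiableAt.comp x (mdifferentiableAt_mul_left' (𝕜 := ℂ) (ρ x)⁻¹ (ρ x)) hd).hasMFDerivAt
  have h1' := hasMFDerivAt_restrictScalars h1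
  have h2 : HasDerivAt (fun r => Ad (γ r) x) ⁅ζ, x⁆ 0 := by
    have h3 := ((ContinuousLinearMap.apply ℂ (LieAlg E G) x).restrictScalars
      ℝ).hasFDerivAt.comp_hasDerivAt 0 (hγ.hasDerivAt_Ad 0)
    refine h3.congr_deriv ?_
    change Ad (γ 0) ⁅ζ, x⁆ = ⁅ζ, x⁆
    rw [hγ0, Ad_one]
    rfl
  have h3 : HasMFDerivAt 𝓘(ℝ, ℝ) 𝓘(ℝ, E) (fun r => (ρ x)⁻¹ * ρ (Ad (γ r) x)) 0
      (((logDeriv ρ x : LieAlg E G →L[ℂ] E).restrictScalars ℝ).comp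
        (ContinuousLinearMap.toSpanSingleton ℝ ⁅ζ, x⁆)) := by
    have hx0 : Ad (γ 0) x = x := by rw [hγ0, Ad_one]; rfl
    have h1'' : HasMFDerivAt 𝓘(ℝ, LieAlg E G) 𝓘(ℝ, E) (fun y => (ρ x)⁻¹ * ρ y) (Ad (γ 0) x)
        ((logDeriv ρ x : LieAlg E G →L[ℂ] E).restrictScalars ℝ) := by rw [hx0]; exact h1'
    exact HasMFDerivAt.comp (E := ℝ) (E' := LieAlg E G) (E'' := E)
      (g := fun y => (ρ x)⁻¹ * ρ y) (f := fun r => Ad (γ r) x) 0 h1'' h2.hasFDerivAt.hasMFDerivAt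
  have h4 : HasMFDerivAt 𝓘(ℝ, ℝ) 𝓘(ℝ, E) (fun r => (ρ x)⁻¹ * γ r * (ρ x)⁻¹⁻¹) 0
      (((Ad (ρ x)⁻¹ : E →L[ℂ] E).restrictScalars ℝ).comp
        (ContinuousLinearMap.toSpanSingleton ℝ (ζ : E))) := by
    have h0 := hasMFDerivAt_restrictScalars (hasMFDerivAt_conj (E := E) (ρ x)⁻¹)
    rw [← hγ0] at h0
    exact HasMFDerivAt.comp (0 : ℝ) h0 hγ.hasMFDerivAt
  have h5 := hasMFDerivAt_mul_of_eq_one h4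
    (hasMFDerivAt_inv_of_eq_one hγ.hasMFDerivAt hγ0) (by simp [hγ0]) (by simp [hγ0])
  -- The curve ρ(x)⁻¹ρ(Ad_γ(r) x) is differentiated twice over: by the chain rule, and, after
  -- equivariance rewrites ρ(Ad_γ(r) x), as the product of ρ(x)⁻¹γ(r)ρ(x) and γ(r)⁻¹. Comparing the
  -- results gives the formula.
  have e : (fun r => (ρ x)⁻¹ * γ r * (ρ x)⁻¹⁻¹ * (γ r)⁻¹) =
      fun r => (ρ x)⁻¹ * ρ (Ad (γ r) x) := by
    funext r
    rw [hρ _ (hγ.mem_integralSubgroup hζ r) x hx]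
    group
  rw [e] at h5
  have h6 := DFunLike.congr_fun (F := ℝ →L[ℝ] E)
    (hasMFDerivAt_unique (E := ℝ) (E' := E) h3 h5) (1 : ℝ)
  have h7 : logDeriv ρ x ((1 : ℝ) • ⁅ζ, x⁆) = Ad (ρ x)⁻¹ ((1 : ℝ) • ζ) + -((1 : ℝ) • ζ) := h6
  rwa [one_smul, one_smul, ← sub_eq_add_neg] at h7

theorem map_map_of_comp_eq {V V' W W' : Type*} [AddCommGroup V] [AddCommGroup V'] [AddCommGroup W]
    [AddCommGroup W'] [Module ℂ V] [Module ℂ V'] [Module ℂ W] [Module ℂ W'] {D : V →ₗ[ℂ] V'}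
    {f : W →ₗ[ℂ] V} {f' : W' →ₗ[ℂ] V'} {T : W →ₗ[ℂ] W'} (h : D ∘ₗ f = f' ∘ₗ T) (Z : W ⊗[ℂ] W) :
    TensorProduct.map D D (TensorProduct.map f f Z) =
      TensorProduct.map f' f' (TensorProduct.map T T Z) := by
  rw [← LinearMap.comp_apply, ← LinearMap.comp_apply, ← TensorProduct.map_comp,
    ← TensorProduct.map_comp, h]

/-- Transports the equation from the body frame, where the operator is ad s, to the spatial frame,
where it is ad (Ad_g s). It is applied with A = Ad_g and A' = Ad_g⁻¹, and uses only that A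
intertwines the two operators and fixes Ω. -/
theorem map_gauge_conj {L : Type*} [AddCommGroup L] [Module ℂ L] {A A' θ a b : L →ₗ[ℂ] L}
    {Ω : L ⊗[ℂ] L} (c : L ⊗[ℂ] L) (hAA' : A ∘ₗ A' = LinearMap.id) (had : A ∘ₗ a = b ∘ₗ A)
    (hΩA : TensorProduct.map A A Ω = Ω) :
    TensorProduct.map A A (TensorProduct.map (A' ∘ₗ θ ∘ₗ A) LinearMap.id Ω
      - TensorProduct.map LinearMap.id (A' ∘ₗ θ ∘ₗ A) Ω
      + TensorProduct.map (A' ∘ₗ θ ∘ₗ A) (A' ∘ₗ θ ∘ₗ A) (TensorProduct.map a LinearMap.id Ω)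
      + TensorProduct.map (LinearMap.id - (A' ∘ₗ θ ∘ₗ A) ∘ₗ a)
          (LinearMap.id - (A' ∘ₗ θ ∘ₗ A) ∘ₗ a) (TensorProduct.map A' A' c)) =
    TensorProduct.map θ LinearMap.id Ω - TensorProduct.map LinearMap.id θ Ω
      + TensorProduct.map θ θ (TensorProduct.map b LinearMap.id Ω)
      + TensorProduct.map (LinearMap.id - θ ∘ₗ b) (LinearMap.id - θ ∘ₗ b) c := by
  have hmm : ∀ (f g f' g' : L →ₗ[ℂ] L) (z : L ⊗[ℂ] L),
      TensorProduct.map f g (TensorProduct.map f' g' z) = TensorProduct.map (f ∘ₗ f') (g ∘ₗ g') z := by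
    intro f g f' g' z
    rw [TensorProduct.map_comp]; rfl
  have hθ' : A ∘ₗ (A' ∘ₗ θ ∘ₗ A) = θ ∘ₗ A := by rw [← LinearMap.comp_assoc, hAA', LinearMap.id_comp]
  have e1 : TensorProduct.map A A (TensorProduct.map (A' ∘ₗ θ ∘ₗ A) LinearMap.id Ω) =
      TensorProduct.map θ LinearMap.id Ω := by
    conv_rhs => rw [← hΩA, hmm]
    rw [hmm, hθ', LinearMap.comp_id, LinearMap.id_comp]
  have e2 : TensorProduct.map A A (TensorProduct.map LinearMap.id (A' ∘ₗ θ ∘ₗ A) Ω) =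
      TensorProduct.map LinearMap.id θ Ω := by
    conv_rhs => rw [← hΩA, hmm]
    rw [hmm, hθ', LinearMap.comp_id, LinearMap.id_comp]
  have e3 : TensorProduct.map A A (TensorProduct.map (A' ∘ₗ θ ∘ₗ A) (A' ∘ₗ θ ∘ₗ A)
      (TensorProduct.map a LinearMap.id Ω)) =
      TensorProduct.map θ θ (TensorProduct.map b LinearMap.id Ω) := by
    conv_rhs => rw [← hΩA, hmm, hmm]
    rw [hmm, hθ', hmm, LinearMap.comp_assoc, had, LinearMap.comp_id]
    rfl
  have hKA : A ∘ₗ (LinearMap.id - (A' ∘ₗ θ ∘ₗ A) ∘ₗ a) ∘ₗ A' = LinearMap.id - θ ∘ₗ b := by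
    have h2 : A ∘ₗ (LinearMap.id - (A' ∘ₗ θ ∘ₗ A) ∘ₗ a) = (LinearMap.id - θ ∘ₗ b) ∘ₗ A := by
      rw [LinearMap.comp_sub, LinearMap.sub_comp, ← LinearMap.comp_assoc, hθ',
        LinearMap.comp_assoc, had]
      rfl
    rw [← LinearMap.comp_assoc, h2, LinearMap.comp_assoc, hAA', LinearMap.comp_id]
  have e4 : TensorProduct.map A A (TensorProduct.map (LinearMap.id - (A' ∘ₗ θ ∘ₗ A) ∘ₗ a)
      (LinearMap.id - (A' ∘ₗ θ ∘ₗ A) ∘ₗ a) (TensorProduct.map A' A' c)) =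
      TensorProduct.map (LinearMap.id - θ ∘ₗ b) (LinearMap.id - θ ∘ₗ b) c := by
    rw [hmm, hmm, LinearMap.comp_assoc, hKA]
  rw [map_add, map_add, map_sub, e1, e2, e3, e4]

theorem add_sub_eq_sub_iff {V : Type*} [AddCommGroup V] (X R S T Y : V) :
    X + (R - S) = Y - T ↔ Y - R = X + (T - S) := by
  have e : -(X + (R - S) - (Y - T)) = Y - R - (X + (T - S)) := by abel
  rw [← sub_eq_zero, ← neg_eq_zero, e, sub_eq_zero]

/-- `π_{𝔤₁}` is mapped to `π_𝔤` by `ν_ρ` at `(g, s)` if and only if `ρ` satisfies the gauge equation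
at `Ad_g s`. -/
theorem map_piG1_eq_iff [T2Space G] [LieAlgebra.HasCentralRadical ℂ (LieAlg E G)]
    (hB : IsInvariantForm B)
    (hBinv : ∀ (g : G) (x y : LieAlg E G), B (Ad g x) (Ad g y) = B x y)
    {P : Finset (Module.Dual ℂ t)} (hP : IsPositiveSystem t P) {e : Module.Dual ℂ t → LieAlg E G}
    (he : IsRootVectors t B e) (hρ : IsEquivariant (integralSubgroup (levi l)) ρ)
    {p : G × t} (hp : p ∈ slice t)
    (hd : MDifferentiableAt 𝓘(ℂ, LieAlg E G) 𝓘(ℂ, E) ρ (momentMap p)) :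
    TensorProduct.map (mfderiv (model t) (model t) (nu ρ) p : Tan t p →ₗ[ℂ] Tan t (nu ρ p))
        (mfderiv (model t) (model t) (nu ρ) p : Tan t p →ₗ[ℂ] Tan t (nu ρ p)) (piG1 B P e l p)
      = piG B P e (nu ρ p) ↔
    rAM B (B (momentMap p)) - Ad₂ (ρ (momentMap p))⁻¹ (rAMsub B (leviSS l) (momentMap p))
      = gaugeTransform B ρ (rStd e P - rStd e (leviRoots P l)) (momentMap p) := by
  obtain ⟨g, s⟩ := p
  have hs : ∀ α, IsRoot t α → α s ≠ 0 := fun α hα => by simpa using hp α hα 0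
  obtain ⟨D, hD, hDt⟩ := hasMFDerivAt_nu hd
  set x : LieAlg E G := momentMap (g, s) with hx
  have hxg : Ad g (s : LieAlg E G) = x := rfl
  have hxn : NonResonant x := nonResonant_Ad (nonResonant_of_mem_regularSet hB t hp) g
  set θ : LieAlg E G →ₗ[ℂ] LieAlg E G := (logDeriv ρ x).toLinearMap with hθ
  set A : LieAlg E G →ₗ[ℂ] LieAlg E G := (Ad g).toLinearMap with hA
  set A' : LieAlg E G →ₗ[ℂ] LieAlg E G := (Ad g⁻¹).toLinearMap with hA'
  set T := twistMap t (A' ∘ₗ θ ∘ₗ A) s with hT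
  rw [hD.mfderiv]
  let D' : Tan t (g, s) →ₗ[ℂ] Tan t (nu ρ (g, s)) := (D : E × t →ₗ[ℂ] E × t)
  have h1 := fun Z => map_map_of_comp_eq (D := D') hDt Z
  change TensorProduct.map D' D' _ = _ ↔ _
  have hinj : Function.Injective (TensorProduct.map (trivTan (nu ρ (g, s))) (trivTan (nu ρ (g, s)))) := by
    let F := LinearEquiv.ofBijective (trivTan (nu ρ (g, s))) (trivTan_bijective _)
    exact (TensorProduct.congr F F).injective
  rw [piG1, piG, piModified_eq, piModified_eq, h1, hinj.eq_iff]
  change TensorProduct.map T T (trivialBivector t B s + TensorProduct.map _ _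
    (Ad₂ g⁻¹ (rAMsub B (leviSS l) x - rStd e (leviRoots P l)))) =
    trivialBivector t B s + TensorProduct.map _ _
      (Ad₂ (ρ x * g)⁻¹ (rAM B (B (Ad (ρ x * g) s)) - rStd e P)) ↔ _
  rw [hT, map_twistMap_eq_iff hB t hs]
  set Ω := casimir B with hΩ
  set c := rAMsub B (leviSS l) x - rStd e (leviRoots P l) with hc
  have hAA' : A ∘ₗ A' = LinearMap.id := LinearMap.ext fun v => Ad_apply_Ad_inv g v
  have had : A ∘ₗ LieAlgebra.ad ℂ (LieAlg E G) (s : LieAlg E G) =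
      LieAlgebra.ad ℂ (LieAlg E G) x ∘ₗ A := LinearMap.ext fun v => by
    change Ad g ⁅(s : LieAlg E G), v⁆ = ⁅x, Ad g v⁆
    rw [Ad_lie, hxg]
  have hΩA : TensorProduct.map A A Ω = Ω := Ad₂_casimir hB hBinv g
  have hAinj : Function.Injective (TensorProduct.map A A) :=
    Function.LeftInverse.injective (g := Ad₂ g⁻¹) fun z => Ad₂_inv_Ad₂ g z
  -- This is where equivariance enters: on 𝔥 the operator 1 - θ ad_x is Ad_ρ⁻¹. About the r-matrices
  -- of 𝔤₁ only their membership in 𝔥 ⊗ 𝔥 is used.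
  have h2 : TensorProduct.map (LinearMap.id - θ ∘ₗ LieAlgebra.ad ℂ (LieAlg E G) x)
      (LinearMap.id - θ ∘ₗ LieAlgebra.ad ℂ (LieAlg E G) x) c = Ad₂ (ρ x)⁻¹ c := by
    refine map_eq_of_mem_tensorSquare (k := levi l) (fun ζ hζ => ?_)
      (sub_mem (rAMsub_mem_tensorSquare x) (rStd_leviRoots_mem_tensorSquare hB hP he))
    change ζ - logDeriv ρ x ⁅x, ζ⁆ = Ad (ρ x)⁻¹ ζ
    rw [← lie_skew, map_neg, logDeriv_lie (levi l) hρ hxn hd hζ]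
    abel
  -- At the target point ν_ρ(g, s) the moment map takes the value Ad_ρ x. Equivariance of r_AM
  -- cancels this ρ, while the constant r_𝔤 keeps it.
  have e5 : TensorProduct.map A A (Ad₂ (ρ x * g)⁻¹ (rAM B (B (Ad (ρ x * g) s)) - rStd e P)) =
      rAM B (B x) - Ad₂ (ρ x)⁻¹ (rStd e P) := by
    change Ad₂ g _ = _
    rw [Ad₂_Ad₂, mul_inv_rev, mul_inv_cancel_left, Ad_mul_apply, hxg, rAM_Ad hB hBinv, map_sub,
      Ad₂_inv_Ad₂]
  have e6 := map_gauge_conj (θ := θ) c hAA' had hΩA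
  rw [h2] at e6
  rw [← hAinj.eq_iff, e5]
  refine (Eq.congr_left e6).trans ?_
  rw [gaugeTransform_eq hB, hc, map_sub, map_sub]
  exact add_sub_eq_sub_iff _ _ _ _ _

end Equivariance

end RelGW

namespace RelGW

open Filter Topology

/-! ### From ρ to ν_ρ: holomorphy, equivariance and the symplectic property. -/

section Holomorphy

variable {E : Type*} [NormedAddCommGroup E] [NormedSpace ℂ E] [FiniteDimensional ℂ E]
  {G : Type*} [TopologicalSpace G] [ChartedSpace E G] [Group G] [LieGroup 𝓘(ℂ, E) ω G]
  {B : LinearMap.BilinForm ℂ (LieAlg E G)}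
  {t : LieSubalgebra ℂ (LieAlg E G)} {l : t} {ρ : LieAlg E G → G}

theorem isOpen_nonResonant : IsOpen {x : LieAlg E G | NonResonant x} :=
  isOpen_nonResonantOp.preimage (adCLM E G).continuous

theorem contMDiff_momentMap :
    ContMDiff (model t) 𝓘(ℂ, LieAlg E G) ω (momentMap : G × t → LieAlg E G) := by
  have h1 : ContMDiff (model t) 𝓘(ℂ, LieAlg E G →L[ℂ] LieAlg E G) ω
      (fun q : G × t => (Ad q.1 : LieAlg E G →L[ℂ] LieAlg E G)) :=
    (contMDiff_Ad E G).comp contMDiff_fst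
  have h2 : ContMDiff (model t) 𝓘(ℂ, LieAlg E G) ω (fun q : G × t => (q.2 : LieAlg E G)) :=
    t.toSubmodule.subtypeL.contMDiff.comp contMDiff_snd
  exact h1.clm_apply h2

theorem nonResonant_momentMap [t.IsCartanSubalgebra]
    [LieAlgebra.HasCentralRadical ℂ (LieAlg E G)] (hB : IsInvariantForm B) {p : G × t}
    (hp : p ∈ slice t) : NonResonant (momentMap p : LieAlg E G) :=
  nonResonant_Ad (nonResonant_of_mem_regularSet hB t hp) p.1

theorem contMDiffAt_nu {p : G × t}
    (hρ : ContMDiffAt 𝓘(ℂ, LieAlg E G) 𝓘(ℂ, E) ω ρ (momentMap p)) :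
    ContMDiffAt (model t) (model t) ω (nu ρ) p := by
  have h1 : ContMDiffAt (model t) 𝓘(ℂ, E) ω (fun q : G × t => ρ (momentMap q)) p :=
    hρ.comp p contMDiff_momentMap.contMDiffAt
  exact (h1.mul contMDiffAt_fst).prodMk contMDiffAt_snd

/-- Contracting a covector with the push-forward of X equals D applied to a contraction of X.
Nondegeneracy makes every vector such a contraction. -/
theorem surjective_of_bivectorNondegenerate {V W : Type*} [AddCommGroup V] [Module ℂ V]
    [AddCommGroup W] [Module ℂ W] {D : V →ₗ[ℂ] W} {X : V ⊗[ℂ] V}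
    (h : BivectorNondegenerate (TensorProduct.map D D X)) : Function.Surjective D := by
  intro w
  obtain ⟨c, hc⟩ := h.2 w
  refine ⟨TensorProduct.lid ℂ V (TensorProduct.map (c ∘ₗ D) LinearMap.id X), ?_⟩
  rw [← hc]
  clear hc h
  induction X using TensorProduct.induction_on with
  | zero => simp
  | tmul x y => simp
  | add a b ha hb => simp only [map_add, ha, hb]

variable [t.IsCartanSubalgebra]

theorem isSliceEquivariant_nu [LieAlgebra.HasCentralRadical ℂ (LieAlg E G)]
    (hB : IsInvariantForm B) {H : Subgroup G} (hρ : IsEquivariant H ρ) :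
    IsSliceEquivariant H (nu (t := t) ρ) := by
  intro h hh p hp
  have h1 := hρ h hh _ (nonResonant_momentMap hB hp)
  refine Prod.ext ?_ rfl
  change ρ (Ad (h * p.1) (p.2 : LieAlg E G)) * (h * p.1) = h * (ρ (momentMap p) * p.1)
  rw [Ad_mul_apply]
  refine (congrArg (· * (h * p.1)) h1).trans ?_
  group

theorem isLocallySymplectic_nu [T2Space G] [LieAlgebra.HasCentralRadical ℂ (LieAlg E G)]
    (hB : IsInvariantForm B)
    (hBinv : ∀ (g : G) (x y : LieAlg E G), B (Ad g x) (Ad g y) = B x y)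
    {P : Finset (Module.Dual ℂ t)} (hP : IsPositiveSystem t P) {e : Module.Dual ℂ t → LieAlg E G}
    (he : IsRootVectors t B e)
    (hρ : ContMDiffOn 𝓘(ℂ, LieAlg E G) 𝓘(ℂ, E) ω ρ {x | NonResonant x})
    (heq : IsEquivariant (integralSubgroup (levi l)) ρ) (hg : GaugeEquation B P e l ρ) :
    IsLocallySymplectic B P e l (nu (t := t) ρ) := by
  have hρ' : ∀ x, NonResonant x → ContMDiffAt 𝓘(ℂ, LieAlg E G) 𝓘(ℂ, E) ω ρ x := fun x hx =>
    hρ.contMDiffAt (isOpen_nonResonant.mem_nhds hx)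
  have hmap : ∀ p ∈ slice t, NonResonant (proj B (leviSS l) (Ad p.1 (p.2 : LieAlg E G))) →
    TensorProduct.map (mfderiv (model t) (model t) (nu ρ) p : Tan t p →ₗ[ℂ] Tan t (nu ρ p))
        (mfderiv (model t) (model t) (nu ρ) p : Tan t p →ₗ[ℂ] Tan t (nu ρ p)) (piG1 B P e l p)
      = piG B P e (nu ρ p) := by
    intro p hp hpr
    have hn := nonResonant_momentMap hB hp
    exact (map_piG1_eq_iff hB hBinv hP he heq hp
      ((hρ' _ hn).mdifferentiableAt (by simp))).2 (hg _ hn hpr)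
  refine ⟨fun p hp => hp, fun p hp => (contMDiffAt_nu (hρ' _ (nonResonant_momentMap hB hp))).contMDiffWithinAt,
    hmap, fun p hp hpr hnd => ?_⟩
  have hc := contMDiffAt_nu (hρ' _ (nonResonant_momentMap hB hp))
  rw [← hmap p hp hpr] at hnd
  have hs := surjective_of_bivectorNondegenerate hnd
  have hD := (hc.mdifferentiableAt (by simp)).hasMFDerivAt
  have : IsManifold (model t) ω (G × t) := inferInstance
  refine isLocalDiffeomorphAt_of_bijective hc hD ⟨?_, hs⟩
  exact (LinearMap.injective_iff_surjective (V := E × t) (K := ℂ)).2 hs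

omit [t.IsCartanSubalgebra] in
-- The group H fixes l because its Lie algebra centralizes l, so it preserves the centralizer of l.
theorem Ad_mem_levi [LieAlgebra.HasCentralRadical ℂ (LieAlg E G)] {g : G}
    (hg : g ∈ integralSubgroup (levi l)) {y : LieAlg E G} (hy : y ∈ levi l) : Ad g y ∈ levi l := by
  have h1 : Ad g (l : LieAlg E G) = l := Ad_apply_eq_of_mem_integralSubgroup (k := levi l)
    (fun ξ hξ => by rw [← lie_skew, mem_levi.1 hξ, neg_zero]) hg
  rw [mem_levi, ← h1, ← Ad_lie, mem_levi.1 hy, map_zero]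

theorem nu_eq_self [LieAlgebra.HasCentralRadical ℂ (LieAlg E G)] (hB : IsInvariantForm B)
    (hρ : ∀ x ∈ levi l, NonResonant x → ρ x = 1) {p : G × t} (hp : p ∈ slice t)
    (hp1 : p.1 ∈ integralSubgroup (leviSS l)) : nu ρ p = p := by
  have h1 := hρ (momentMap p) (Ad_mem_levi (integralSubgroup_mono leviSS_le_levi hp1)
    (cartan_le_levi hB p.2.2)) (nonResonant_momentMap hB hp)
  refine Prod.ext ?_ rfl
  change ρ (momentMap p) * p.1 = p.1
  rw [h1, one_mul]

end Holomorphy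

end RelGW

namespace RelGW

open Filter Topology

/-! ### The non-resonant domains and the conjugates of the regular set. -/

section Projection

variable {L : Type*} [LieRing L] [LieAlgebra ℂ L] [FiniteDimensional ℂ L]

/-- `proj` as a linear map. -/
noncomputable def projLinear (B : LinearMap.BilinForm ℂ L) (k : LieSubalgebra ℂ L) : L →ₗ[ℂ] k where
  toFun := proj B k
  map_add' x y := by
    simp only [proj, vee, restrictFunctional, map_add, LinearMap.add_comp,
      TensorProduct.map_add_left, LinearMap.add_apply]
  map_smul' c x := by
    simp only [proj, vee, restrictFunctional, map_smul, LinearMap.smul_comp,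
      TensorProduct.map_smul_left, LinearMap.smul_apply, RingHom.id_apply]

omit [FiniteDimensional ℂ L] in
theorem nonResonant_zero : NonResonant (0 : L) := by
  intro n hn h
  obtain ⟨v, hv⟩ := h.exists_hasEigenvector
  have h1 := hv.apply_eq_smul
  rw [map_zero, LinearMap.zero_apply, eq_comm, smul_eq_zero] at h1
  refine h1.elim (fun h1 => ?_) hv.2
  simp [hn, Real.pi_ne_zero] at h1

theorem mem_regularSet_of_nonResonant [LieAlgebra.HasCentralRadical ℂ L]
    {B : LinearMap.BilinForm ℂ L} (hB : IsInvariantForm B) {t : LieSubalgebra ℂ L}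
    [t.IsCartanSubalgebra] {s : t} (hs : ∀ α, IsRoot t α → α s ≠ 0) (h : NonResonant (s : L)) :
    s ∈ regularSet t := by
  intro α hα n hn
  rcases eq_or_ne n 0 with rfl | h0
  · exact hs α hα (by simpa using hn)
  · obtain ⟨y, hy, hy0⟩ := Submodule.exists_mem_ne_zero_of_ne_bot
      (mt (LieSubmodule.toSubmodule_eq_bot _).1 hα.2)
    refine h n h0 (Module.End.hasEigenvalue_of_hasEigenvector (x := y)
      ⟨Module.End.mem_eigenspace_iff.2 ?_, hy0⟩)
    rw [LieAlgebra.ad_apply, lie_of_mem_rootSpace hB t (α := α) hy, hn]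

end Projection

section Domain

variable {E : Type*} [NormedAddCommGroup E] [NormedSpace ℂ E] [FiniteDimensional ℂ E]
  {G : Type*} [TopologicalSpace G] [ChartedSpace E G] [Group G] [LieGroup 𝓘(ℂ, E) ω G]

/-- `x ↦ ad (proj x)`. -/
noncomputable def adProj (B : LinearMap.BilinForm ℂ (LieAlg E G))
    (k : LieSubalgebra ℂ (LieAlg E G)) : LieAlg E G →L[ℂ] k →L[ℂ] k :=
  LinearMap.toContinuousLinearMap
    ((LinearMap.toContinuousLinearMap : (k →ₗ[ℂ] k) ≃ₗ[ℂ] k →L[ℂ] k).toLinearMap ∘ₗ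
      (LieAlgebra.ad ℂ k : k →ₗ[ℂ] k →ₗ[ℂ] k) ∘ₗ projLinear B k)

variable {B : LinearMap.BilinForm ℂ (LieAlg E G)} {k : LieSubalgebra ℂ (LieAlg E G)}

variable (B k) in
/-- The common domain of the two dynamical r-matrices. -/
def gaugeDomain : Set (LieAlg E G) := {x | NonResonant x ∧ NonResonant (proj B k x)}

theorem isOpen_gaugeDomain : IsOpen (gaugeDomain B k) :=
  isOpen_nonResonant.inter (isOpen_nonResonantOp.preimage (adProj B k).continuous)

theorem countable_resonant (x y : LieAlg E G) (hx : NonResonant x) :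
    {z : ℂ | ¬ NonResonant (x + z • y)}.Countable := by
  refine (countable_resonant_line (a := LieAlgebra.ad ℂ _ x) (b := LieAlgebra.ad ℂ _ y) hx).mono ?_
  intro z hz h
  refine hz ?_
  rw [← map_smul, ← map_add] at h
  exact h

theorem countable_resonant_proj (x y : LieAlg E G) (hx : NonResonant (proj B k x)) :
    {z : ℂ | ¬ NonResonant (proj B k (x + z • y))}.Countable := by
  refine (countable_resonant_line (V := k) (a := LieAlgebra.ad ℂ _ (proj B k x))
    (b := LieAlgebra.ad ℂ _ (proj B k y)) hx).mono ?_
  intro z hz h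
  refine hz ?_
  have h1 : proj B k (x + z • y) = proj B k x + z • proj B k y :=
    ((projLinear B k).map_add _ _).trans (congrArg _ ((projLinear B k).map_smul _ _))
  rw [← map_smul, ← map_add, ← h1] at h
  exact h

/-- Non-resonance of x and of its projection each fail only countably often on a complex line
through a point of the domain. -/
theorem isPreconnected_gaugeDomain : IsPreconnected (gaugeDomain B k) := by
  refine isPreconnected_of_countable_line fun x hx y => ?_
  refine ((countable_resonant x y hx.1).union (countable_resonant_proj x y hx.2)).mono ?_
  intro z hz
  by_contra h
  rw [Set.mem_union, not_or] at h
  exact hz ⟨not_not.1 h.1, not_not.1 h.2⟩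

theorem isPreconnected_nonResonant_inter :
    IsPreconnected {y : k | NonResonant (y : LieAlg E G)} :=
  isPreconnected_of_countable_line fun x hx y => countable_resonant (x : LieAlg E G) y hx

theorem isPreconnected_nonResonant : IsPreconnected {x : LieAlg E G | NonResonant x} :=
  isPreconnected_of_countable_line fun x hx y => countable_resonant x y hx

variable [LieAlgebra.HasCentralRadical ℂ (LieAlg E G)] (hB : IsInvariantForm B)
  {t : LieSubalgebra ℂ (LieAlg E G)} [t.IsCartanSubalgebra]
include hB

/-- Scale an element of t on which no root vanishes towards 0, which lies in the open domain.
Non-resonance then excludes the remaining affine root hyperplanes. -/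
theorem exists_mem_regularSet_gaugeDomain (k : LieSubalgebra ℂ (LieAlg E G)) :
    ∃ s ∈ regularSet t, (s : LieAlg E G) ∈ gaugeDomain B k := by
  obtain ⟨s, hs⟩ := exists_regular t
  have h0 : (0 : LieAlg E G) ∈ gaugeDomain B k := by
    refine ⟨nonResonant_zero, ?_⟩
    rw [show proj B k 0 = 0 from (projLinear B k).map_zero]
    exact nonResonant_zero
  have hc : Tendsto (fun z : ℂ => z • (s : LieAlg E G)) (𝓝[≠] 0) (𝓝 0) := by
    have : Continuous fun z : ℂ => z • (s : LieAlg E G) := by fun_prop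
    simpa using (this.tendsto 0).mono_left nhdsWithin_le_nhds
  obtain ⟨z, hz, hz0⟩ := ((hc.eventually (isOpen_gaugeDomain.mem_nhds h0)).and
    self_mem_nhdsWithin).exists
  refine ⟨z • s, mem_regularSet_of_nonResonant hB (fun α hα => ?_) hz.1, hz⟩
  rw [map_smul]
  exact mul_ne_zero hz0 (hs α hα)

theorem exists_lie_add_of_mem_levi {l s : t} (hs : ∀ α, IsRoot t α → α s ≠ 0) {w : LieAlg E G}
    (hw : w ∈ levi l) : ∃ u ∈ leviSS l, ∃ y ∈ t, w = ⁅u, (s : LieAlg E G)⁆ + y := by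
  have hls : ⁅(l : LieAlg E G), (s : LieAlg E G)⁆ = 0 := lie_eq_zero_of_mem_cartan hB t l.2 s.2
  have key : ∀ w ∈ levi l, ∃ v ∈ levi l, ∃ y ∈ t, w = y + ⁅(s : LieAlg E G), v⁆ := by
    intro w hw
    obtain ⟨y, hy, z, rfl⟩ := exists_add_lie_of_regular hB t hs w
    refine ⟨z, ?_, y, hy, rfl⟩
    rw [mem_levi, lie_add, lie_eq_zero_of_mem_cartan hB t l.2 hy, zero_add, leibniz_lie, hls,
      zero_lie, zero_add] at hw
    exact mem_levi.2 (lie_eq_zero_of_lie_lie_eq_zero hB t l.2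
      (lie_eq_zero_of_mem_cartan hB t l.2 (mem_cartan_of_lie_eq_zero hB t hs hw)))
  -- The decomposition is applied twice so that the bracket becomes [s, [s, v']] with v' ∈ 𝔥. Then u
  -- = -[s, v'] lies in [𝔥, 𝔥] and not merely in 𝔥.
  obtain ⟨v, hv, y, hy, rfl⟩ := key w hw
  obtain ⟨v', hv', y', hy', rfl⟩ := key v hv
  refine ⟨-⁅(s : LieAlg E G), v'⁆, neg_mem (LieSubalgebra.subset_lieSpan
    ⟨s, mem_levi.2 hls, v', hv', rfl⟩), y, hy, ?_⟩
  rw [neg_lie, lie_skew, lie_add, lie_eq_zero_of_mem_cartan hB t s.2 hy', zero_add, add_comm]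

/-- The elements of `𝔥` near a regular element of `t` are conjugate under `G₁` to elements
of `t`. -/
theorem eventually_exists_Ad_eq [T2Space G] (l : t) {s : t} (hs : s ∈ regularSet t) :
    ∀ᶠ y : levi l in 𝓝 ⟨s, cartan_le_levi hB s.2⟩,
      ∃ g ∈ integralSubgroup (leviSS l), ∃ s' ∈ regularSet t,
        (y : LieAlg E G) = Ad g (s' : LieAlg E G) := by
  have hs0 : ∀ α, IsRoot t α → α s ≠ 0 := fun α hα => by simpa using hs α hα 0
  -- The map (u, y) ↦ exp(ad u)(s + y) takes values in 𝔥. Composing with a linear retraction q of 𝔤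
  -- onto 𝔥 makes 𝔥 the target, so that surjectivity of the derivative can be tested there.
  obtain ⟨q, hq⟩ := LinearMap.exists_leftInverse_of_injective (levi l).toSubmodule.subtype
    (Submodule.ker_subtype _)
  have hq' : ∀ y (hy : y ∈ levi l), q y = ⟨y, hy⟩ := fun y hy => LinearMap.congr_fun hq ⟨y, hy⟩
  let Q : LieAlg E G →L[ℂ] levi l := LinearMap.toContinuousLinearMap q
  let a : leviSS l × t →L[ℂ] LieAlg E G →L[ℂ] LieAlg E G :=
    adCLM E G ∘L (leviSS l).toSubmodule.subtypeL ∘L ContinuousLinearMap.fst ℂ (leviSS l) t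
  let b : leviSS l × t →L[ℂ] LieAlg E G :=
    t.toSubmodule.subtypeL ∘L ContinuousLinearMap.snd ℂ (leviSS l) t
  have h1 : HasStrictFDerivAt (fun p => NormedSpace.exp (a p)) a 0 := by
    have h := hasStrictFDerivAt_exp_zero (𝕂 := ℂ) (𝔸 := LieAlg E G →L[ℂ] LieAlg E G)
    rw [← map_zero a] at h
    exact h.comp (0 : leviSS l × t) a.hasStrictFDerivAt
  have h2 : HasStrictFDerivAt (fun p => (s : LieAlg E G) + b p) b 0 :=
    b.hasStrictFDerivAt.const_add _
  have h3 := Q.hasStrictFDerivAt.comp (0 : leviSS l × t) (h1.clm_apply h2)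
  -- The derivative at 0 is (u, y) ↦ [u, s] + y, which is onto 𝔥 by `exists_lie_add_of_mem_levi`. So
  -- the image of each neighbourhood of 0 is a neighbourhood of s in 𝔥.
  have h4 := h3.map_nhds_eq_of_surj (LinearMap.range_eq_top.2 fun w => ?_)
  · have h5 : (fun p => Q (NormedSpace.exp (a p) ((s : LieAlg E G) + b p))) 0
        = ⟨s, cartan_le_levi hB s.2⟩ := by
      simp only [map_zero, add_zero, NormedSpace.exp_zero]
      exact hq' _ _
    change map (fun p => Q (NormedSpace.exp (a p) ((s : LieAlg E G) + b p))) _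
      = 𝓝 ((fun p => Q (NormedSpace.exp (a p) ((s : LieAlg E G) + b p))) 0) at h4
    rw [h5] at h4
    rw [← h4, eventually_map]
    have hc : Tendsto (fun p : leviSS l × t => s + p.2) (𝓝 0) (𝓝 s) := by
      have : Continuous fun p : leviSS l × t => s + p.2 := by fun_prop
      simpa using this.tendsto 0
    filter_upwards [hc.eventually ((isOpen_regularSet t).mem_nhds hs)] with p hp
    obtain ⟨g, hg, hg'⟩ := exists_Ad_eq_exp p.1.2
    refine ⟨g, hg, s + p.2, hp, ?_⟩
    have h6 : NormedSpace.exp (a p) ((s : LieAlg E G) + b p) = Ad g ((s + p.2 : t) : LieAlg E G) := by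
      rw [hg']; rfl
    change ((q (NormedSpace.exp (a p) ((s : LieAlg E G) + b p)) : levi l) : LieAlg E G) = _
    rw [h6, hq' _ (Ad_mem_levi (integralSubgroup_mono leviSS_le_levi hg)
      (cartan_le_levi hB (s + p.2).2))]
  · obtain ⟨u, hu, y, hy, hw⟩ := exists_lie_add_of_mem_levi hB hs0 w.2
    refine ⟨(⟨u, hu⟩, ⟨y, hy⟩), ?_⟩
    have h7 : (NormedSpace.exp (a 0)) (y : LieAlg E G) + ⁅u, (s : LieAlg E G) + b 0⁆
        = (w : LieAlg E G) := by
      rw [map_zero, map_zero, NormedSpace.exp_zero, add_zero, hw, add_comm]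
      rfl
    change q ((NormedSpace.exp (a 0)) (y : LieAlg E G) + ⁅u, (s : LieAlg E G) + b 0⁆) = w
    rw [h7, hq' _ w.2]
    rfl

/-- The case l = 0, where the Levi subalgebra is all of 𝔤. -/
theorem eventually_exists_Ad_eq_top [T2Space G] {s : t} (hs : s ∈ regularSet t) :
    ∀ᶠ x : LieAlg E G in 𝓝 (s : LieAlg E G), ∃ g : G, ∃ s' ∈ regularSet t,
      x = Ad g (s' : LieAlg E G) := by
  have h0 : ∀ x : LieAlg E G, x ∈ levi (0 : t) := fun x => by
    rw [mem_levi, ZeroMemClass.coe_zero, zero_lie]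
  have hc : Continuous fun x : LieAlg E G => (⟨x, h0 x⟩ : levi (0 : t)) :=
    continuous_id.subtype_mk h0
  filter_upwards [(hc.tendsto (s : LieAlg E G)).eventually (eventually_exists_Ad_eq hB 0 hs)]
    with x hx
  obtain ⟨g, -, s', hs', h⟩ := hx
  exact ⟨g, s', hs', h⟩

end Domain

end RelGW

namespace RelGW

open Filter Topology

/-! ### Analyticity of both sides of the gauge equation. -/

section TensorValued

variable {X : Type*} [NormedAddCommGroup X] [NormedSpace ℂ X]
  {V : Type*} [NormedAddCommGroup V] [NormedSpace ℂ V]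
  {V' : Type*} [NormedAddCommGroup V'] [NormedSpace ℂ V']
  {W : Type*} [NormedAddCommGroup W] [NormedSpace ℂ W] [FiniteDimensional ℂ W]
  {W' : Type*} [NormedAddCommGroup W'] [NormedSpace ℂ W'] [FiniteDimensional ℂ W']

/-- Tensors are tested against linear functionals, so that only scalar functions need to be
analytic. On pure tensors the claim is the smoothness of a bilinear form. -/
theorem contDiffAt_dual_map {f : X → V →L[ℂ] W} {g : X → V' →L[ℂ] W'} {x : X}
    (hf : ContDiffAt ℂ ω f x) (hg : ContDiffAt ℂ ω g x) (β : Module.Dual ℂ (W ⊗[ℂ] W'))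
    (c : V ⊗[ℂ] V') :
    ContDiffAt ℂ ω (fun y => β (TensorProduct.map (f y : V →ₗ[ℂ] W) (g y : V' →ₗ[ℂ] W') c)) x := by
  induction c using TensorProduct.induction_on with
  | zero => simpa using contDiffAt_const
  | tmul v v' =>
    let b : W →L[ℂ] W' →L[ℂ] ℂ :=
      LinearMap.toContinuousBilinearMap ((TensorProduct.mk ℂ W W').compr₂ β)
    have h1 : ContDiffAt ℂ ω (fun y => f y v) x := hf.clm_apply contDiffAt_const
    have h2 : ContDiffAt ℂ ω (fun y => g y v') x := hg.clm_apply contDiffAt_const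
    exact (b.contDiff.contDiffAt.comp x h1).clm_apply h2
  | add a b ha hb =>
    simp only [map_add]
    exact ha.add hb

end TensorValued

section Regularity

variable {E : Type*} [NormedAddCommGroup E] [NormedSpace ℂ E] [FiniteDimensional ℂ E]
  {G : Type*} [TopologicalSpace G] [ChartedSpace E G] [Group G] [LieGroup 𝓘(ℂ, E) ω G]
  {B : LinearMap.BilinForm ℂ (LieAlg E G)} {ρ : LieAlg E G → G} {x : LieAlg E G}
  {k : LieSubalgebra ℂ (LieAlg E G)}

theorem contDiffAt_logDeriv (hρ : ContMDiffAt 𝓘(ℂ, LieAlg E G) 𝓘(ℂ, E) ω ρ x) :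
    ContDiffAt ℂ ω (fun y => (logDeriv ρ y : LieAlg E G →L[ℂ] LieAlg E G)) x := by
  have h1 : ContMDiffAt (𝓘(ℂ, LieAlg E G).prod 𝓘(ℂ, LieAlg E G)) 𝓘(ℂ, E) ω
      (Function.uncurry fun y z : LieAlg E G => (ρ y)⁻¹ * ρ z) (x, x) := by
    have e1 : ContMDiffAt (𝓘(ℂ, LieAlg E G).prod 𝓘(ℂ, LieAlg E G)) 𝓘(ℂ, E) ω
        (fun p : LieAlg E G × LieAlg E G => ρ p.1) (x, x) := hρ.comp (x, x) contMDiffAt_fst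
    have e2 : ContMDiffAt (𝓘(ℂ, LieAlg E G).prod 𝓘(ℂ, LieAlg E G)) 𝓘(ℂ, E) ω
        (fun p : LieAlg E G × LieAlg E G => ρ p.2) (x, x) := hρ.comp (x, x) contMDiffAt_snd
    exact e1.inv.mul e2
  have h2 := ContMDiffAt.mfderiv (m := ω) (fun y z : LieAlg E G => (ρ y)⁻¹ * ρ z) id h1
    contMDiffAt_id (by simp)
  have e : (fun y : LieAlg E G => (ρ y)⁻¹ * ρ (id y)) = fun _ => 1 := by
    funext y; exact inv_mul_cancel _
  rw [e] at h2
  have e2 : inTangentCoordinates 𝓘(ℂ, LieAlg E G) 𝓘(ℂ, E) (id : LieAlg E G → LieAlg E G)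
      (fun _ => (1 : G)) (fun y => mfderiv 𝓘(ℂ, LieAlg E G) 𝓘(ℂ, E)
        (fun z => (ρ y)⁻¹ * ρ z) (id y)) x = fun y => (logDeriv ρ y : LieAlg E G →L[ℂ] E) := by
    funext y
    exact inTangentCoordinates_of_vectorSpace (E₁ := LieAlg E G) (E₂ := E) id (1 : G)
      (fun y => (logDeriv ρ y : LieAlg E G →L[ℂ] E)) x y
  rw [e2] at h2
  exact contMDiffAt_iff_contDiffAt.1 h2

theorem contDiffAt_Ad_inv (hρ : ContMDiffAt 𝓘(ℂ, LieAlg E G) 𝓘(ℂ, E) ω ρ x) :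
    ContDiffAt ℂ ω (fun y => (Ad (ρ y)⁻¹ : LieAlg E G →L[ℂ] LieAlg E G)) x :=
  contMDiffAt_iff_contDiffAt.1 ((contMDiff_Ad E G).contMDiffAt.comp x hρ.inv)

theorem contDiffAt_phi_adL (hx : NonResonant x) :
    ContDiffAt ℂ ω (fun y => (phi (adL y) : LieAlg E G →L[ℂ] LieAlg E G)) x := by
  have h := analyticAt_phi ((isUnit_entireD_iff (adCLM E G x)).2 hx)
  exact h.contDiffAt.comp x (adCLM E G).contDiff.contDiffAt

theorem contDiffAt_phi_adProj (hx : NonResonant (proj B k x)) :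
    ContDiffAt ℂ ω (fun y => (phi (adL (proj B k y)) : k →L[ℂ] k)) x := by
  have h := analyticAt_phi ((isUnit_entireD_iff (adProj B k x)).2 hx)
  have h2 : ContDiffAt ℂ ω (fun y => adProj B k y) x := by
    have h3 := ContinuousLinearMap.contDiff (𝕜 := ℂ) (n := ω) (F := k →L[ℂ] k) (adProj B k)
    exact h3.contDiffAt
  exact h.contDiffAt.comp x h2

theorem contDiffAt_dual_rAM (hB : IsInvariantForm B) (hx : NonResonant x)
    (β : Module.Dual ℂ (LieAlg E G ⊗[ℂ] LieAlg E G)) :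
    ContDiffAt ℂ ω (fun y => β (rAM B (B y))) x := by
  simp only [rAM_apply hB]
  exact contDiffAt_dual_map (f := fun _ => ContinuousLinearMap.id ℂ (LieAlg E G))
    contDiffAt_const (contDiffAt_phi_adL hx) β _

theorem contDiffAt_dual_rAMsub (hρ : ContMDiffAt 𝓘(ℂ, LieAlg E G) 𝓘(ℂ, E) ω ρ x)
    (hx : NonResonant (proj B k x)) (β : Module.Dual ℂ (LieAlg E G ⊗[ℂ] LieAlg E G)) :
    ContDiffAt ℂ ω (fun y => β (Ad₂ (ρ y)⁻¹ (rAMsub B k y))) x := by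
  have h1 : ContDiffAt ℂ ω
      (fun y => (Ad (ρ y)⁻¹ : LieAlg E G →L[ℂ] LieAlg E G) ∘L k.toSubmodule.subtypeL) x :=
    (contDiffAt_Ad_inv hρ).clm_comp contDiffAt_const
  have h2 := contDiffAt_dual_map h1 (h1.clm_comp (contDiffAt_phi_adProj hx)) β
    (casimir (restrictForm B k))
  refine h2.congr_of_eventuallyEq (Eventually.of_forall fun y => congrArg β ?_)
  rw [Ad₂, rAMsub, rAM, ← LinearMap.comp_apply, ← TensorProduct.map_comp, ← LinearMap.comp_apply,
    ← TensorProduct.map_comp]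
  rfl

theorem contDiffAt_dual_gaugeTransform (hB : IsInvariantForm B)
    (hρ : ContMDiffAt 𝓘(ℂ, LieAlg E G) 𝓘(ℂ, E) ω ρ x) (r : LieAlg E G ⊗[ℂ] LieAlg E G)
    (β : Module.Dual ℂ (LieAlg E G ⊗[ℂ] LieAlg E G)) :
    ContDiffAt ℂ ω (fun y => β (gaugeTransform B ρ r y)) x := by
  have hθ := contDiffAt_logDeriv hρ
  have hi : ContDiffAt ℂ ω (fun _ : LieAlg E G => ContinuousLinearMap.id ℂ (LieAlg E G)) x :=
    contDiffAt_const
  have had : ContDiffAt ℂ ω (fun y => adCLM E G y) x := (adCLM E G).contDiff.contDiffAt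
  have h := (((contDiffAt_dual_map hθ hi β (casimir B)).sub
    (contDiffAt_dual_map hi hθ β (casimir B))).add
    (contDiffAt_dual_map (hθ.clm_comp had) hθ β (casimir B))).add
    (contDiffAt_dual_map (contDiffAt_Ad_inv hρ) (contDiffAt_Ad_inv hρ) β r)
  refine h.congr_of_eventuallyEq (Eventually.of_forall fun y => ?_)
  simp only [gaugeTransform_eq hB, map_add, map_sub]
  rw [← LinearMap.comp_apply (TensorProduct.map _ _) (TensorProduct.map _ _),
    ← TensorProduct.map_comp]
  rfl

end Regularity

/-! ### From ν_ρ back to ρ by the identity theorem. -/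

section Converse

variable {E : Type*} [NormedAddCommGroup E] [NormedSpace ℂ E] [FiniteDimensional ℂ E]
  {G : Type*} [TopologicalSpace G] [T2Space G] [ChartedSpace E G] [Group G]
  [LieGroup 𝓘(ℂ, E) ω G] [LieAlgebra.HasCentralRadical ℂ (LieAlg E G)]
  {B : LinearMap.BilinForm ℂ (LieAlg E G)} {t : LieSubalgebra ℂ (LieAlg E G)}
  [t.IsCartanSubalgebra] {l : t} {ρ : LieAlg E G → G}

/-- Equivariance of ν_ρ is equivariance of ρ at the points of Ad_G t', which fill a neighbourhood of
a regular s. Both sides are holomorphic on the connected non-resonant set. -/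
theorem isEquivariant_of_nu (hB : IsInvariantForm B)
    (hρ : ContMDiffOn 𝓘(ℂ, LieAlg E G) 𝓘(ℂ, E) ω ρ {x | NonResonant x}) {H : Subgroup G}
    (hν : IsSliceEquivariant H (nu (t := t) ρ)) : IsEquivariant H ρ := by
  intro h hh
  obtain ⟨s, hs, hs'⟩ := exists_mem_regularSet_gaugeDomain (t := t) hB ⊤
  have h1 : ContMDiffOn 𝓘(ℂ, LieAlg E G) 𝓘(ℂ, E) ω (fun x => ρ (Ad h x)) {x | NonResonant x} :=
    hρ.comp ((Ad h : LieAlg E G →L[ℂ] LieAlg E G).contMDiff.contMDiffOn)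
      fun x hx => nonResonant_Ad hx h
  have h2 : ContMDiffOn 𝓘(ℂ, LieAlg E G) 𝓘(ℂ, E) ω (fun x => h * ρ x * h⁻¹)
      {x | NonResonant x} := (contMDiffOn_const.mul hρ).mul contMDiffOn_const
  refine eqOn_of_preconnected_of_eventuallyEq isOpen_nonResonant isPreconnected_nonResonant h1 h2
    hs'.1 ?_
  filter_upwards [eventually_exists_Ad_eq_top hB hs] with x hx
  obtain ⟨g, s', hs', rfl⟩ := hx
  have h3 := congrArg Prod.fst (hν h hh (g, s') hs')
  change ρ (Ad (h * g) (s' : LieAlg E G)) * (h * g) = h * (ρ (Ad g (s' : LieAlg E G)) * g) at h3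
  rw [Ad_mul_apply] at h3
  refine (eq_mul_inv_of_mul_eq h3).trans ?_
  group

/-- The identity theorem is applied inside 𝔥: near a regular s every element of 𝔥 is Ad_g s' with g
∈ G₁ and s' ∈ t', and there ν_ρ(g, s') = (g, s') says that ρ is 1. -/
theorem eq_one_of_nu (hB : IsInvariantForm B)
    (hρ : ContMDiffOn 𝓘(ℂ, LieAlg E G) 𝓘(ℂ, E) ω ρ {x | NonResonant x})
    (hν : ∀ p ∈ slice t, p.1 ∈ integralSubgroup (leviSS l) → nu ρ p = p) :
    ∀ x ∈ levi l, NonResonant x → ρ x = 1 := by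
  intro x hx hxn
  obtain ⟨s, hs, hs'⟩ := exists_mem_regularSet_gaugeDomain (t := t) hB ⊤
  have hi : ContMDiff 𝓘(ℂ, levi l) 𝓘(ℂ, LieAlg E G) ω fun y : levi l => (y : LieAlg E G) :=
    (levi l).toSubmodule.subtypeL.contMDiff
  have h1 : ContMDiffOn 𝓘(ℂ, levi l) 𝓘(ℂ, E) ω (fun y : levi l => ρ y)
      {y : levi l | NonResonant (y : LieAlg E G)} := hρ.comp hi.contMDiffOn fun y hy => hy
  have ho : IsOpen {y : levi l | NonResonant (y : LieAlg E G)} :=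
    isOpen_nonResonant.preimage continuous_subtype_val
  refine eqOn_of_preconnected_of_eventuallyEq ho isPreconnected_nonResonant_inter h1
    (contMDiffOn_const (c := (1 : G))) (x₀ := ⟨s, cartan_le_levi hB s.2⟩) hs'.1 ?_
    (show (⟨x, hx⟩ : levi l) ∈ _ from hxn)
  filter_upwards [eventually_exists_Ad_eq hB l hs] with y hy
  obtain ⟨g, hg, s', hs', hy⟩ := hy
  have h3 := congrArg Prod.fst (hν (g, s') hs' hg)
  change ρ (Ad g (s' : LieAlg E G)) * g = g at h3
  rw [hy]
  exact mul_eq_right.1 h3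

theorem gaugeEquation_of_nu (hB : IsInvariantForm B)
    (hBinv : ∀ (g : G) (x y : LieAlg E G), B (Ad g x) (Ad g y) = B x y)
    {P : Finset (Module.Dual ℂ t)} (hP : IsPositiveSystem t P) {e : Module.Dual ℂ t → LieAlg E G}
    (he : IsRootVectors t B e)
    (hρ : ContMDiffOn 𝓘(ℂ, LieAlg E G) 𝓘(ℂ, E) ω ρ {x | NonResonant x})
    (heq : IsEquivariant (integralSubgroup (levi l)) ρ)
    (hν : IsLocallySymplectic B P e l (nu (t := t) ρ)) : GaugeEquation B P e l ρ := by
  obtain ⟨s, hs, hs'⟩ := exists_mem_regularSet_gaugeDomain (t := t) hB (leviSS l)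
  have hρ' : ∀ x, NonResonant x → ContMDiffAt 𝓘(ℂ, LieAlg E G) 𝓘(ℂ, E) ω ρ x := fun x hx =>
    hρ.contMDiffAt (isOpen_nonResonant.mem_nhds hx)
  intro x hx hxp
  refine sub_eq_zero.1 ((Module.forall_dual_apply_eq_zero_iff ℂ _).1 fun β => ?_)
  rw [map_sub β, sub_eq_zero]
  have hL : AnalyticOnNhd ℂ (fun y => β (rAM B (B y) - Ad₂ (ρ y)⁻¹ (rAMsub B (leviSS l) y)))
      (gaugeDomain B (leviSS l)) := by
    intro y hy
    simp only [map_sub]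
    exact ((contDiffAt_dual_rAM hB hy.1 β).sub
      (contDiffAt_dual_rAMsub (hρ' y hy.1) hy.2 β)).analyticAt
  have hR : AnalyticOnNhd ℂ
      (fun y => β (gaugeTransform B ρ (rStd e P - rStd e (leviRoots P l)) y))
      (gaugeDomain B (leviSS l)) := fun y hy =>
    (contDiffAt_dual_gaugeTransform hB (hρ' y hy.1) _ β).analyticAt
  -- Near s every point is Ad_g s' with s' ∈ t', so the bivector identity at (g, s') gives the gauge
  -- equation there. Analyticity carries it over the connected domain.
  refine hL.eqOn_of_preconnected_of_eventuallyEq hR isPreconnected_gaugeDomain hs' ?_ ⟨hx, hxp⟩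
  filter_upwards [eventually_exists_Ad_eq_top hB hs, isOpen_gaugeDomain.mem_nhds hs'] with y hy hyd
  obtain ⟨g, s', hs', rfl⟩ := hy
  have hn := nonResonant_momentMap hB (p := (g, s')) hs'
  exact congrArg β ((map_piG1_eq_iff hB hBinv hP he heq (p := (g, s')) hs'
    ((hρ' _ hn).mdifferentiableAt (by simp))).1 (hν.map_bivector (g, s') hs' hyd.2))

end Converse

end RelGW

open RelGW in
theorem proposition6p5
    {E : Type*} [NormedAddCommGroup E] [NormedSpace ℂ E] [FiniteDimensional ℂ E]
    {G : Type*} [TopologicalSpace G] [T2Space G] [ChartedSpace E G] [Group G]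
    [LieGroup 𝓘(ℂ, E) ω G]
    [LieAlgebra.HasCentralRadical ℂ (LieAlg E G)]
    (B : LinearMap.BilinForm ℂ (LieAlg E G)) (hBsymm : B.IsSymm) (hBnd : B.Nondegenerate)
    (hBinv : ∀ (g : G) (x y : LieAlg E G), B (Ad g x) (Ad g y) = B x y)
    (t : LieSubalgebra ℂ (LieAlg E G)) [t.IsCartanSubalgebra]
    (P : Finset (Module.Dual ℂ t)) (hP : IsPositiveSystem t P)
    (e : Module.Dual ℂ t → LieAlg E G) (he : IsRootVectors t B e)
    (l : t)
    (ρ : LieAlg E G → G)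
    (hρ : ContMDiffOn 𝓘(ℂ, LieAlg E G) 𝓘(ℂ, E) ω ρ {x | NonResonant x}) :
    (IsEquivariant (integralSubgroup (levi l)) ρ →
      (GaugeEquation B P e l ρ ↔
        IsSliceEquivariant (integralSubgroup (levi l)) (nu (t := t) ρ) ∧
          IsLocallySymplectic B P e l (nu (t := t) ρ))) ∧
    (IsRelativeTwist B P e l ρ ↔ IsRelativeLinearization B P e l (nu (t := t) ρ)) := by
  have hB := isInvariantForm_of_Ad B hBsymm hBnd hBinv
  have hgauge := fun heq => gaugeEquation_of_nu (l := l) hB hBinv hP he hρ heq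
  have hsymp := isLocallySymplectic_nu (l := l) hB hBinv hP he hρ
  refine ⟨fun heq => ⟨fun hg => ⟨isSliceEquivariant_nu hB heq, hsymp heq hg⟩,
    fun hν => hgauge heq hν.2⟩, fun h => ?_, fun h => ?_⟩
  · exact ⟨isSliceEquivariant_nu hB h.equivariant, hsymp h.equivariant h.gauge,
      fun p hp hp1 => nu_eq_self hB h.eq_one hp hp1⟩
  · have heq := isEquivariant_of_nu hB hρ h.equivariant
    exact ⟨heq, hgauge heq h.symplectic, eq_one_of_nu hB hρ h.eq_self⟩
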